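/- **Theorem.** Let $p=e_*+h_*+2s_*$; indices are $1\le e\le e_*$, $e_*<h\le e_*+h_*$, $e_*+h_*<s\le p-s_*$, and $j$ runs over $1,\dots,p$. Let $M\subset\mathbf C^{2p}$ be a real analytic submanifold $z_{p+j}=E_j(z',\bar z')$, $E=Q+O(3)$, where $z'=(z_1,\dots,z_p)$ and $Q$ is a product quadric: a product of Bishop quadrics $z_{p+j}=|z_j|^2+\gamma_j(z_j^2+\bar z_j^2)$ with $0<\gamma_e<\tfrac12$, $\tfrac12<\gamma_h<\infty$, and of quadrics $z_{p+s}=(z_s+2\gamma_s\bar z_{s+s_*})^2$, $z_{p+s+s_*}=(z_{s+s_*}+2(1-\bar\gamma_s)\bar z_s)^2$ with $\operatorname{Re}\gamma_s<\frac12$, $\operatorname{Im}\gamma_s>0$. Assume that $M$ satisfies condition D: the projection $\pi_1(z',w')=(z',E(z',w'))$ of the complexification of $M$ has $2^p$ deck transformations (biholomorphic germs $\tau(z',w')=(z',f(z',w'))$ at $0$ with $\tau(0)=0$, $E\circ\tau=E$). Let $\tau_1$ be the unique one whose fixed-point set has dimension $p$, $\rho_0(z',w')=(\bar w',\bar z')$,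 $\tau_2=\rho_0\tau_1\rho_0$, $\sigma=\tau_1\tau_2$. On $\mathbf C^{2p}$ with coordinates $(\xi,\eta)$ let $\rho$ be the antiholomorphic involution $\xi_e'=\bar\eta_e,\ \eta_e'=\bar\xi_e,\ \xi_h'=\bar\xi_h,\ \eta_h'=\bar\eta_h,\ \xi_s'=\bar\xi_{s+s_*},\ \xi_{s+s_*}'=\bar\xi_s,\ \eta_s'=\bar\eta_{s+s_*},\ \eta_{s+s_*}'=\bar\eta_s$. Let $\lambda_e>1$, $|\lambda_h|=1$, $|\lambda_s|>1$, $\lambda_{s+s_*}=\bar\lambda_s^{-1}$, and let $\mu_j=\lambda_j^2$ be non-resonant: $\mu^P\ne1$ for all $P\in\mathbf Z^p\setminus\{0\}$. Suppose that there are formal coordinates $(\xi,\eta)$ in which $\rho_0$ becomes $\rho$, the linear part of $\tau_1$ becomes $\xi_j'=\lambda_j\eta_j,\ \eta_j'=\lambda_j^{-1}\xi_j$, and $\sigma$ becomes $$\hat\sigma:\ \xi_j'=\hat M_j(\xi\eta)\xi_j,\quad \eta_j'=\hat M_j(\xi\eta)^{-1}\eta_j,\qquad \xi\eta=(\xi_1\eta_1,\dots,\xi_p\eta_p),\quad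 \hat M_j(0)=\mu_j ,$$ where $\log\hat M(\zeta)$, with components $\log(\hat M_j/\mu_j)$ for $j\le e_*$ and $-i\log(\hat M_j/\mu_j)$ for $j>e_*$, is tangent to the identity and the $j$-th component of $\log\hat M(\zeta)-\zeta$ is independent of $\zeta_j$. Let $\hat\Lambda_j^2=\hat M_j$, $\hat\Lambda_j(0)=\lambda_j$, and $\hat\tau_1:\xi_j'=\hat\Lambda_j(\xi\eta)\eta_j,\ \eta_j'=\hat\Lambda_j(\xi\eta)^{-1}\xi_j$; let $\hat\tau_{1j}$ act by the same formula on $(\xi_j,\eta_j)$ and fix the other coordinates. Let $E_{\hat\Lambda}$ be the inverse of the formal map $(\xi,\eta)\mapsto(\xi+\hat\Lambda(\xi\eta)\eta,\ \eta-\hat\Lambda(\xi\eta)^{-1}\xi)$ (componentwise products), so that $\hat\tau_{1j}=E_{\hat\Lambda}Z_jE_{\hat\Lambda}^{-1}$, where $Z_j$ changes the sign of $\eta_j$; $E_{\hat\Lambda(0)}$ is the corresponding linear map. $\mathcal C(\hat\tau_1)$ is the set of formal maps fixing $0$ and commuting with $\hat\tau_1$. $\mathcal C^{c}(\hat\tau_{11},\dots,\hat\tau_{1p})$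 is the set of maps $E_{\hat\Lambda}\phi E_{\hat\Lambda}^{-1}$, where $\phi$ is tangent to the identity and its terms of degree $\ge2$ contain no monomial that is even in every $\eta_k$ in the $\xi$-components, and no monomial that is odd in $\eta_j$ and even in each $\eta_k$, $k\ne j$, in the $\eta_j$-component. For a formal biholomorphic map $\Psi\in\mathcal C(\hat\tau_1)\cap\mathcal C^c(\hat\tau_{11},\dots,\hat\tau_{1p})$ tangent to the identity, let $(U,V)=E_{\hat\Lambda(0)}E_{\hat\Lambda}^{-1}\Psi^{-1}$. Then the equations $$z_j=U_j(\xi,\eta)+\lambda_jV_j(\xi,\eta),\qquad \bar z_j=\overline{U_j\circ\rho(\xi,\eta)}+\bar\lambda_j\overline{V_j\circ\rho(\xi,\eta)}$$ can be solved for $(\xi,\eta)$ as formal power series in $(z',\bar z')$, and $$\tilde M_\Psi:\ z_{p+j}=\bigl(\lambda_j^{-1}U_j(\xi,\eta)-V_j(\xi,\eta)\bigr)^2,\quad 1\le j\le p,$$ is a formal submanifold. Moreover: 1. $M$ is formally equivalent to $\tilde M_\Psi$ for some such $\Psi$. 2. If $M$ is formally equivalent to $\tilde M_\Psi$, then, for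 $\Psi'$ in the same class, $M$ is formally equivalent to $\tilde M_{\Psi'}$ if and only if $\Psi'=R_\epsilon\Psi R_\epsilon^{-1}$ for some $R_\epsilon:(\xi_j,\eta_j)\mapsto(\epsilon_j\xi_j,\epsilon_j\eta_j)$ with $\epsilon_j=\pm1$, $\epsilon_{s+s_*}=\epsilon_s$ (i.e. $R_\epsilon$ commutes with $\rho$). 3. For such $\Psi$, the group of formal biholomorphic maps of $(\mathbf C^{2p},0)$ that preserve $\tilde M_\Psi$ consists exactly of the maps $L_\epsilon: z_j\mapsto\epsilon_jz_j,\ z_{p+j}\mapsto z_{p+j}$ with $\epsilon_j=\pm1$, $\epsilon_{s+s_*}=\epsilon_s$ and $R_\epsilon\Psi=\Psi R_\epsilon$. 4. If some convergent change of coordinates brings $\sigma$ to a Poincaré–Dulac normal form (i.e. to a map commuting with its linear part), then for such $\Psi$ the series defining $\tilde M_\Psi$ converge and $M$ is holomorphically equivalent to $\tilde M_\Psi$. -/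

import Mathlib

noncomputable section

namespace CRNormalForm

open MvPowerSeries

/-! ### Formal and convergent power series -/

/-- A power series in finitely many variables is convergent (the germ of a holomorphic function)
iff its coefficients have at most geometric growth. -/
def IsConvergent {V : Type} (f : MvPowerSeries V ℂ) : Prop :=
  ∃ C r : ℝ, 0 < r ∧ ∀ n : V →₀ ℕ, ‖coeff n f‖ ≤ C * r ^ n.degree

/-- For an antiholomorphic involution of the form `x ↦ (fun k => conj (x (π k)))`, where `π` is an
involutive permutation of the coordinates, and a power series `f`, this is the power series of the
function `x ↦ conj (f (conj (x ∘ π)))`. -/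
def conjPull {V : Type} (π : V → V) (f : MvPowerSeries V ℂ) : MvPowerSeries V ℂ :=
  subst (fun k => (X (π k) : MvPowerSeries V ℂ)) (MvPowerSeries.map (starRingEnd ℂ) f)

/-- Formal maps of `ℂ^V` to itself fixing the origin. -/
@[ext] structure FormalMap (V : Type) where
  comp : V → MvPowerSeries V ℂ
  zero_at : ∀ i, constantCoeff (comp i) = 0

namespace FormalMap

variable {V : Type}

theorem hasSubst [Finite V] (F : FormalMap V) : HasSubst F.comp :=
  hasSubst_of_constantCoeff_zero F.zero_at

/-- Formal maps form a monoid: `F * G` is the composition `x ↦ F (G x)` and `1` is the identity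
map. The units of this monoid are the formal biholomorphisms. -/
instance [Finite V] : Monoid (FormalMap V) where
  one := ⟨fun i => X i, fun i => constantCoeff_X i⟩
  mul F G := ⟨fun i => subst G.comp (F.comp i), fun i =>
    constantCoeff_subst_eq_zero G.hasSubst G.zero_at (F.zero_at i)⟩
  mul_assoc F G H := by
    ext1
    funext i
    exact subst_comp_subst_apply G.hasSubst H.hasSubst (F.comp i)
  one_mul F := by
    ext1
    funext i
    exact subst_X F.hasSubst i
  mul_one F := by
    ext1
    funext i
    exact congrFun subst_self (F.comp i)

/-- The Jacobian matrix at the origin. -/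
def jac (F : FormalMap V) : Matrix V V ℂ :=
  Matrix.of fun i k => coeff (Finsupp.single k 1) (F.comp i)

/-- The linear part at the origin, as a formal map. -/
def linPart [Fintype V] (F : FormalMap V) : FormalMap V :=
  ⟨fun i => ∑ k, C (F.jac i k) * X k, fun i => by simp⟩

/-- `F` is tangent to the identity. -/
def TangentToId [DecidableEq V] (F : FormalMap V) : Prop := F.jac = 1

/-- All components converge. -/
def Convergent (F : FormalMap V) : Prop := ∀ i, IsConvergent (F.comp i)

/-- `ρ₁ ∘ F ∘ ρ₂`, where `ρ₁`, `ρ₂` are the antiholomorphic involutions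
`x ↦ (fun k => conj (x (πᵢ k)))`. -/
def conjBy [Finite V] (π₁ π₂ : V → V) (F : FormalMap V) : FormalMap V :=
  ⟨fun i => conjPull π₂ (F.comp (π₁ i)), fun i =>
    constantCoeff_subst_eq_zero
      (hasSubst_of_constantCoeff_zero fun k => constantCoeff_X (π₂ k))
      (fun k => constantCoeff_X (π₂ k)) (by simp [F.zero_at])⟩

open Classical in
/-- The inverse of a formal biholomorphism (the identity if `F` is not invertible). -/
def inv [Finite V] (F : FormalMap V) : FormalMap V :=
  if hF : IsUnit F then ((hF.unit⁻¹ : (FormalMap V)ˣ) : FormalMap V) else 1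

/-- `F` commutes with its linear part. For a map whose linear part is diagonalizable this says
that it is in Poincaré-Dulac normal form. -/
def IsPoincareDulac [Fintype V] (F : FormalMap V) : Prop := Commute F F.linPart

end FormalMap

/-! ### Submanifolds `z'' = E(z', conj z')` of `ℂ^{2p}` with maximal complex tangent space

`p` is the cardinality of the index type `I`. In a series in the variables `I ⊕ I`, the left copy
stands for `z'` and the right copy for `w'`, to be replaced by the conjugate of `z'`. For maps of
the ambient space `ℂ^{2p}` the left copy stands for `z'` and the right copy for `z''`. In
`(ξ, η)`-space, the left copy stands for `ξ` and the right copy for `η`. -/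

section Manifold

variable {I : Type} [Fintype I]

/-- The components of `F(z', E(z', w'))`. -/
def alongGraph (E : I → MvPowerSeries (I ⊕ I) ℂ) (F : FormalMap (I ⊕ I)) (i : I ⊕ I) :
    MvPowerSeries (I ⊕ I) ℂ :=
  subst (Sum.elim (fun j => (X (Sum.inl j) : MvPowerSeries (I ⊕ I) ℂ)) E) (F.comp i)

/-- `F` maps `z'' = E₁(z', conj z')` into `z'' = E₂(z', conj z')`: with `z'`, `w'` independent,
`F''(z', E₁(z', w')) = E₂ (F'(z', E₁(z', w')), conj (F'(z', E₁(z', w')))` at `(conj w', conj z'))`. -/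
def MapsManifold (F : FormalMap (I ⊕ I)) (E₁ E₂ : I → MvPowerSeries (I ⊕ I) ℂ) : Prop :=
  ∀ j, alongGraph E₁ F (Sum.inr j) =
    subst (Sum.elim (fun k => alongGraph E₁ F (Sum.inl k))
      (fun k => conjPull Sum.swap (alongGraph E₁ F (Sum.inl k)))) (E₂ j)

/-- Formal equivalence of the two submanifolds. -/
def FormallyEquivalent (E₁ E₂ : I → MvPowerSeries (I ⊕ I) ℂ) : Prop :=
  ∃ F : (FormalMap (I ⊕ I))ˣ, MapsManifold (F : FormalMap (I ⊕ I)) E₁ E₂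

/-- Holomorphic equivalence of the two submanifolds. -/
def HolomorphicallyEquivalent (E₁ E₂ : I → MvPowerSeries (I ⊕ I) ℂ) : Prop :=
  ∃ F : (FormalMap (I ⊕ I))ˣ, (F : FormalMap (I ⊕ I)).Convergent ∧
    MapsManifold (F : FormalMap (I ⊕ I)) E₁ E₂

/-- The deck transformations of the projection `π₁ : (z', w') ↦ (z', E(z', w'))` of the
complexification: the holomorphic maps `(z', w') ↦ (z', f(z', w'))`, invertible and fixing the
origin, with `E ∘ τ = E`. -/
def deckTransformations (E : I → MvPowerSeries (I ⊕ I) ℂ) : Set (FormalMap (I ⊕ I))ˣ :=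
  {τ | (τ : FormalMap (I ⊕ I)).Convergent ∧
    (∀ j, (τ : FormalMap (I ⊕ I)).comp (Sum.inl j) = X (Sum.inl j)) ∧
    ∀ j, subst (τ : FormalMap (I ⊕ I)).comp (E j) = E j}

/-- Condition D: `π₁` has the maximal number `2 ^ p` of deck transformations. -/
def ConditionD (E : I → MvPowerSeries (I ⊕ I) ℂ) : Prop :=
  (deckTransformations E).ncard = 2 ^ Fintype.card I

/-- The deck transformation `τ₁` whose fixed-point set has the smallest possible dimension `p`.
(Deck transformations have finite order, so they are linearizable and the dimension of the
fixed-point set is that of the eigenspace of the linear part for the eigenvalue `1`.) -/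
def IsPrincipalDeck [DecidableEq I] (E : I → MvPowerSeries (I ⊕ I) ℂ)
    (τ : (FormalMap (I ⊕ I))ˣ) : Prop :=
  τ ∈ deckTransformations E ∧
    Module.finrank ℂ (LinearMap.ker
      (Matrix.toLin' ((τ : FormalMap (I ⊕ I)).jac - 1))) = Fintype.card I

/-- `σ = τ₁ τ₂` with `τ₂ = ρ₀ τ₁ ρ₀`, where `ρ₀ (z', w') = (conj w', conj z')`. -/
def sigmaOf (τ : FormalMap (I ⊕ I)) : FormalMap (I ⊕ I) :=
  τ * FormalMap.conjBy Sum.swap Sum.swap τ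

end Manifold

/-! ### Product quadrics -/

/-- Indices `1, …, p`, `p = e + h + 2 s`, split into the elliptic, the hyperbolic, and the two
groups of complex indices; the `k`-th elements of the last two groups form the pair written as
`s`, `s + s_*`. -/
abbrev Idx (e h s : ℕ) : Type := Fin e ⊕ Fin h ⊕ Fin s ⊕ Fin s

/-- Elliptic, hyperbolic and complex indices. -/
abbrev iE {e h s : ℕ} (k : Fin e) : Idx e h s := Sum.inl k
abbrev iH {e h s : ℕ} (k : Fin h) : Idx e h s := Sum.inr (Sum.inl k)
abbrev iS {e h s : ℕ} (k : Fin s) : Idx e h s := Sum.inr (Sum.inr (Sum.inl k))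
abbrev iT {e h s : ℕ} (k : Fin s) : Idx e h s := Sum.inr (Sum.inr (Sum.inr k))

/-- The invariants of a product quadric, with `e` elliptic, `h` hyperbolic and `s` complex
components. -/
structure QuadricInvariants (e h s : ℕ) where
  ell : Fin e → ℝ
  ell_pos : ∀ k, 0 < ell k
  ell_lt : ∀ k, ell k < 1 / 2
  hyp : Fin h → ℝ
  hyp_gt : ∀ k, 1 / 2 < hyp k
  cpx : Fin s → ℂ
  cpx_re : ∀ k, (cpx k).re < 1 / 2
  cpx_im : ∀ k, 0 < (cpx k).im

variable {e h s : ℕ}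

abbrev zv (j : Idx e h s) : MvPowerSeries (Idx e h s ⊕ Idx e h s) ℂ := X (Sum.inl j)
abbrev wv (j : Idx e h s) : MvPowerSeries (Idx e h s ⊕ Idx e h s) ℂ := X (Sum.inr j)

/-- The product quadric: the Bishop quadrics `z₂ = |z₁|² + γ (z₁² + conj z₁ ²)` and the quadrics
`z₃ = (z₁ + 2 γ conj z₂)²`, `z₄ = (z₂ + 2 (1 - conj γ) conj z₁)²`. -/
def QuadricInvariants.quadric (g : QuadricInvariants e h s) :
    Idx e h s → MvPowerSeries (Idx e h s ⊕ Idx e h s) ℂ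
  | .inl k => zv (iE k) * wv (iE k) + C (g.ell k : ℂ) * (zv (iE k) ^ 2 + wv (iE k) ^ 2)
  | .inr (.inl k) => zv (iH k) * wv (iH k) + C (g.hyp k : ℂ) * (zv (iH k) ^ 2 + wv (iH k) ^ 2)
  | .inr (.inr (.inl k)) => (zv (iS k) + C (2 * g.cpx k) * wv (iT k)) ^ 2
  | .inr (.inr (.inr k)) => (zv (iT k) + C (2 * (1 - starRingEnd ℂ (g.cpx k))) * wv (iS k)) ^ 2

/-- `E = Q + O(3)`. -/
def IsHigherOrderPerturbation {I : Type} (E Q : I → MvPowerSeries (I ⊕ I) ℂ) : Prop :=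
  ∀ j, ∀ n : I ⊕ I →₀ ℕ, n.degree < 3 → coeff n (E j) = coeff n (Q j)

/-! ### Normal forms of `σ`, `τ₁`, `τ₂`, `ρ` -/

/-- The coordinate permutation of the normalized antiholomorphic involution `ρ`, that is
`ρ : ξ_e' = conj η_e, η_e' = conj ξ_e, ξ_h' = conj ξ_h, η_h' = conj η_h, ξ_s' = conj ξ_{s+s_*},
ξ_{s+s_*}' = conj ξ_s, η_s' = conj η_{s+s_*}, η_{s+s_*}' = conj η_s`. -/
def rhoPerm : Idx e h s ⊕ Idx e h s → Idx e h s ⊕ Idx e h s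
  | .inl (.inl k) => .inr (iE k)
  | .inr (.inl k) => .inl (iE k)
  | .inl (.inr (.inl k)) => .inl (iH k)
  | .inr (.inr (.inl k)) => .inr (iH k)
  | .inl (.inr (.inr (.inl k))) => .inl (iT k)
  | .inl (.inr (.inr (.inr k))) => .inl (iS k)
  | .inr (.inr (.inr (.inl k))) => .inr (iT k)
  | .inr (.inr (.inr (.inr k))) => .inr (iS k)

/-- The normalization of the `λ_j`: `λ_e > 1`, `|λ_h| = 1`, `|λ_s| > 1`,
`λ_{s+s_*} = (conj λ_s)⁻¹`. -/
structure NormalizedMultipliers (lam : Idx e h s → ℂ) : Prop where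
  ell : ∀ k : Fin e, ∃ r : ℝ, 1 < r ∧ lam (iE k) = (r : ℂ)
  hyp : ∀ k : Fin h, ‖lam (iH k)‖ = 1
  cpx : ∀ k : Fin s, 1 < ‖lam (iS k)‖
  cpx_pair : ∀ k : Fin s, lam (iT k) = (starRingEnd ℂ (lam (iS k)))⁻¹

/-- `μ^Q ≠ 1` for all integer vectors `Q ≠ 0`. -/
def NonResonant {I : Type} [Fintype I] (mu : I → ℂ) : Prop :=
  ∀ Q : I → ℤ, Q ≠ 0 → ∏ j, mu j ^ Q j ≠ 1

/-- `f(ξη)`, `ξη = (ξ_1 η_1, …, ξ_p η_p)`. -/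
def ofProd {I : Type} [Fintype I] (f : MvPowerSeries I ℂ) : MvPowerSeries (I ⊕ I) ℂ :=
  subst (fun k => (X (Sum.inl k) * X (Sum.inr k) : MvPowerSeries (I ⊕ I) ℂ)) f

section Forms

variable {I : Type} [Fintype I]

/-- `ξ_j' = M_j(ξη) ξ_j`, `η_j' = M_j(ξη)⁻¹ η_j`. -/
def hatSigma (M : I → MvPowerSeries I ℂ) : FormalMap (I ⊕ I) :=
  ⟨Sum.elim (fun j => ofProd (M j) * X (Sum.inl j)) (fun j => ofProd (M j)⁻¹ * X (Sum.inr j)),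
    by rintro (j | j) <;> simp⟩

/-- `ξ_j' = Λ_j(ξη) η_j`, `η_j' = Λ_j(ξη)⁻¹ ξ_j`. -/
def hatTau (L : I → MvPowerSeries I ℂ) : FormalMap (I ⊕ I) :=
  ⟨Sum.elim (fun j => ofProd (L j) * X (Sum.inr j)) (fun j => ofProd (L j)⁻¹ * X (Sum.inl j)),
    by rintro (j | j) <;> simp⟩

/-- The map `(ξ, η) ↦ (ξ + Λ(ξη) η, η - Λ(ξη)⁻¹ ξ)`. It conjugates
`τ̂_{1j} : ξ_j' = Λ_j(ξη) η_j, η_j' = Λ_j(ξη)⁻¹ ξ_j, ξ_k' = ξ_k, η_k' = η_k (k ≠ j)`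
to the sign change `Z_j` of the coordinate `η_j`. Its inverse is the map `E_Λ` with
`τ̂_{1j} = E_Λ Z_j E_Λ⁻¹`. -/
def straighten (L : I → MvPowerSeries I ℂ) : FormalMap (I ⊕ I) :=
  ⟨Sum.elim (fun j => X (Sum.inl j) + ofProd (L j) * X (Sum.inr j))
    (fun j => X (Sum.inr j) - ofProd (L j)⁻¹ * X (Sum.inl j)),
    by rintro (j | j) <;> simp⟩

/-- The linear map `E_{Λ(0)} : (ξ, η) ↦ ((ξ - Λ(0) η) / 2, (Λ(0)⁻¹ ξ + η) / 2)`, where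
`Λ(0) = diag (λ_1, …, λ_p)`; it is the inverse of the linear part of `straighten`. -/
def linearE (lam : I → ℂ) : FormalMap (I ⊕ I) :=
  ⟨Sum.elim (fun j => C (1 / 2 : ℂ) * (X (Sum.inl j) - C (lam j) * X (Sum.inr j)))
    (fun j => C (1 / 2 : ℂ) * (C (lam j)⁻¹ * X (Sum.inl j) + X (Sum.inr j))),
    by rintro (j | j) <;> simp⟩

/-- The complement `C^c(Z_1, …, Z_p)` of the centralizer of the sign changes `Z_j` of the
coordinates `η_j`: the maps tangent to the identity whose nonlinear part has no monomial that
occurs in maps commuting with all the `Z_j`, that is, no monomial even in every `η_k` in the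
`ξ`-components, and no monomial odd in `η_j` and even in the other `η_k` in the
`η_j`-component. -/
def IsComplementZ [DecidableEq I] (F : FormalMap (I ⊕ I)) : Prop :=
  F.TangentToId ∧
  (∀ j, ∀ n : I ⊕ I →₀ ℕ, 2 ≤ n.degree → (∀ k, Even (n (Sum.inr k))) →
    coeff n (F.comp (Sum.inl j)) = 0) ∧
  (∀ j, ∀ n : I ⊕ I →₀ ℕ, 2 ≤ n.degree → Odd (n (Sum.inr j)) →
    (∀ k, k ≠ j → Even (n (Sum.inr k))) → coeff n (F.comp (Sum.inr j)) = 0)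

/-- `Ψ` lies in `C(τ̂₁) ∩ C^c(τ̂₁₁, …, τ̂₁ₚ)` and is tangent to the identity. Here
`C^c(τ̂₁₁, …, τ̂₁ₚ)` consists of the conjugates `E_Λ φ E_Λ⁻¹` with `φ` in `C^c(Z_1, …, Z_p)`. -/
def IsNormalizedPsi [DecidableEq I] (L : I → MvPowerSeries I ℂ) (Ψ : (FormalMap (I ⊕ I))ˣ) :
    Prop :=
  (Ψ : FormalMap (I ⊕ I)).TangentToId ∧
  Commute (Ψ : FormalMap (I ⊕ I)) (hatTau L) ∧
  ∃ φ : FormalMap (I ⊕ I), IsComplementZ φ ∧ straighten L * Ψ = φ * straighten L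

/-- `(U, V) = E_{Λ(0)} E_Λ⁻¹ Ψ⁻¹`; `U` is the left half and `V` the right half. -/
def mapUV (lam : I → ℂ) (L : I → MvPowerSeries I ℂ) (Ψ : (FormalMap (I ⊕ I))ˣ) :
    FormalMap (I ⊕ I) :=
  linearE lam * straighten L * ((Ψ⁻¹ : (FormalMap (I ⊕ I))ˣ) : FormalMap (I ⊕ I))

/-- `R_ε : ξ_j' = ε_j ξ_j, η_j' = ε_j η_j`. -/
def mapR (ε : I → ℂ) : FormalMap (I ⊕ I) :=
  ⟨Sum.elim (fun j => C (ε j) * X (Sum.inl j)) (fun j => C (ε j) * X (Sum.inr j)),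
    by rintro (j | j) <;> simp⟩

/-- `L_ε : z_j' = ε_j z_j, z_{p+j}' = z_{p+j}`. -/
def mapL (ε : I → ℂ) : FormalMap (I ⊕ I) :=
  ⟨Sum.elim (fun j => C (ε j) * X (Sum.inl j)) (fun j => X (Sum.inr j)),
    by rintro (j | j) <;> simp⟩

end Forms

/-- `ε ∈ {1, -1}^p` with `ε_{s+s_*} = ε_s`, i.e. `R_ε` is an involution commuting with `ρ`. -/
def IsRealSign (ε : Idx e h s → ℂ) : Prop :=
  (∀ j, ε j = 1 ∨ ε j = -1) ∧ ∀ k : Fin s, ε (iT k) = ε (iS k)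

/-- `log (f / f(0))`. -/
def logQuot {I : Type} (f : MvPowerSeries I ℂ) : MvPowerSeries I ℂ :=
  PowerSeries.subst (C (constantCoeff f)⁻¹ * f - 1) (PowerSeries.log ℂ)

/-- `(log M)_j = log (M_j / M_j(0))` for elliptic `j` and `-i log (M_j / M_j(0))` for the other
`j`. -/
def logM (M : Idx e h s → MvPowerSeries (Idx e h s) ℂ) :
    Idx e h s → MvPowerSeries (Idx e h s) ℂ
  | .inl k => logQuot (M (.inl k))
  | .inr k => C (-Complex.I) * logQuot (M (.inr k))

/-- `F` is tangent to the identity, and the `j`-th component of `F(ζ) - ζ` does not depend on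
`ζ_j`. -/
def IsRestNormalForm {I : Type} (F : I → MvPowerSeries I ℂ) : Prop :=
  ∀ j, ∀ n : I →₀ ℕ, coeff n (F j - X j) ≠ 0 → 2 ≤ n.degree ∧ n j = 0

/-- The `σ` associated with `τ₁` has the formal normal form `σ̂` given by `M`: there are formal
coordinates `(ξ, η)` in which `ρ₀` becomes `ρ`, `σ` becomes `σ̂`, and the linear part of `τ₁` is
`ξ_j' = λ_j η_j, η_j' = λ_j⁻¹ ξ_j`. -/
def HasSigmaNormalForm (τ : FormalMap (Idx e h s ⊕ Idx e h s)) (lam : Idx e h s → ℂ)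
    (M : Idx e h s → MvPowerSeries (Idx e h s) ℂ) : Prop :=
  ∃ Θ : (FormalMap (Idx e h s ⊕ Idx e h s))ˣ,
    FormalMap.conjBy Sum.swap rhoPerm (Θ : FormalMap (Idx e h s ⊕ Idx e h s)) = Θ ∧
    sigmaOf τ * Θ = Θ * hatSigma M ∧
    (τ * Θ).jac = ((Θ : FormalMap (Idx e h s ⊕ Idx e h s)) * hatTau fun j => C (lam j)).jac

/-- `σ` is brought to a Poincaré-Dulac normal form by a convergent change of coordinates. -/
def HasConvergentPoincareDulac {V : Type} [Fintype V] (σ : FormalMap V) : Prop :=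
  ∃ (Θ : (FormalMap V)ˣ) (σ' : FormalMap V), (Θ : FormalMap V).Convergent ∧
    σ * Θ = Θ * σ' ∧ σ'.IsPoincareDulac

/-! ### The normal form of the submanifold -/

/-- The change of coordinates `(ξ, η) ↦ (z', w')`, `z_j = U_j + λ_j V_j`,
`w_j = conj (U_j ∘ ρ) + conj λ_j conj (V_j ∘ ρ)`. -/
def normalPhi (lam : Idx e h s → ℂ) (L : Idx e h s → MvPowerSeries (Idx e h s) ℂ)
    (Ψ : (FormalMap (Idx e h s ⊕ Idx e h s))ˣ) : FormalMap (Idx e h s ⊕ Idx e h s) :=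
  let f : Idx e h s → MvPowerSeries (Idx e h s ⊕ Idx e h s) ℂ := fun j =>
    (mapUV lam L Ψ).comp (Sum.inl j) + C (lam j) * (mapUV lam L Ψ).comp (Sum.inr j)
  have hf : ∀ j, constantCoeff (f j) = 0 := fun j => by
    simp [f, (mapUV lam L Ψ).zero_at]
  ⟨Sum.elim f (fun j => conjPull rhoPerm (f j)), by
    rintro (j | j)
    · exact hf j
    · exact constantCoeff_subst_eq_zero
        (hasSubst_of_constantCoeff_zero fun k => constantCoeff_X (rhoPerm k))
        (fun k => constantCoeff_X (rhoPerm k)) (by simp [hf j])⟩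

/-- The defining function of the normal form
`z_{p+j} = (λ_j⁻¹ U_j(ξ, η) - V_j(ξ, η))²`, with `(ξ, η)` expressed through `z'` and
`w' = conj z'` by inverting `normalPhi`. -/
def normalE (lam : Idx e h s → ℂ) (L : Idx e h s → MvPowerSeries (Idx e h s) ℂ)
    (Ψ : (FormalMap (Idx e h s ⊕ Idx e h s))ˣ) :
    Idx e h s → MvPowerSeries (Idx e h s ⊕ Idx e h s) ℂ := fun j =>
  subst (normalPhi lam L Ψ).inv.comp
    ((C (lam j)⁻¹ * (mapUV lam L Ψ).comp (Sum.inl j) - (mapUV lam L Ψ).comp (Sum.inr j)) ^ 2)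

end CRNormalForm

end

noncomputable section

namespace CRNormalForm

open MvPowerSeries

set_option linter.unusedSectionVars false

/-! The object to understand is the projection `(z', w') ↦ (z', E(z', w'))` of the complexification.
Averaging linearizes its finite group of deck transformations (`exists_linearization`). After the
shear that completes the squares in the quadric, their linear parts are sign changes of the second
block of coordinates, and condition D forces all 2^p sign changes to occur. Hence the projection is
F ∘ `sqMap` ∘ B, with F and B biholomorphic and `sqMap` the fold (x, y) ↦ (x, y²), and τ₁ becomes
the simultaneous sign change of all y_j (`exists_fold_coordinates`).

In the coordinates given for σ̂, both τ₁ and τ̂₁ factor σ̂ as an involution times its ρ-conjugate,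
so their product commutes with σ̂. Non-resonance makes such a map of the form ξ_j' = a_j(ξη)ξ_j,
η_j' = b_j(ξη)η_j, and ab = 1 because log M̂ is tangent to the identity
(`exists_of_commute_hatSigma`). A square root of this product conjugates τ₁ to τ̂₁ without
disturbing ρ or σ̂. This gives coordinates Θ in which ρ₀, τ₁ and σ are all in normal form
(`exists_coordinates`).

Write S = E_Λ̂⁻¹ (`straighten L`) and K = BΘ. The projection of the normal form, in its own real
coordinates, is `sqMap` ∘ S ∘ Ψ⁻¹ (`graphMap_normalE`). An equivalence of M with it is an outer map
together with an inner map T commuting with ρ, and it exists exactly when S Ψ⁻¹ T K⁻¹ descends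
through the fold (`Folds`). A descending map commutes with the simultaneous sign change, so T
commutes with τ̂₁, hence with σ̂, and only T = R_ε remains (`eq_mapR`).

What is left is a factorization problem: write Y = S K⁻¹ as φH with H descending and φ in the
complement of the centralizer of the sign changes. It is solved by `evenPart`, the average over
conjugation by sign changes, since right factors commuting with all sign changes pass through it
(`evenPart_mul`). The factorization exists because the linear part of Y descends (`folds_linPart`),
and its φ becomes SΨS⁻¹. Uniqueness up to R_ε (`eq_of_folds`) gives the uniqueness of Ψ and, applied
with the normal form itself as source, the automorphism group.

For convergence, a convergent Poincaré–Dulac form with multipliers m satisfies M̂ = m ∘ B with B: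
ζ_j ↦ (a_j b_j)(ζ) ζ_j. Because the j-th component of log M̂(ζ) - ζ is free of ζ_j, B can be solved
for on coordinate subspaces of growing dimension (`convergent_of_isRestNormalForm`). Square roots
then give the convergence of Λ̂ and Θ. Since `evenPart` preserves convergence, the factors φ and H
converge, and with them Ψ and the equivalence. -/

/-- The power series with given coefficients. -/
def ofCoeffs {V : Type} (c : (V →₀ ℕ) → ℂ) : MvPowerSeries V ℂ := c

@[simp] theorem coeff_ofCoeffs {V : Type} (c : (V →₀ ℕ) → ℂ) (n : V →₀ ℕ) :
    coeff n (ofCoeffs c) = c n := rfl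

/-! ### Agreement of power series up to a given degree -/

section Agree

variable {V W : Type}

/-- The coefficients of degree less than `d` coincide. -/
def AgreeTo (d : ℕ) (f g : MvPowerSeries V ℂ) : Prop :=
  ∀ n : V →₀ ℕ, n.degree < d → coeff n f = coeff n g

namespace AgreeTo

variable {d d' : ℕ} {f g h f' g' : MvPowerSeries V ℂ}

theorem refl (f : MvPowerSeries V ℂ) : AgreeTo d f f := fun _ _ => rfl

theorem symm (h₁ : AgreeTo d f g) : AgreeTo d g f := fun n hn => (h₁ n hn).symm

theorem trans (h₁ : AgreeTo d f g) (h₂ : AgreeTo d g h) : AgreeTo d f h :=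
  fun n hn => (h₁ n hn).trans (h₂ n hn)

theorem mono (h₁ : AgreeTo d f g) (hd : d' ≤ d) : AgreeTo d' f g :=
  fun n hn => h₁ n (hn.trans_le hd)

theorem add (h₁ : AgreeTo d f g) (h₂ : AgreeTo d f' g') : AgreeTo d (f + f') (g + g') :=
  fun n hn => by rw [map_add, map_add, h₁ n hn, h₂ n hn]

theorem sub (h₁ : AgreeTo d f g) (h₂ : AgreeTo d f' g') : AgreeTo d (f - f') (g - g') :=
  fun n hn => by rw [map_sub, map_sub, h₁ n hn, h₂ n hn]

theorem sub_zero_iff : AgreeTo d (f - g) 0 ↔ AgreeTo d f g := by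
  constructor
  · intro h n hn
    have := h n hn
    rwa [map_sub, coeff_zero, sub_eq_zero] at this
  · intro h n hn
    rw [map_sub, coeff_zero, h n hn, sub_self]

theorem mul_zero (h₁ : AgreeTo d f 0) (h₂ : AgreeTo d' g 0) : AgreeTo (d + d') (f * g) 0 := by
  classical
  intro n hn
  rw [coeff_mul, coeff_zero]
  refine Finset.sum_eq_zero fun p hp => ?_
  have hdeg : p.1.degree + p.2.degree = n.degree := by
    rw [← Finset.HasAntidiagonal.mem_antidiagonal.1 hp, map_add]
  rcases lt_or_ge p.1.degree d with h | h
  · rw [h₁ _ h, coeff_zero, zero_mul]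
  · rw [h₂ _ (by omega), coeff_zero, MulZeroClass.mul_zero]

theorem zero_deg (f g : MvPowerSeries V ℂ) : AgreeTo 0 f g := fun _ hn => absurd hn (by simp)

theorem one_of_constantCoeff (hf : constantCoeff f = 0) : AgreeTo 1 f 0 := by
  intro n hn
  have : n = 0 := by rwa [Nat.lt_one_iff, Finsupp.degree_eq_zero_iff] at hn
  rw [this, coeff_zero_eq_constantCoeff_apply, hf, coeff_zero]

theorem eq_of_forall (h : ∀ d, AgreeTo d f g) : f = g :=
  MvPowerSeries.ext fun n => h (n.degree + 1) n (Nat.lt_succ_self _)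

end AgreeTo

/-- A product of |n| series without constant term has order |n|. By `a b - a' b' = a (b - b') + (a -
a') b'`, exchanging one factor for a congruent one leaves an error to which all the other factors
still contribute their order. -/
theorem agreeTo_monomial {G G' : V → MvPowerSeries W ℂ} {e : ℕ}
    (h0 : ∀ i, constantCoeff (G i) = 0) (h0' : ∀ i, constantCoeff (G' i) = 0)
    (h : ∀ i, AgreeTo (e + 1) (G i) (G' i)) (n : V →₀ ℕ) :
    AgreeTo n.degree (n.prod fun s k => G s ^ k) 0 ∧
    AgreeTo n.degree (n.prod fun s k => G' s ^ k) 0 ∧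
    AgreeTo (n.degree + e) (n.prod fun s k => G s ^ k) (n.prod fun s k => G' s ^ k) := by
  have step : ∀ {d d' : ℕ} {a a' b b' : MvPowerSeries W ℂ},
      AgreeTo d a 0 ∧ AgreeTo d a' 0 ∧ AgreeTo (d + e) a a' →
      AgreeTo d' b 0 ∧ AgreeTo d' b' 0 ∧ AgreeTo (d' + e) b b' →
      AgreeTo (d + d') (a * b) 0 ∧ AgreeTo (d + d') (a' * b') 0 ∧
        AgreeTo (d + d' + e) (a * b) (a' * b') := by
    intro d d' a a' b b' h₁ h₂
    refine ⟨h₁.1.mul_zero h₂.1, h₁.2.1.mul_zero h₂.2.1, AgreeTo.sub_zero_iff.1 ?_⟩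
    have : a * b - a' * b' = a * (b - b') + (a - a') * b' := by ring
    rw [this]
    have e1 := (h₁.1.mul_zero (AgreeTo.sub_zero_iff.2 h₂.2.2)).add
      (((AgreeTo.sub_zero_iff.2 h₁.2.2).mul_zero h₂.2.1).mono (d' := d + (d' + e)) (by omega))
    rw [add_zero, ← add_assoc] at e1
    exact e1
  have hone : AgreeTo 0 (1 : MvPowerSeries W ℂ) 0 ∧ AgreeTo 0 (1 : MvPowerSeries W ℂ) 0 ∧
      AgreeTo (0 + e) (1 : MvPowerSeries W ℂ) 1 :=
    ⟨AgreeTo.zero_deg _ _, AgreeTo.zero_deg _ _, AgreeTo.refl _⟩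
  induction n using Finsupp.induction_linear with
  | zero => simpa using hone
  | add f g hf hg =>
    have hp : ∀ G : V → MvPowerSeries W ℂ, ((f + g).prod fun s k => G s ^ k) =
        (f.prod fun s k => G s ^ k) * g.prod fun s k => G s ^ k := fun G =>
      Finsupp.prod_add_index' (fun a => pow_zero _) (fun a b c => pow_add _ _ _)
    rw [hp, hp, map_add]
    exact step hf hg
  | single a b =>
    have hp : ∀ G : V → MvPowerSeries W ℂ, ((Finsupp.single a b).prod fun s k => G s ^ k) =
        G a ^ b := fun G => Finsupp.prod_single_index (pow_zero _)
    rw [hp, hp, Finsupp.degree_single]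
    clear hp
    induction b with
    | zero => simpa using hone
    | succ b ih =>
      rw [pow_succ, pow_succ]
      refine step ih ⟨AgreeTo.one_of_constantCoeff (h0 a), AgreeTo.one_of_constantCoeff (h0' a), ?_⟩
      rw [add_comm]
      exact h a

variable [Finite V]

theorem AgreeTo.subst {d : ℕ} {f g : MvPowerSeries V ℂ} {G : V → MvPowerSeries W ℂ}
    (h0 : ∀ i, constantCoeff (G i) = 0) (h : AgreeTo d f g) :
    AgreeTo d (subst G f) (subst G g) := by
  intro n hn
  have hs := hasSubst_of_constantCoeff_zero h0
  rw [coeff_subst hs, coeff_subst hs]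
  refine finsum_congr fun m => ?_
  rcases lt_or_ge n.degree m.degree with hm | hm
  · have := (agreeTo_monomial (e := 0) h0 h0 (fun i => AgreeTo.refl _) m).1 n hm
    rw [this, coeff_zero, smul_zero, smul_zero]
  · rw [h m (hm.trans_lt hn)]

/-- This gain of order drives the degree-by-degree arguments: for f of order 2, the results agree
one degree further than the inner maps do. -/
theorem AgreeTo.subst_right {m e : ℕ} {f : MvPowerSeries V ℂ} {G G' : V → MvPowerSeries W ℂ}
    (h0 : ∀ i, constantCoeff (G i) = 0) (h0' : ∀ i, constantCoeff (G' i) = 0)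
    (hf : AgreeTo m f 0) (h : ∀ i, AgreeTo (e + 1) (G i) (G' i)) :
    AgreeTo (m + e) (MvPowerSeries.subst G f) (MvPowerSeries.subst G' f) := by
  intro n hn
  rw [coeff_subst (hasSubst_of_constantCoeff_zero h0),
    coeff_subst (hasSubst_of_constantCoeff_zero h0')]
  refine finsum_congr fun k => ?_
  rcases lt_or_ge k.degree m with hm | hm
  · rw [hf k hm, coeff_zero, zero_smul, zero_smul]
  · rw [(agreeTo_monomial h0 h0' h k).2.2 n (by omega)]

theorem AgreeTo.subst_congr {d : ℕ} {f g : MvPowerSeries V ℂ} {G G' : V → MvPowerSeries W ℂ}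
    (h0 : ∀ i, constantCoeff (G i) = 0) (h0' : ∀ i, constantCoeff (G' i) = 0)
    (hf : AgreeTo d f g) (h : ∀ i, AgreeTo d (G i) (G' i)) :
    AgreeTo d (MvPowerSeries.subst G f) (MvPowerSeries.subst G' g) := by
  rcases d with _ | d
  · exact AgreeTo.zero_deg _ _
  refine (hf.subst h0).trans ?_
  have h1 := AgreeTo.subst_right (m := 0) h0 h0' (AgreeTo.zero_deg g 0) h
  -- The constant term of `g` is insensitive to the substitution, and the remainder has order 1, so
  -- no degree of agreement is lost.
  have h2 : ∀ G : V → MvPowerSeries W ℂ, (∀ i, constantCoeff (G i) = 0) →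
      MvPowerSeries.subst G g =
      C (constantCoeff g) + MvPowerSeries.subst G (g - C (constantCoeff g)) := by
    intro G hG
    conv_lhs => rw [← add_sub_cancel (C (constantCoeff g)) g]
    rw [subst_add (hasSubst_of_constantCoeff_zero hG), subst_C]
  rw [h2 G h0, h2 G' h0']
  refine (AgreeTo.refl _).add ?_
  have h3 := AgreeTo.subst_right (m := 1) (f := g - C (constantCoeff g)) h0 h0'
    (AgreeTo.one_of_constantCoeff (by simp)) h
  exact h3.mono (by omega)

end Agree

theorem degree_lt_two {V : Type} {n : V →₀ ℕ} (hn : n.degree < 2) :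
    n = 0 ∨ ∃ k, n = Finsupp.single k 1 := by
  rcases Nat.lt_succ_iff_lt_or_eq.1 hn with h | h
  · left
    rwa [Nat.lt_one_iff, Finsupp.degree_eq_zero_iff] at h
  · right
    have hs : n.support.Nonempty := by
      rw [Finsupp.support_nonempty_iff]
      rintro rfl
      simp at h
    obtain ⟨k, hk⟩ := hs
    have h1 : Finsupp.single k 1 ≤ n := by
      rw [Finsupp.single_le_iff]
      exact Nat.one_le_iff_ne_zero.2 (Finsupp.mem_support_iff.1 hk)
    refine ⟨k, ?_⟩
    have h2 := congrArg Finsupp.degree (tsub_add_cancel_of_le h1)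
    rw [map_add, Finsupp.degree_single, h] at h2
    have h3 : n - Finsupp.single k 1 = 0 := by
      rw [← Finsupp.degree_eq_zero_iff]
      omega
    rw [← tsub_add_cancel_of_le h1, h3, zero_add]

theorem constantCoeff_conjPull {V : Type} [Finite V] (π : V → V) {f : MvPowerSeries V ℂ}
    (hf : constantCoeff f = 0) : constantCoeff (conjPull π f) = 0 :=
  constantCoeff_subst_eq_zero
    (hasSubst_of_constantCoeff_zero fun k => constantCoeff_X (π k))
    (fun k => constantCoeff_X (π k)) (by simp [hf])

/-! ### Jacobians, linear parts and the formal inverse function theorem. -/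

namespace FormalMap

variable {V : Type}

theorem mul_comp [Finite V] (F G : FormalMap V) (i : V) :
    (F * G).comp i = subst G.comp (F.comp i) := rfl

theorem one_comp [Finite V] (i : V) : (1 : FormalMap V).comp i = X i := rfl

variable [Fintype V]

/-- The linear map with a given matrix. -/
def ofMatrix (A : Matrix V V ℂ) : FormalMap V :=
  ⟨fun i => ∑ k, C (A i k) * X k, fun i => by simp⟩

theorem linPart_eq (F : FormalMap V) : F.linPart = ofMatrix F.jac := rfl

theorem ofMatrix_comp (A : Matrix V V ℂ) (i : V) : (ofMatrix A).comp i = ∑ k, C (A i k) * X k :=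
  rfl

theorem subst_linear {W : Type} {G : V → MvPowerSeries W ℂ} (h : HasSubst G) (a : V → ℂ) :
    subst G (∑ k, C (a k) * X k : MvPowerSeries V ℂ) = ∑ k, C (a k) * G k := by
  rw [← coe_substAlgHom h, map_sum]
  refine Finset.sum_congr rfl fun k _ => ?_
  rw [map_mul, coe_substAlgHom, subst_C, subst_X h]

theorem ofMatrix_mul_comp (A : Matrix V V ℂ) (G : FormalMap V) (i : V) :
    (ofMatrix A * G).comp i = ∑ k, C (A i k) * G.comp k :=
  subst_linear G.hasSubst _

variable [DecidableEq V]

theorem jac_apply (F : FormalMap V) (i k : V) :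
    F.jac i k = coeff (Finsupp.single k 1) (F.comp i) := rfl

theorem jac_ofMatrix (A : Matrix V V ℂ) : (ofMatrix A).jac = A := by
  ext i k
  rw [jac_apply, ofMatrix_comp, map_sum]
  simp [coeff_C_mul, coeff_index_single_X]

theorem ofMatrix_mul (A B : Matrix V V ℂ) : ofMatrix (A * B) = ofMatrix A * ofMatrix B := by
  ext1
  funext i
  rw [ofMatrix_mul_comp, ofMatrix_comp]
  simp only [ofMatrix_comp, Finset.mul_sum, ← mul_assoc, ← map_mul]
  rw [Finset.sum_comm]
  refine Finset.sum_congr rfl fun k _ => ?_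
  rw [Matrix.mul_apply, map_sum, Finset.sum_mul]

theorem ofMatrix_one : ofMatrix (1 : Matrix V V ℂ) = 1 := by
  ext1
  funext i
  rw [ofMatrix_comp, one_comp]
  simp [Matrix.one_apply]

theorem agreeTo_linPart (F : FormalMap V) (i : V) : AgreeTo 2 (F.comp i) (F.linPart.comp i) := by
  intro n hn
  rcases degree_lt_two hn with rfl | ⟨k, rfl⟩
  · rw [coeff_zero_eq_constantCoeff_apply, coeff_zero_eq_constantCoeff_apply, F.zero_at,
      F.linPart.zero_at]
  · rw [linPart_eq, ← jac_apply, ← jac_apply, jac_ofMatrix]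

theorem jac_one : (1 : FormalMap V).jac = 1 := by
  rw [← ofMatrix_one, jac_ofMatrix]

theorem jac_mul (F G : FormalMap V) : (F * G).jac = F.jac * G.jac := by
  ext i k
  have h := (agreeTo_linPart F i).subst G.zero_at (Finsupp.single k 1) (by simp)
  rw [jac_apply, mul_comp, h, ← mul_comp, linPart_eq, ofMatrix_mul_comp, map_sum,
    Matrix.mul_apply]
  refine Finset.sum_congr rfl fun l _ => ?_
  rw [coeff_C_mul, ← jac_apply]

theorem linPart_mul (F G : FormalMap V) : (F * G).linPart = F.linPart * G.linPart := by
  rw [linPart_eq, jac_mul, ofMatrix_mul, linPart_eq, linPart_eq]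

theorem linPart_ofMatrix (A : Matrix V V ℂ) : (ofMatrix A).linPart = ofMatrix A := by
  rw [linPart_eq, jac_ofMatrix]

/-- The successive approximations of the inverse of a formal map tangent to the identity. -/
def approxInv (F : FormalMap V) : ℕ → FormalMap V
  | 0 => 1
  | k + 1 => ⟨fun i => X i - subst (approxInv F k).comp (F.comp i - X i), fun i => by
      rw [map_sub, constantCoeff_X, zero_sub, neg_eq_zero]
      exact constantCoeff_subst_eq_zero (approxInv F k).hasSubst (approxInv F k).zero_at
        (by simp [F.zero_at])⟩

theorem agreeTo_X_of_jac {F : FormalMap V} (hF : F.jac = 1) (i : V) :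
    AgreeTo 2 (F.comp i) (X i) := by
  have := agreeTo_linPart F i
  rwa [linPart_eq, hF, ofMatrix_one, one_comp] at this

/-- With N = F - id of order 2, the iteration G ↦ id - N ∘ G gains one degree of agreement at each
step. -/
theorem approxInv_succ {F : FormalMap V} (hF : F.jac = 1) (k : ℕ) (i : V) :
    AgreeTo (k + 2) ((approxInv F (k + 1)).comp i) ((approxInv F k).comp i) := by
  have hN : ∀ i, AgreeTo 2 (F.comp i - X i) 0 := fun i =>
    AgreeTo.sub_zero_iff.2 (agreeTo_X_of_jac hF i)
  induction k generalizing i with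
  | zero =>
    have h : subst (1 : FormalMap V).comp (F.comp i - X i) = F.comp i - X i :=
      congrFun subst_self (F.comp i - X i)
    change AgreeTo 2 (X i - subst (1 : FormalMap V).comp (F.comp i - X i)) (X i)
    rw [h]
    have := (AgreeTo.refl (d := 2) (X i : MvPowerSeries V ℂ)).sub (hN i)
    rwa [sub_zero] at this
  | succ k ih =>
    change AgreeTo _ (X i - _) (X i - _)
    refine (AgreeTo.refl _).sub ?_
    have := AgreeTo.subst_right (approxInv F (k + 1)).zero_at (approxInv F k).zero_at (hN i) ih
    exact this.mono (by omega)

theorem approxInv_agree {F : FormalMap V} (hF : F.jac = 1) {k l : ℕ} (hkl : k ≤ l) (i : V) :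
    AgreeTo (k + 2) ((approxInv F l).comp i) ((approxInv F k).comp i) := by
  induction l, hkl using Nat.le_induction with
  | base => exact AgreeTo.refl _
  | succ l hl ih => exact ((approxInv_succ hF l i).mono (by omega)).trans ih

/-- The inverse of a formal map tangent to the identity. -/
def limInv (F : FormalMap V) : FormalMap V :=
  -- Coefficients of degree k no longer change after the k-th approximation, so the index |n|
  -- already gives the limit.
  ⟨fun i => ofCoeffs fun n => coeff n ((approxInv F n.degree).comp i), fun i => by
    rw [← coeff_zero_eq_constantCoeff_apply, coeff_ofCoeffs, coeff_zero_eq_constantCoeff_apply,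
      zero_at]⟩

theorem coeff_limInv (F : FormalMap V) (i : V) (n : V →₀ ℕ) :
    coeff n ((limInv F).comp i) = coeff n ((approxInv F n.degree).comp i) := rfl

theorem limInv_agree {F : FormalMap V} (hF : F.jac = 1) (k : ℕ) (i : V) :
    AgreeTo (k + 1) ((limInv F).comp i) ((approxInv F k).comp i) := by
  intro n hn
  rw [coeff_limInv, approxInv_agree hF (Nat.lt_succ_iff.1 hn) i n (by omega)]

/-- For the approximations G_d one has F ∘ G_d = G_d - G_{d+1} + id, and consecutive approximations
agree in all degrees below d + 2. -/
theorem mul_limInv {F : FormalMap V} (hF : F.jac = 1) : F * limInv F = 1 := by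
  ext1
  funext i
  refine AgreeTo.eq_of_forall fun d => ?_
  have h1 : AgreeTo (d + 1) (subst (limInv F).comp (F.comp i))
      (subst (approxInv F d).comp (F.comp i)) :=
    AgreeTo.subst_congr (limInv F).zero_at (approxInv F d).zero_at (AgreeTo.refl _)
      (limInv_agree hF d)
  have h2 : subst (approxInv F d).comp (F.comp i) =
      (approxInv F d).comp i - (approxInv F (d + 1)).comp i + X i := by
    change _ = _ - (X i - subst (approxInv F d).comp (F.comp i - X i)) + X i
    rw [subst_sub (approxInv F d).hasSubst, subst_X (approxInv F d).hasSubst]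
    ring
  rw [h2] at h1
  have h3 := AgreeTo.sub_zero_iff.2 (approxInv_succ hF d i).symm
  have h4 := (h3.mono (d' := d + 1) (by omega)).add (AgreeTo.refl (X i : MvPowerSeries V ℂ))
  rw [zero_add] at h4
  exact (h1.trans h4).mono (by omega)

/-- The right inverse is again tangent to the identity, so it has a right inverse of its own, which
must be F. -/
theorem isUnit_of_jac_eq_one {F : FormalMap V} (hF : F.jac = 1) : IsUnit F := by
  have h1 := mul_limInv hF
  have hG : (limInv F).jac = 1 := by
    have := congrArg jac h1
    rwa [jac_mul, hF, one_mul, jac_one] at this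
  have h2 := mul_limInv hG
  have h3 : limInv (limInv F) = F := by
    rw [← one_mul (limInv (limInv F)), ← h1, mul_assoc, h2, mul_one]
  rw [h3] at h2
  exact ⟨⟨F, limInv F, h1, h2⟩, rfl⟩

theorem isUnit_ofMatrix {A : Matrix V V ℂ} (hA : IsUnit A) : IsUnit (ofMatrix A) := by
  obtain ⟨u, rfl⟩ := hA
  refine ⟨⟨ofMatrix (u : Matrix V V ℂ), ofMatrix (↑u⁻¹ : Matrix V V ℂ), ?_, ?_⟩, rfl⟩
  · rw [← ofMatrix_mul, Units.mul_inv, ofMatrix_one]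
  · rw [← ofMatrix_mul, Units.inv_mul, ofMatrix_one]

/-- The formal inverse function theorem. -/
theorem isUnit_iff_jac {F : FormalMap V} : IsUnit F ↔ IsUnit F.jac := by
  constructor
  · rintro ⟨u, rfl⟩
    refine ⟨⟨(u : FormalMap V).jac, (↑u⁻¹ : FormalMap V).jac, ?_, ?_⟩, rfl⟩
    · rw [← jac_mul, Units.mul_inv, jac_one]
    · rw [← jac_mul, Units.inv_mul, jac_one]
  · intro h
    obtain ⟨u, hu⟩ := h
    have h1 : IsUnit (ofMatrix (↑u⁻¹ : Matrix V V ℂ)) := isUnit_ofMatrix ⟨u⁻¹, rfl⟩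
    have h2 : IsUnit (ofMatrix (↑u⁻¹ : Matrix V V ℂ) * F) := by
      apply isUnit_of_jac_eq_one
      rw [jac_mul, jac_ofMatrix, ← hu, Units.inv_mul]
    obtain ⟨v, hv⟩ := h1
    rw [← hv] at h2
    simpa using (v⁻¹.isUnit.mul h2)

theorem isUnit_of_injective {F : FormalMap V}
    (h : ∀ v : V → ℂ, F.jac.mulVec v = 0 → v = 0) : IsUnit F := by
  rw [isUnit_iff_jac, ← Matrix.mulVec_injective_iff_isUnit]
  intro v w hvw
  have := h (v - w) (by rw [Matrix.mulVec_sub]; exact sub_eq_zero.2 hvw)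
  exact sub_eq_zero.1 this

theorem mulVec_jac_injective {F : FormalMap V} (h : IsUnit F) {v : V → ℂ}
    (hv : F.jac.mulVec v = 0) : v = 0 := by
  rw [isUnit_iff_jac, ← Matrix.mulVec_injective_iff_isUnit] at h
  exact h (by simpa using hv)

theorem inv_eq (u : (FormalMap V)ˣ) : (u : FormalMap V).inv = ((u⁻¹ : (FormalMap V)ˣ)) := by
  have h : IsUnit (u : FormalMap V) := u.isUnit
  rw [inv, dif_pos h]
  congr 2
  ext1
  exact h.unit_spec

end FormalMap

/-! ### Conjugation by antiholomorphic involutions -/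

section Conj

variable {V : Type} [Finite V]

theorem conjPull_subst (π : V → V) {W : Type} [Finite W] {G : W → MvPowerSeries V ℂ}
    (h0 : ∀ i, constantCoeff (G i) = 0) (f : MvPowerSeries W ℂ) :
    conjPull π (subst G f) =
      subst (fun i => conjPull π (G i)) (MvPowerSeries.map (starRingEnd ℂ) f) := by
  have hs := hasSubst_of_constantCoeff_zero h0
  have hX : HasSubst (fun k => (X (π k) : MvPowerSeries V ℂ)) :=
    hasSubst_of_constantCoeff_zero fun k => constantCoeff_X (π k)
  rw [conjPull, map_subst hs, subst_comp_subst_apply (hs.map _) hX]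
  rfl

theorem subst_conjPull (π : V → V) {W : Type} {G : V → MvPowerSeries W ℂ}
    (h0 : ∀ i, constantCoeff (G i) = 0) (f : MvPowerSeries V ℂ) :
    subst G (conjPull π f) =
      subst (fun i => G (π i)) (MvPowerSeries.map (starRingEnd ℂ) f) := by
  have hs := hasSubst_of_constantCoeff_zero h0
  have hX : HasSubst (fun k => (X (π k) : MvPowerSeries V ℂ)) :=
    hasSubst_of_constantCoeff_zero fun k => constantCoeff_X (π k)
  rw [conjPull, subst_comp_subst_apply hX hs]
  congr 1
  funext k
  rw [subst_X hs]

/-- `conjPull` as a ring homomorphism. -/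
def conjPullHom (π : V → V) : MvPowerSeries V ℂ →+* MvPowerSeries V ℂ :=
  ((substAlgHom (R := ℂ) (hasSubst_of_constantCoeff_zero
    fun k => constantCoeff_X (R := ℂ) (π k))).toRingHom).comp (MvPowerSeries.map (starRingEnd ℂ))

theorem conjPullHom_apply (π : V → V) (f : MvPowerSeries V ℂ) :
    conjPullHom π f = conjPull π f := by
  have hX : HasSubst (fun k => (X (π k) : MvPowerSeries V ℂ)) :=
    hasSubst_of_constantCoeff_zero fun k => constantCoeff_X (π k)
  change substAlgHom hX _ = _
  rw [coe_substAlgHom]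
  rfl

theorem conjPull_X (π : V → V) (k : V) : conjPull π (X k) = X (π k) := by
  rw [conjPull, map_X, subst_X (hasSubst_of_constantCoeff_zero fun k => constantCoeff_X (π k))]

theorem conjPull_C (π : V → V) (a : ℂ) :
    conjPull π (C a) = C (starRingEnd ℂ a) := by
  rw [conjPull, map_C, subst_C]

theorem map_conj_conj (f : MvPowerSeries V ℂ) :
    MvPowerSeries.map (starRingEnd ℂ) (MvPowerSeries.map (starRingEnd ℂ) f) = f := by
  ext n
  simp

theorem conjPull_conjPull {π : V → V} (hπ : Function.Involutive π) (f : MvPowerSeries V ℂ) :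
    conjPull π (conjPull π f) = f := by
  have hX : ∀ k, constantCoeff (X (π k) : MvPowerSeries V ℂ) = 0 := fun k => constantCoeff_X (π k)
  conv_lhs => rw [conjPull.eq_1 π f, conjPull_subst π hX, map_conj_conj]
  simp only [conjPull_X, hπ _]
  exact congrFun subst_self f

theorem coeff_conjPull {π : V → V} (hπ : Function.Involutive π) (f : MvPowerSeries V ℂ)
    (n : V →₀ ℕ) :
    coeff n (conjPull π f) = starRingEnd ℂ (coeff (n.mapDomain π) f) := by
  have h1 : conjPull π f = rename (hπ.toPerm π) (MvPowerSeries.map (starRingEnd ℂ) f) := by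
    rw [rename_eq_subst]
    rfl
  have h2 : n = (n.mapDomain π).embDomain (hπ.toPerm π).toEmbedding := by
    rw [Finsupp.embDomain_eq_mapDomain, ← Finsupp.mapDomain_comp]
    conv_lhs => rw [← Finsupp.mapDomain_id (v := n)]
    congr 1
    funext k
    exact (hπ k).symm
  conv_lhs => rw [h1, h2]
  have := coeff_embDomain_rename (hπ.toPerm π).toEmbedding
    (MvPowerSeries.map (starRingEnd ℂ) f) (n.mapDomain π)
  rw [coeff_map] at this
  exact this

namespace FormalMap

theorem conjBy_comp (π₁ π₂ : V → V) (F : FormalMap V) (i : V) :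
    (conjBy π₁ π₂ F).comp i = conjPull π₂ (F.comp (π₁ i)) := rfl

/-- The middle involution cancels in (ρ₁ F ρ₂)(ρ₂ G ρ₃). Allowing different involutions on the two
sides lets reality conditions relating ρ₀ and ρ be composed like ordinary maps. -/
theorem conjBy_mul {π₁ π₂ π₃ : V → V} (h₂ : Function.Involutive π₂) (F G : FormalMap V) :
    conjBy π₁ π₂ F * conjBy π₂ π₃ G = conjBy π₁ π₃ (F * G) := by
  ext1
  funext i
  rw [mul_comp, conjBy_comp, conjBy_comp, mul_comp, conjPull_subst π₃ G.zero_at,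
    subst_conjPull π₂ (conjBy π₂ π₃ G).zero_at]
  congr 1
  funext k
  rw [conjBy_comp, h₂]

theorem conjBy_one {π : V → V} (hπ : Function.Involutive π) :
    conjBy π π (1 : FormalMap V) = 1 := by
  ext1
  funext i
  rw [conjBy_comp, one_comp, one_comp, conjPull_X, hπ]

theorem conjBy_conjBy {π₁ π₂ : V → V} (h₁ : Function.Involutive π₁)
    (h₂ : Function.Involutive π₂) (F : FormalMap V) :
    conjBy π₁ π₂ (conjBy π₁ π₂ F) = F := by
  ext1
  funext i
  rw [conjBy_comp, conjBy_comp, h₁, conjPull_conjPull h₂]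

theorem jac_conjBy {π₁ π₂ : V → V} (h₂ : Function.Involutive π₂) (F : FormalMap V) (i k : V) :
    (conjBy π₁ π₂ F).jac i k = starRingEnd ℂ (F.jac (π₁ i) (π₂ k)) := by
  change coeff _ (conjPull π₂ _) = starRingEnd ℂ (coeff _ _)
  rw [coeff_conjPull h₂, Finsupp.mapDomain_single]

end FormalMap

end Conj

/-! ### Substitution of monomials -/

section Monomials

variable {V W : Type} [Finite V]

/-- The exponent of the image of a monomial under a substitution of monomials. -/
def expMap (e : V → W →₀ ℕ) (n : V →₀ ℕ) : W →₀ ℕ := n.sum fun i k => k • e i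

theorem coeff_subst_monomials {G : V → MvPowerSeries W ℂ} {e : V → W →₀ ℕ} (he : ∀ i, e i ≠ 0)
    (hG : ∀ i, G i = monomial (e i) 1) (f : MvPowerSeries V ℂ) (m : W →₀ ℕ) :
    coeff m (subst G f) = finsum fun n => coeff n f • coeff m (monomial (expMap e n) (1 : ℂ)) := by
  classical
  have h0 : ∀ i, constantCoeff (G i) = 0 := fun i => by
    rw [hG, ← coeff_zero_eq_constantCoeff_apply, coeff_monomial_ne (he i).symm]
  rw [coeff_subst (hasSubst_of_constantCoeff_zero h0)]
  refine finsum_congr fun n => ?_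
  congr 2
  rw [Finsupp.prod, expMap, Finsupp.sum]
  simp only [hG, monomial_pow, one_pow]
  rw [prod_monomial]
  simp

/-- Distinct monomials have distinct images, so a single term of the substitution sum survives and f
can be read off from its substitution. -/
theorem coeff_subst_expMap {G : V → MvPowerSeries W ℂ} {e : V → W →₀ ℕ} (he : ∀ i, e i ≠ 0)
    (hG : ∀ i, G i = monomial (e i) 1) (hinj : Function.Injective (expMap e))
    (f : MvPowerSeries V ℂ) (n : V →₀ ℕ) :
    coeff (expMap e n) (subst G f) = coeff n f := by
  rw [coeff_subst_monomials he hG, finsum_eq_single _ n]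
  · rw [coeff_monomial_same, smul_eq_mul, mul_one]
  · intro m hm
    rw [coeff_monomial_ne (fun h => hm (hinj h).symm), smul_zero]

theorem coeff_subst_notMem {G : V → MvPowerSeries W ℂ} {e : V → W →₀ ℕ} (he : ∀ i, e i ≠ 0)
    (hG : ∀ i, G i = monomial (e i) 1) (f : MvPowerSeries V ℂ) {m : W →₀ ℕ}
    (hm : m ∉ Set.range (expMap e)) : coeff m (subst G f) = 0 := by
  rw [coeff_subst_monomials he hG, finsum_eq_zero_of_forall_eq_zero]
  intro n
  rw [coeff_monomial_ne (fun h => hm ⟨n, h.symm⟩), smul_zero]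

theorem subst_ofCoeffs_expMap {G : V → MvPowerSeries W ℂ} {e : V → W →₀ ℕ} (he : ∀ i, e i ≠ 0)
    (hG : ∀ i, G i = monomial (e i) 1) (hinj : Function.Injective (expMap e))
    {f : MvPowerSeries W ℂ} (hf : ∀ m, m ∉ Set.range (expMap e) → coeff m f = 0) :
    subst G (ofCoeffs fun n => coeff (expMap e n) f) = f := by
  ext m
  by_cases hm : m ∈ Set.range (expMap e)
  · obtain ⟨n, rfl⟩ := hm
    rw [coeff_subst_expMap he hG hinj, coeff_ofCoeffs]
  · rw [coeff_subst_notMem he hG _ hm, hf m hm]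

theorem expMap_single (e : V → W →₀ ℕ) (i : V) : expMap e (Finsupp.single i 1) = e i := by
  have h := Finsupp.sum_single_index (a := i) (b := 1) (h := fun i k => k • e i) (zero_smul _ _)
  rw [expMap, h, one_smul]

theorem expMap_apply [Fintype V] (e : V → W →₀ ℕ) (n : V →₀ ℕ) (w : W) :
    expMap e n w = ∑ i, n i * e i w := by
  have h : expMap e n = ∑ i, n i • e i := Finsupp.sum_fintype _ _ fun i => zero_smul _ _
  rw [h, Finsupp.finsetSum_apply]
  rfl

end Monomials

/-! ### Diagonal maps -/

section Diagonal

variable {V : Type} [Fintype V] [DecidableEq V]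

/-- The diagonal linear map with given entries. -/
def diagMap (d : V → ℂ) : FormalMap V :=
  ⟨fun i => C (d i) * X i, fun i => by simp⟩

theorem diagMap_eq (d : V → ℂ) : diagMap d = FormalMap.ofMatrix (Matrix.diagonal d) := by
  ext1
  funext i
  rw [FormalMap.ofMatrix_comp, Finset.sum_eq_single i]
  · rw [Matrix.diagonal_apply_eq]
    rfl
  · intro k _ hk
    rw [Matrix.diagonal_apply_ne _ hk.symm, map_zero, zero_mul]
  · simp

theorem jac_diagMap (d : V → ℂ) : (diagMap d).jac = Matrix.diagonal d := by
  rw [diagMap_eq, FormalMap.jac_ofMatrix]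

theorem diagMap_mul_comp (d : V → ℂ) (F : FormalMap V) (i : V) :
    (diagMap d * F).comp i = C (d i) * F.comp i := by
  change subst F.comp (C (d i) * X i) = _
  rw [subst_mul F.hasSubst, subst_C, subst_X F.hasSubst]

theorem diagMap_mul (d d' : V → ℂ) : diagMap d * diagMap d' = diagMap (d * d') := by
  ext1
  funext i
  rw [diagMap_mul_comp]
  change C (d i) * (C (d' i) * X i) = C (d i * d' i) * X i
  rw [map_mul, mul_assoc]

theorem diagMap_one : diagMap (1 : V → ℂ) = 1 := by
  ext1
  funext i
  change C 1 * X i = X i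
  rw [map_one, one_mul]

theorem coeff_subst_diagMap (d : V → ℂ) (f : MvPowerSeries V ℂ) (n : V →₀ ℕ) :
    coeff n (subst (diagMap d).comp f) = (∏ k, d k ^ n k) * coeff n f := by
  have h : (diagMap d).comp = d • (X : V → MvPowerSeries V ℂ) := by
    funext i
    change C (d i) * X i = _
    rw [Pi.smul_apply', smul_eq_C_mul]
  rw [h, ← rescale_eq_subst, coeff_rescale, Finsupp.prod_fintype _ _ (fun i => pow_zero _)]

end Diagonal

/-! ### Sign changes, even parts and the fold (x, y) ↦ (x, y²). -/

section Squares

variable {I : Type} [Fintype I] [DecidableEq I]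

/-- The sign change of the coordinates `η_k`, `k ∈ S`. -/
def flip (S : Finset I) : FormalMap (I ⊕ I) :=
  diagMap (Sum.elim 1 fun k => if k ∈ S then -1 else 1)

/-- The map `(x, y) ↦ (x, y²)`. -/
def sqMap : FormalMap (I ⊕ I) :=
  ⟨Sum.elim (fun j => X (Sum.inl j)) (fun j => X (Sum.inr j) ^ 2), by rintro (j | j) <;> simp⟩

/-- Exponents of the monomials `(x, y²)`. -/
def sqExp : I ⊕ I → I ⊕ I →₀ ℕ :=
  Sum.elim (fun j => Finsupp.single (Sum.inl j) 1) (fun j => Finsupp.single (Sum.inr j) 2)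

theorem sqExp_ne (i : I ⊕ I) : sqExp i ≠ 0 := by
  rcases i with j | j <;> simp [sqExp]

theorem sqMap_eq (i : I ⊕ I) : (sqMap : FormalMap (I ⊕ I)).comp i = monomial (sqExp i) 1 := by
  rcases i with j | j
  · rfl
  · exact X_pow_eq _ _

theorem expMap_sqExp_inl (n : I ⊕ I →₀ ℕ) (j : I) :
    expMap sqExp n (Sum.inl j) = n (Sum.inl j) := by
  rw [expMap_apply, Fintype.sum_sum_type, Finset.sum_eq_single j]
  · simp [sqExp]
  · intro k _ hk
    simp [sqExp, hk]
  · simp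

theorem expMap_sqExp_inr (n : I ⊕ I →₀ ℕ) (j : I) :
    expMap sqExp n (Sum.inr j) = n (Sum.inr j) * 2 := by
  rw [expMap_apply, Fintype.sum_sum_type, add_comm, Finset.sum_eq_single j]
  · simp [sqExp]
  · intro k _ hk
    simp [sqExp, hk]
  · simp

theorem expMap_sqExp_injective : Function.Injective (expMap (sqExp (I := I))) := by
  intro n m h
  ext i
  have := DFunLike.congr_fun h i
  rcases i with j | j
  · rwa [expMap_sqExp_inl, expMap_sqExp_inl] at this
  · rw [expMap_sqExp_inr, expMap_sqExp_inr] at this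
    omega

theorem mem_range_sqExp {n : I ⊕ I →₀ ℕ} :
    n ∈ Set.range (expMap sqExp) ↔ ∀ k, Even (n (Sum.inr k)) := by
  constructor
  · rintro ⟨m, rfl⟩ k
    rw [expMap_sqExp_inr]
    exact even_two.mul_left _
  · intro h
    refine ⟨Finsupp.equivFunOnFinite.symm
      (Sum.elim (fun j => n (Sum.inl j)) fun j => n (Sum.inr j) / 2), ?_⟩
    ext i
    rcases i with j | j
    · rw [expMap_sqExp_inl]
      rfl
    · rw [expMap_sqExp_inr]
      exact Nat.div_two_mul_two_of_even (h j)

/-- The series `g` with `g (x, y²) = f (x, y)`, for `f` even in every `y_k`. -/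
def unsquare (f : MvPowerSeries (I ⊕ I) ℂ) : MvPowerSeries (I ⊕ I) ℂ :=
  ofCoeffs fun n => coeff (expMap sqExp n) f

theorem subst_unsquare {f : MvPowerSeries (I ⊕ I) ℂ}
    (hf : ∀ n : I ⊕ I →₀ ℕ, ¬ (∀ k, Even (n (Sum.inr k))) → coeff n f = 0) :
    subst sqMap.comp (unsquare f) = f :=
  subst_ofCoeffs_expMap sqExp_ne sqMap_eq expMap_sqExp_injective
    fun m hm => hf m (mt mem_range_sqExp.2 hm)

theorem unsquare_subst (f : MvPowerSeries (I ⊕ I) ℂ) : unsquare (subst sqMap.comp f) = f := by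
  ext n
  exact coeff_subst_expMap sqExp_ne sqMap_eq expMap_sqExp_injective f n

/-- Replacing y by y² loses no coefficient, as `unsquare` undoes it. Hence the map induced
downstairs by a descending map is unique. -/
theorem sqMap_cancel {F G : FormalMap (I ⊕ I)} (h : F * sqMap = G * sqMap) : F = G := by
  ext1
  funext i
  have := congrArg (fun H => unsquare (FormalMap.comp H i)) h
  simpa only [FormalMap.mul_comp, unsquare_subst] using this

theorem coeff_subst_flip (S : Finset I) (f : MvPowerSeries (I ⊕ I) ℂ) (n : I ⊕ I →₀ ℕ) :
    coeff n (subst (flip S).comp f) = (∏ k ∈ S, (-1) ^ n (Sum.inr k)) * coeff n f := by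
  rw [flip, coeff_subst_diagMap, Fintype.prod_sum_type]
  simp only [Sum.elim_inl, Sum.elim_inr, Pi.one_apply, one_pow, Finset.prod_const_one, one_mul,
    ite_pow]
  rw [Finset.prod_ite_mem, Finset.univ_inter]

theorem coeff_eq_zero_of_flip {f : MvPowerSeries (I ⊕ I) ℂ}
    (hf : ∀ S : Finset I, subst (flip S).comp f = f) (n : I ⊕ I →₀ ℕ)
    (hn : ¬ ∀ k, Even (n (Sum.inr k))) : coeff n f = 0 := by
  push Not at hn
  obtain ⟨k, hk⟩ := hn
  have := congrArg (coeff n) (hf {k})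
  rw [coeff_subst_flip, Finset.prod_singleton, (Nat.not_even_iff_odd.1 hk).neg_one_pow] at this
  linear_combination (-1 / 2) * this

theorem flip_mul_self (S : Finset I) : flip S * flip S = 1 := by
  rw [flip, diagMap_mul, ← diagMap_one]
  congr 1
  funext i
  rcases i with j | j
  · simp
  · by_cases h : j ∈ S <;> simp [h]

theorem sqMap_mul_flip (S : Finset I) : sqMap * flip S = sqMap := by
  ext1
  funext i
  rcases i with j | j
  · change subst (flip S).comp (X _) = X _
    rw [subst_X (flip S).hasSubst]
    change C 1 * X _ = _
    rw [map_one, one_mul]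
  · change subst (flip S).comp (X _ ^ 2) = X _ ^ 2
    rw [subst_pow (flip S).hasSubst, subst_X (flip S).hasSubst]
    change (C (if j ∈ S then -1 else 1) * X _) ^ 2 = X _ ^ 2
    rw [mul_pow, ← map_pow]
    split_ifs <;> simp

/-- The parity of the exponent of `η_k` in the `i`-th component of a map commuting with the sign
changes. -/
def parity : I ⊕ I → I → ℕ
  | Sum.inl _, _ => 0
  | Sum.inr j, k => if j = k then 1 else 0

theorem prod_neg_one_pow_parity (S : Finset I) (j : I) :
    ∏ k ∈ S, (-1 : ℂ) ^ parity (Sum.inr j) k = if j ∈ S then -1 else 1 := by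
  simp only [parity]
  by_cases h : j ∈ S
  · rw [if_pos h, Finset.prod_eq_single j]
    · simp
    · intro k _ hk
      simp [hk.symm]
    · simp [h]
  · rw [if_neg h, Finset.prod_eq_one]
    intro k hk
    rw [if_neg, pow_zero]
    rintro rfl
    exact h hk

theorem flip_mul_comp (S : Finset I) (F : FormalMap (I ⊕ I)) (i : I ⊕ I) :
    (flip S * F).comp i = C (∏ k ∈ S, (-1) ^ parity i k) * F.comp i := by
  rw [flip, diagMap_mul_comp]
  congr 2
  rcases i with j | j
  · simp [parity]
  · rw [prod_neg_one_pow_parity, Sum.elim_inr]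

open Classical in
/-- The projection onto the maps commuting with all sign changes of coordinates `η_k`. -/
def evenPart (F : FormalMap (I ⊕ I)) : FormalMap (I ⊕ I) :=
  ⟨fun i => ofCoeffs fun n =>
    if ∀ k, Even (n (Sum.inr k) + parity i k) then coeff n (F.comp i) else 0, fun i => by
    rw [← coeff_zero_eq_constantCoeff_apply, coeff_ofCoeffs, coeff_zero_eq_constantCoeff_apply,
      F.zero_at, ite_self]⟩

open Classical in
theorem coeff_evenPart (F : FormalMap (I ⊕ I)) (i : I ⊕ I) (n : I ⊕ I →₀ ℕ) :
    coeff n ((evenPart F).comp i) =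
      if ∀ k, Even (n (Sum.inr k) + parity i k) then coeff n (F.comp i) else 0 := rfl

-- The sum factors as ∏ (1 + (-1)^{a_k}), in which every factor is 2 or 0.
open Classical in
theorem sum_signs (a : I → ℕ) :
    ∑ S : Finset I, ∏ k ∈ S, (-1 : ℂ) ^ a k =
      if ∀ k, Even (a k) then 2 ^ Fintype.card I else 0 := by
  rw [← Finset.powerset_univ, ← Finset.prod_one_add]
  split_ifs with h
  · rw [Finset.prod_congr rfl (g := fun _ => (2 : ℂ)), Finset.prod_const, Finset.card_univ]
    intro k _
    rw [(h k).neg_one_pow]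
    norm_num
  · push Not at h
    obtain ⟨k, hk⟩ := h
    refine Finset.prod_eq_zero (Finset.mem_univ k) ?_
    rw [(Nat.not_even_iff_odd.1 hk).neg_one_pow]
    norm_num

/-- Averaging over conjugation by sign changes selects the monomials of matching parity. Unlike the
coefficientwise definition, the average interacts well with composition. -/
theorem evenPart_comp (F : FormalMap (I ⊕ I)) (i : I ⊕ I) :
    (evenPart F).comp i = C ((2 : ℂ) ^ Fintype.card I)⁻¹ *
      ∑ S : Finset I, (flip S * F * flip S).comp i := by
  classical
  ext n
  rw [coeff_evenPart, coeff_C_mul, map_sum]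
  have h : ∀ S : Finset I, coeff n ((flip S * F * flip S).comp i) =
      (∏ k ∈ S, (-1) ^ (n (Sum.inr k) + parity i k)) * coeff n (F.comp i) := by
    intro S
    rw [FormalMap.mul_comp, coeff_subst_flip, flip_mul_comp, coeff_C_mul, ← mul_assoc,
      ← Finset.prod_mul_distrib]
    simp only [pow_add]
  simp only [h]
  rw [← Finset.sum_mul, sum_signs]
  split_ifs
  · rw [inv_mul_cancel_left₀ (pow_ne_zero _ two_ne_zero)]
  · simp

/-- The map commutes with all sign changes of coordinates `η_k`. -/
def SignEquivariant (F : FormalMap (I ⊕ I)) : Prop := ∀ S : Finset I, Commute F (flip S)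

/-- In each term of the average G slides past the sign change on its right. Both existence and
uniqueness of the complement factor rest on this. -/
theorem evenPart_mul (F : FormalMap (I ⊕ I)) {G : FormalMap (I ⊕ I)} (hG : SignEquivariant G) :
    evenPart (F * G) = evenPart F * G := by
  ext1
  funext i
  rw [FormalMap.mul_comp, evenPart_comp, evenPart_comp, subst_mul G.hasSubst, subst_C,
    ← coe_substAlgHom G.hasSubst, map_sum]
  congr 1
  refine Finset.sum_congr rfl fun S _ => ?_
  rw [coe_substAlgHom, ← FormalMap.mul_comp]
  simp only [mul_assoc]
  rw [(hG S).eq]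

theorem signEquivariant_evenPart (F : FormalMap (I ⊕ I)) : SignEquivariant (evenPart F) := by
  intro S
  ext1
  funext i
  rw [FormalMap.mul_comp, flip_mul_comp]
  ext n
  rw [coeff_subst_flip, coeff_C_mul, coeff_evenPart]
  split_ifs with h
  · congr 1
    refine Finset.prod_congr rfl fun k _ => ?_
    have := (h k).neg_one_pow (α := ℂ)
    rw [pow_add] at this
    rcases neg_one_pow_eq_or ℂ (parity i k) with h1 | h1 <;> rw [h1] at this ⊢ <;>
      linear_combination (norm := ring_nf) this
    linear_combination (-2 : ℂ) * this
  · simp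

theorem parity_match_X (i : I ⊕ I) (k : I) :
    Even (Finsupp.single i 1 (Sum.inr k) + parity i k) := by
  rcases i with j | j
  · simp [parity]
  · by_cases h : j = k
    · subst h
      simp [parity]
    · simp [parity, h]

theorem jac_evenPart {F : FormalMap (I ⊕ I)} (hF : F.jac = 1) : (evenPart F).jac = 1 := by
  ext i k
  rw [FormalMap.jac_apply, coeff_evenPart, ← FormalMap.jac_apply, hF]
  split_ifs with h
  · rfl
  · rw [Matrix.one_apply_ne]
    rintro rfl
    exact h (parity_match_X i)

/-- In degree at least 2 the excluded monomials are precisely those kept by `evenPart`. Membership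
in the complement thus becomes an equation to which `evenPart_mul` applies. -/
theorem isComplementZ_iff {F : FormalMap (I ⊕ I)} :
    IsComplementZ F ↔ F.jac = 1 ∧ evenPart F = 1 := by
  have hX : ∀ (i : I ⊕ I) (n : I ⊕ I →₀ ℕ), 2 ≤ n.degree →
      coeff n (X i : MvPowerSeries (I ⊕ I) ℂ) = 0 := by
    intro i n hn
    rw [coeff_X, if_neg]
    rintro rfl
    simp at hn
  constructor
  · rintro ⟨h1, h2, h3⟩
    refine ⟨h1, ?_⟩
    ext1
    funext i
    ext n
    rw [coeff_evenPart, FormalMap.one_comp]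
    split_ifs with h
    · rcases lt_or_ge n.degree 2 with hn | hn
      · exact FormalMap.agreeTo_X_of_jac h1 i n hn
      · rw [hX i n hn]
        rcases i with j | j
        · exact h2 j n hn fun k => h k
        · refine h3 j n hn ?_ fun k hk => ?_
          · have := h j
            simp only [parity, if_true] at this
            rw [← Nat.not_even_iff_odd]
            intro hc
            exact (Nat.even_add_one.1 this) hc
          · have := h k
            simpa [parity, hk.symm] using this
    · rw [coeff_X, if_neg]
      rintro rfl
      exact h (parity_match_X i)
  · rintro ⟨h1, h2⟩
    have key : ∀ i (n : I ⊕ I →₀ ℕ), 2 ≤ n.degree → (∀ k, Even (n (Sum.inr k) + parity i k)) →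
        coeff n (F.comp i) = 0 := by
      intro i n hn h
      have := coeff_evenPart F i n
      rwa [h2, FormalMap.one_comp, hX i n hn, if_pos h, eq_comm] at this
    refine ⟨h1, fun j n hn h => key _ n hn fun k => h k, fun j n hn h h' => key _ n hn fun k => ?_⟩
    by_cases hk : j = k
    · subst hk
      simpa [parity] using h.add_one
    · simpa [parity, hk] using h' k (Ne.symm hk)

/-! ### Maps compatible with `(x, y) ↦ (x, y²)` -/

/-- `F ∘ sqMap = sqMap ∘ H` with `F` invertible, for some `F`. -/
def Folds (H : FormalMap (I ⊕ I)) : Prop :=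
  ∃ F : (FormalMap (I ⊕ I))ˣ, (F : FormalMap (I ⊕ I)) * sqMap = sqMap * H

theorem Folds.mul {H H' : FormalMap (I ⊕ I)} (h : Folds H) (h' : Folds H') : Folds (H * H') := by
  obtain ⟨F, hF⟩ := h
  obtain ⟨F', hF'⟩ := h'
  refine ⟨F * F', ?_⟩
  rw [Units.val_mul, mul_assoc, hF', ← mul_assoc, hF, mul_assoc]

theorem Folds.inv {H : (FormalMap (I ⊕ I))ˣ} (h : Folds (H : FormalMap (I ⊕ I))) :
    Folds ((H⁻¹ : (FormalMap (I ⊕ I))ˣ) : FormalMap (I ⊕ I)) := by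
  obtain ⟨F, hF⟩ := h
  refine ⟨F⁻¹, ?_⟩
  have h1 : sqMap = ((F⁻¹ : (FormalMap (I ⊕ I))ˣ) : FormalMap (I ⊕ I)) * (sqMap * (H : FormalMap (I ⊕ I))) := by
    rw [← hF, ← mul_assoc, Units.inv_mul, one_mul]
  conv_rhs => rw [h1]
  simp only [mul_assoc, Units.mul_inv, mul_one]

theorem sqMap_mul_comp_inl (H : FormalMap (I ⊕ I)) (j : I) :
    (sqMap * H).comp (Sum.inl j) = H.comp (Sum.inl j) :=
  subst_X H.hasSubst _

theorem sqMap_mul_comp_inr (H : FormalMap (I ⊕ I)) (j : I) :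
    (sqMap * H).comp (Sum.inr j) = H.comp (Sum.inr j) ^ 2 := by
  change subst H.comp (X _ ^ 2) = _
  rw [subst_pow H.hasSubst, subst_X H.hasSubst]

/-- Sign changes pass through H and are absorbed by the fold, so the components of `sqMap * H` are
even in every y_k, that is, series in (x, y²). -/
theorem exists_unfold_of_signEquivariant {H : FormalMap (I ⊕ I)} (hH : SignEquivariant H) :
    ∃ F : FormalMap (I ⊕ I), F * sqMap = sqMap * H := by
  have h0 : ∀ i, constantCoeff (unsquare ((sqMap * H).comp i)) = 0 := by
    intro i
    rw [← coeff_zero_eq_constantCoeff_apply, unsquare, coeff_ofCoeffs]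
    have : expMap sqExp (0 : I ⊕ I →₀ ℕ) = 0 := Finsupp.sum_zero_index
    rw [this, coeff_zero_eq_constantCoeff_apply, FormalMap.zero_at]
  refine ⟨⟨fun i => unsquare ((sqMap * H).comp i), h0⟩, ?_⟩
  ext1
  funext i
  refine subst_unsquare (coeff_eq_zero_of_flip fun S => ?_)
  rw [← FormalMap.mul_comp, mul_assoc, (hH S).eq, ← mul_assoc, sqMap_mul_flip]

theorem SignEquivariant.inv {H : (FormalMap (I ⊕ I))ˣ}
    (hH : SignEquivariant (H : FormalMap (I ⊕ I))) :
    SignEquivariant ((H⁻¹ : (FormalMap (I ⊕ I))ˣ) : FormalMap (I ⊕ I)) :=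
  fun S => (hH S).units_inv_left

/-- The inverse of H descends as well, and the two descended maps are inverse to each other because
the fold can be cancelled. -/
theorem SignEquivariant.folds {H : (FormalMap (I ⊕ I))ˣ}
    (hH : SignEquivariant (H : FormalMap (I ⊕ I))) : Folds (H : FormalMap (I ⊕ I)) := by
  obtain ⟨F, hF⟩ := exists_unfold_of_signEquivariant hH
  obtain ⟨F', hF'⟩ := exists_unfold_of_signEquivariant hH.inv
  refine ⟨⟨F, F', sqMap_cancel ?_, sqMap_cancel ?_⟩, hF⟩
  · rw [mul_assoc, hF', ← mul_assoc, hF, mul_assoc, Units.mul_inv, mul_one, one_mul]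
  · rw [mul_assoc, hF, ← mul_assoc, hF', mul_assoc, Units.inv_mul, mul_one, one_mul]

theorem jac_mul_flip (H : FormalMap (I ⊕ I)) (S : Finset I) (i k : I ⊕ I) :
    (H * flip S).jac i k = H.jac i k * (Sum.elim 1 (fun k => if k ∈ S then -1 else 1) k : ℂ) := by
  rw [FormalMap.jac_mul, flip, jac_diagMap, Matrix.mul_diagonal]

theorem Folds.comp_inl_flip {H : FormalMap (I ⊕ I)} (h : Folds H) (S : Finset I) (j : I) :
    (H * flip S).comp (Sum.inl j) = H.comp (Sum.inl j) := by
  obtain ⟨F, hF⟩ := h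
  rw [← sqMap_mul_comp_inl, ← mul_assoc, ← hF, mul_assoc, sqMap_mul_flip, hF, sqMap_mul_comp_inl]

/-- The square of the component is a series in (x, y²), hence invariant under sign changes. Power
series form a domain, so the component itself can only change sign. -/
theorem Folds.comp_inr_flip {H : FormalMap (I ⊕ I)} (h : Folds H) (S : Finset I) (j : I) :
    (H * flip S).comp (Sum.inr j) = H.comp (Sum.inr j) ∨
      (H * flip S).comp (Sum.inr j) = -H.comp (Sum.inr j) := by
  obtain ⟨F, hF⟩ := h
  rw [← sq_eq_sq_iff_eq_or_eq_neg, ← sqMap_mul_comp_inr, ← mul_assoc, ← hF, mul_assoc,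
    sqMap_mul_flip, hF, sqMap_mul_comp_inr]

/-- The undetermined sign is read off from the derivative of the j-th y-component in y_j, which
equals 1. The normalization matters: a permutation of the y_j descends too, but does not commute
with individual sign changes. -/
theorem Folds.signEquivariant {H : FormalMap (I ⊕ I)} (h : Folds H) (hj : H.jac = 1) :
    SignEquivariant H := by
  intro S
  ext1
  funext i
  rw [flip_mul_comp]
  rcases i with j | j
  · rw [h.comp_inl_flip]
    simp [parity]
  · have h1 := jac_mul_flip H S (Sum.inr j) (Sum.inr j)
    rw [hj, Matrix.one_apply_eq, one_mul, Sum.elim_inr] at h1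
    rw [prod_neg_one_pow_parity]
    rw [FormalMap.jac_apply] at h1
    have hjj : coeff (Finsupp.single (Sum.inr j) 1) (H.comp (Sum.inr j)) = 1 := by
      rw [← FormalMap.jac_apply, hj, Matrix.one_apply_eq]
    rcases h.comp_inr_flip S j with h2 | h2
    · rw [h2, hjj] at h1
      rw [h2, ← h1, map_one, one_mul]
    · rw [h2, map_neg, hjj] at h1
      rw [h2, ← h1, map_neg, map_one, neg_one_mul]

/-- The square of a component of H has order 2, so it has no linear term in x. -/
theorem jac_inr_inl_of_fold {F H : FormalMap (I ⊕ I)} (h : F * sqMap = sqMap * H) (j k : I) :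
    F.jac (Sum.inr j) (Sum.inl k) = 0 := by
  have h1 := expMap_single sqExp (Sum.inl k : I ⊕ I)
  rw [FormalMap.jac_apply, ← coeff_subst_expMap sqExp_ne sqMap_eq expMap_sqExp_injective, h1,
    ← FormalMap.mul_comp, h, sqMap_mul_comp_inr, sq]
  have h2 := AgreeTo.one_of_constantCoeff (H.zero_at (Sum.inr j))
  rw [h2.mul_zero h2 _ (by simp [sqExp]), coeff_zero]

/-- Restrict to the line x = 0, y = t·(y_k) and compare coefficients of t²: the linear part of F
acts on the squares y_k², while on the other side the linear part of H is squared. -/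
theorem jac_quadratic_of_fold {F H : FormalMap (I ⊕ I)} (h : F * sqMap = sqMap * H) (j : I)
    (y : I → ℂ) :
    ∑ k, F.jac (Sum.inr j) (Sum.inr k) * y k ^ 2 =
      (∑ k, H.jac (Sum.inr j) (Sum.inr k) * y k) ^ 2 := by
  let t : MvPowerSeries Unit ℂ := X ()
  let G : I ⊕ I → MvPowerSeries Unit ℂ := Sum.elim (fun _ => 0) fun k => C (y k) * t
  let G2 : I ⊕ I → MvPowerSeries Unit ℂ := Sum.elim (fun _ => 0) fun k => C (y k ^ 2) * t ^ 2
  have ht : constantCoeff t = 0 := constantCoeff_X _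
  have hG : ∀ i, constantCoeff (G i) = 0 := by rintro (i | i) <;> simp [G, ht]
  have hG2 : ∀ i, constantCoeff (G2 i) = 0 := by rintro (i | i) <;> simp [G2, ht]
  have hsG := hasSubst_of_constantCoeff_zero hG
  have hsG2 := hasSubst_of_constantCoeff_zero hG2
  have e1 : (fun i => subst G ((sqMap : FormalMap (I ⊕ I)).comp i)) = G2 := by
    funext i
    rcases i with i | i
    · change subst G (X _) = 0
      rw [subst_X hsG]
      rfl
    · change subst G (X _ ^ 2) = C (y i ^ 2) * t ^ 2
      rw [subst_pow hsG, subst_X hsG]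
      change (C (y i) * t) ^ 2 = _
      rw [mul_pow, map_pow]
  have e2 : subst G2 (F.comp (Sum.inr j)) = subst G (H.comp (Sum.inr j)) ^ 2 := by
    rw [← subst_pow hsG, ← sqMap_mul_comp_inr, ← h, FormalMap.mul_comp,
      subst_comp_subst_apply (FormalMap.hasSubst _) hsG, e1]
  have htt : AgreeTo 2 (t ^ 2) 0 := by
    have := AgreeTo.one_of_constantCoeff ht
    rw [sq]
    exact this.mul_zero this
  have hC : ∀ {d : ℕ} {f : MvPowerSeries Unit ℂ} (a : ℂ), AgreeTo d f 0 → AgreeTo d (C a * f) 0 := by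
    intro d f a hf n hn
    rw [coeff_C_mul, hf n hn, coeff_zero, mul_zero]
  have hlin : ∀ (A : FormalMap (I ⊕ I)) (B : I ⊕ I → MvPowerSeries Unit ℂ)
      (_ : ∀ i, constantCoeff (B i) = 0),
      subst B (A.linPart.comp (Sum.inr j)) = ∑ k, C (A.jac (Sum.inr j) k) * B k :=
    fun A B hB => FormalMap.subst_linear (hasSubst_of_constantCoeff_zero hB) _
  have e3 : AgreeTo 3 (subst G2 (F.comp (Sum.inr j)))
      (C (∑ k, F.jac (Sum.inr j) (Sum.inr k) * y k ^ 2) * t ^ 2) := by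
    have h1 := AgreeTo.sub_zero_iff.2 (FormalMap.agreeTo_linPart F (Sum.inr j))
    have h2 := AgreeTo.subst_right (e := 1) hG2 (G' := fun _ => 0) (by simp) h1 (by
      rintro (i | i)
      · exact AgreeTo.refl _
      · exact hC _ htt)
    rw [subst_sub hsG2, hlin F G2 hG2] at h2
    have h3 : subst (fun _ => (0 : MvPowerSeries Unit ℂ))
        (F.comp (Sum.inr j) - F.linPart.comp (Sum.inr j)) = 0 :=
      subst_zero_of_constantCoeff_zero (by simp [FormalMap.zero_at])
    rw [h3, AgreeTo.sub_zero_iff, Fintype.sum_sum_type] at h2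
    have h4 : C (∑ k, F.jac (Sum.inr j) (Sum.inr k) * y k ^ 2) * t ^ 2 =
        ∑ k, C (F.jac (Sum.inr j) (Sum.inl k)) * G2 (Sum.inl k) +
          ∑ k, C (F.jac (Sum.inr j) (Sum.inr k)) * G2 (Sum.inr k) := by
      simp [G2, Finset.sum_mul, mul_assoc]
    rw [h4]
    exact h2
  have e4 : AgreeTo 2 (subst G (H.comp (Sum.inr j)))
      (C (∑ k, H.jac (Sum.inr j) (Sum.inr k) * y k) * t) := by
    have h2 := (FormalMap.agreeTo_linPart H (Sum.inr j)).subst hG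
    rw [hlin H G hG, Fintype.sum_sum_type] at h2
    have h4 : C (∑ k, H.jac (Sum.inr j) (Sum.inr k) * y k) * t =
        ∑ k, C (H.jac (Sum.inr j) (Sum.inl k)) * G (Sum.inl k) +
          ∑ k, C (H.jac (Sum.inr j) (Sum.inr k)) * G (Sum.inr k) := by
      simp [G, Finset.sum_mul, mul_assoc]
    rw [h4]
    exact h2
  have e5 : AgreeTo 3 (subst G (H.comp (Sum.inr j)) ^ 2)
      ((C (∑ k, H.jac (Sum.inr j) (Sum.inr k) * y k) * t) ^ 2) := by
    rw [← AgreeTo.sub_zero_iff, sq_sub_sq, mul_comm]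
    refine (AgreeTo.sub_zero_iff.2 e4).mul_zero (AgreeTo.one_of_constantCoeff ?_)
    rw [map_add, constantCoeff_subst_eq_zero hsG hG (H.zero_at _), map_mul, ht]
    simp
  have e6 := e3 (Finsupp.single () 2) (by simp)
  rw [e2, e5 _ (by simp), mul_pow, ← map_pow, coeff_C_mul, coeff_C_mul] at e6
  have e7 : coeff (Finsupp.single () 2) (t ^ 2) = 1 := by
    simp [t, X_pow_eq, coeff_monomial_same]
  rw [e7, mul_one, mul_one] at e6
  exact e6.symm

theorem Folds.jac_inl_inr {H : FormalMap (I ⊕ I)} (h : Folds H) (j k : I) :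
    H.jac (Sum.inl j) (Sum.inr k) = 0 := by
  have h1 := jac_mul_flip H Finset.univ (Sum.inl j) (Sum.inr k)
  rw [FormalMap.jac_apply, h.comp_inl_flip, ← FormalMap.jac_apply] at h1
  simp only [Sum.elim_inr, Finset.mem_univ, if_true] at h1
  linear_combination (1 / 2 : ℂ) * h1

/-- Otherwise the quadratic identity would make a whole row of the Jacobian of the descended map
vanish, against its invertibility. -/
theorem Folds.jac_row_ne {H : FormalMap (I ⊕ I)} (h : Folds H) (j : I) :
    ∃ k, H.jac (Sum.inr j) (Sum.inr k) ≠ 0 := by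
  obtain ⟨F, hF⟩ := h
  by_contra! hc
  have h1 : ∀ k, (F : FormalMap (I ⊕ I)).jac (Sum.inr j) k = 0 := by
    rintro (k | k)
    · exact jac_inr_inl_of_fold hF j k
    · have := jac_quadratic_of_fold hF j (Pi.single k 1)
      simpa [hc, Pi.single_apply] using this
  have h2 := (FormalMap.isUnit_iff_jac.1 F.isUnit)
  rw [Matrix.isUnit_iff_isUnit_det, Matrix.det_eq_zero_of_row_eq_zero _ h1] at h2
  exact not_isUnit_zero h2

theorem Folds.comp_inr_flip_univ {H : FormalMap (I ⊕ I)} (h : Folds H) (j : I) :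
    (H * flip Finset.univ).comp (Sum.inr j) = -H.comp (Sum.inr j) := by
  rcases h.comp_inr_flip Finset.univ j with h2 | h2
  · exfalso
    obtain ⟨k, hk⟩ := h.jac_row_ne j
    have h1 := jac_mul_flip H Finset.univ (Sum.inr j) (Sum.inr k)
    rw [FormalMap.jac_apply, h2, ← FormalMap.jac_apply] at h1
    simp only [Sum.elim_inr, Finset.mem_univ, if_true] at h1
    exact hk (by linear_combination (1 / 2 : ℂ) * h1)
  · exact h2

/-- Each y-component of H has a nonzero linear term in y, so the simultaneous sign change must act
on it by -1. No assumption on the linear part is needed here. -/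
theorem Folds.commute_flip_univ {H : FormalMap (I ⊕ I)} (h : Folds H) :
    Commute H (flip Finset.univ) := by
  ext1
  funext i
  rw [flip_mul_comp]
  rcases i with j | j
  · rw [h.comp_inl_flip]
    simp [parity]
  · rw [h.comp_inr_flip_univ, prod_neg_one_pow_parity]
    simp

theorem Folds.jac_inr_inl {H : FormalMap (I ⊕ I)} (h : Folds H) (j k : I) :
    H.jac (Sum.inr j) (Sum.inl k) = 0 := by
  have h1 := jac_mul_flip H Finset.univ (Sum.inr j) (Sum.inl k)
  rw [FormalMap.jac_apply, h.comp_inr_flip_univ, map_neg, ← FormalMap.jac_apply] at h1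
  simp only [Sum.elim_inl, Pi.one_apply] at h1
  linear_combination (-1 / 2 : ℂ) * h1

theorem jac_inl_inl_of_fold {F H : FormalMap (I ⊕ I)} (h : F * sqMap = sqMap * H) (j k : I) :
    F.jac (Sum.inl j) (Sum.inl k) = H.jac (Sum.inl j) (Sum.inl k) := by
  have h1 := expMap_single sqExp (Sum.inl k : I ⊕ I)
  rw [FormalMap.jac_apply, ← coeff_subst_expMap sqExp_ne sqMap_eq expMap_sqExp_injective, h1,
    ← FormalMap.mul_comp, h, sqMap_mul_comp_inl]
  rfl

/-- The Jacobian of H is block diagonal and that of F is block triangular with the same x-block, so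
a kernel vector of H has x = 0. For its y-part the quadratic identity says that the y-block of F
kills (y_k²), whence y = 0. -/
theorem Folds.isUnit {H : FormalMap (I ⊕ I)} (h : Folds H) : IsUnit H := by
  have h' := h
  obtain ⟨F, hF⟩ := h'
  refine FormalMap.isUnit_of_injective fun v hv => ?_
  have hv' : ∀ i, ∑ k, H.jac i k * v k = 0 := fun i => congrFun hv i
  simp only [Fintype.sum_sum_type] at hv'
  have hx : (Sum.elim (fun k => v (Sum.inl k)) 0 : I ⊕ I → ℂ) = 0 := by
    refine FormalMap.mulVec_jac_injective F.isUnit ?_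
    funext i
    change ∑ k, _ * _ = (0 : ℂ)
    rw [Fintype.sum_sum_type]
    rcases i with j | j
    · have := hv' (Sum.inl j)
      simp only [h.jac_inl_inr, zero_mul, Finset.sum_const_zero, add_zero] at this
      simpa [jac_inl_inl_of_fold hF] using this
    · simp [jac_inr_inl_of_fold hF]
  have hx' : ∀ k, v (Sum.inl k) = 0 := fun k => congrFun hx (Sum.inl k)
  have hy : ∀ j, ∑ k, (F : FormalMap (I ⊕ I)).jac (Sum.inr j) (Sum.inr k) *
      v (Sum.inr k) ^ 2 = 0 := by
    intro j
    rw [jac_quadratic_of_fold hF j fun k => v (Sum.inr k)]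
    have := hv' (Sum.inr j)
    simp only [h.jac_inr_inl, zero_mul, Finset.sum_const_zero, zero_add] at this
    rw [this, zero_pow two_ne_zero]
  have hdet := FormalMap.isUnit_iff_jac.1 F.isUnit
  have hblock : (F : FormalMap (I ⊕ I)).jac = Matrix.fromBlocks
      (F : FormalMap (I ⊕ I)).jac.toBlocks₁₁ (F : FormalMap (I ⊕ I)).jac.toBlocks₁₂ 0
      (F : FormalMap (I ⊕ I)).jac.toBlocks₂₂ := by
    ext i k
    rcases i with i | i <;> rcases k with k | k <;> try rfl
    exact jac_inr_inl_of_fold hF i k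
  rw [Matrix.isUnit_iff_isUnit_det, hblock, Matrix.det_fromBlocks_zero₂₁] at hdet
  have h22 : IsUnit (F : FormalMap (I ⊕ I)).jac.toBlocks₂₂ := by
    rw [Matrix.isUnit_iff_isUnit_det]
    exact isUnit_of_mul_isUnit_right hdet
  have hz : (fun k => v (Sum.inr k) ^ 2) = 0 := by
    rw [← Matrix.mulVec_injective_iff_isUnit] at h22
    refine h22 ?_
    rw [Matrix.mulVec_zero]
    funext j
    exact hy j
  funext i
  rcases i with k | k
  · exact hx' k
  · exact pow_eq_zero_iff two_ne_zero |>.1 (congrFun hz k)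

/-- A linear map preserving the splitting, whose second block is a monomial matrix, folds. -/
theorem folds_of_monomial {P : FormalMap (I ⊕ I)} (hP : IsUnit P) (hlin : P.linPart = P)
    (h12 : ∀ j k, P.jac (Sum.inl j) (Sum.inr k) = 0)
    (h21 : ∀ j k, P.jac (Sum.inr j) (Sum.inl k) = 0)
    (h22 : ∀ j k l, k ≠ l → P.jac (Sum.inr j) (Sum.inr k) * P.jac (Sum.inr j) (Sum.inr l) = 0) :
    Folds P := by
  let A : Matrix (I ⊕ I) (I ⊕ I) ℂ := Matrix.of fun i k =>
    Sum.elim (fun _ => P.jac i k) (fun _ => P.jac i k ^ 2) i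
  -- Each row has at most one nonzero entry in the second block, so squaring produces no cross
  -- terms.
  have hsq : ∀ j (f : I → MvPowerSeries (I ⊕ I) ℂ),
      (∑ k, C (P.jac (Sum.inr j) (Sum.inr k)) * f k) ^ 2 =
        ∑ k, C (P.jac (Sum.inr j) (Sum.inr k) ^ 2) * f k ^ 2 := by
    intro j f
    rw [sq, Finset.sum_mul_sum]
    refine Finset.sum_congr rfl fun k _ => ?_
    rw [Finset.sum_eq_single k]
    · rw [map_pow]
      ring
    · intro l _ hl
      have : C (P.jac (Sum.inr j) (Sum.inr k)) * f k * (C (P.jac (Sum.inr j) (Sum.inr l)) * f l) =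
          C (P.jac (Sum.inr j) (Sum.inr k) * P.jac (Sum.inr j) (Sum.inr l)) * (f k * f l) := by
        rw [map_mul]
        ring
      rw [this, h22 j k l hl.symm, map_zero, zero_mul]
    · simp
  have hsq' : ∀ j (f : I → ℂ), (∑ k, P.jac (Sum.inr j) (Sum.inr k) * f k) ^ 2 =
        ∑ k, P.jac (Sum.inr j) (Sum.inr k) ^ 2 * f k ^ 2 := by
    intro j f
    have := congrArg constantCoeff (hsq j fun k => C (f k))
    simpa using this
  have hA : IsUnit (FormalMap.ofMatrix A) := by
    refine FormalMap.isUnit_of_injective fun v hv => ?_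
    rw [FormalMap.jac_ofMatrix] at hv
    have hv' : ∀ i, ∑ k, A i k * v k = 0 := fun i => congrFun hv i
    simp only [Fintype.sum_sum_type] at hv'
    -- Taking a componentwise square root of the second half of a kernel vector of the squared
    -- matrix brings it back to the kernel of `P`.
    choose w hw using fun k => IsAlgClosed.exists_pow_nat_eq (v (Sum.inr k)) zero_lt_two
    have hu : (Sum.elim (fun k => v (Sum.inl k)) w : I ⊕ I → ℂ) = 0 := by
      refine FormalMap.mulVec_jac_injective hP ?_
      funext i
      change ∑ k, _ * _ = (0 : ℂ)
      rw [Fintype.sum_sum_type]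
      rcases i with j | j
      · simpa [A, h12] using hv' (Sum.inl j)
      · simp only [h21, zero_mul, Finset.sum_const_zero, zero_add, Sum.elim_inr]
        rw [← pow_eq_zero_iff two_ne_zero, hsq']
        simpa [A, h21, hw] using hv' (Sum.inr j)
    funext i
    rcases i with k | k
    · exact congrFun hu (Sum.inl k)
    · have := congrFun hu (Sum.inr k)
      rw [← hw, show w k = 0 from this]
      simp
  obtain ⟨F, hF⟩ := hA
  refine ⟨F, ?_⟩
  rw [hF, ← hlin, FormalMap.linPart_eq]
  ext1
  funext i
  rw [FormalMap.ofMatrix_mul_comp, Fintype.sum_sum_type]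
  rcases i with j | j
  · rw [sqMap_mul_comp_inl, FormalMap.ofMatrix_comp, Fintype.sum_sum_type]
    simp [A, h12, sqMap]
  · rw [sqMap_mul_comp_inr, FormalMap.ofMatrix_comp, Fintype.sum_sum_type]
    simp only [h21, map_zero, zero_mul, Finset.sum_const_zero, zero_add]
    rw [hsq]
    simp [A, h21, sqMap]

end Squares

/-! ### Series in the products `ξ_j η_j` -/

section Products

variable {I : Type} [Fintype I] [DecidableEq I]

theorem constantCoeff_X_mul_X (k : I) :
    constantCoeff (X (Sum.inl k) * X (Sum.inr k) : MvPowerSeries (I ⊕ I) ℂ) = 0 := by simp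

theorem hasSubst_prod :
    HasSubst (fun k => (X (Sum.inl k) * X (Sum.inr k) : MvPowerSeries (I ⊕ I) ℂ)) :=
  hasSubst_of_constantCoeff_zero constantCoeff_X_mul_X

theorem ofProd_mul (f g : MvPowerSeries I ℂ) : ofProd (f * g) = ofProd f * ofProd g :=
  subst_mul hasSubst_prod f g

theorem ofProd_C (a : ℂ) : ofProd (C a : MvPowerSeries I ℂ) = C a := subst_C a

theorem ofProd_one : ofProd (1 : MvPowerSeries I ℂ) = 1 := by
  rw [← map_one C, ofProd_C, map_one]

theorem ofProd_X (k : I) : ofProd (X k : MvPowerSeries I ℂ) = X (Sum.inl k) * X (Sum.inr k) :=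
  subst_X hasSubst_prod k

/-- Exponents of the monomials `ξ_j η_j`. -/
def prodExp (j : I) : I ⊕ I →₀ ℕ := Finsupp.single (Sum.inl j) 1 + Finsupp.single (Sum.inr j) 1

theorem prodExp_ne (j : I) : prodExp j ≠ 0 := by
  intro h
  have := DFunLike.congr_fun h (Sum.inl j)
  simp [prodExp] at this

theorem X_mul_X_eq (j : I) :
    (X (Sum.inl j) * X (Sum.inr j) : MvPowerSeries (I ⊕ I) ℂ) = monomial (prodExp j) 1 := by
  rw [X_def, X_def, monomial_mul_monomial, one_mul]
  rfl

theorem expMap_prodExp_inl (n : I →₀ ℕ) (j : I) : expMap prodExp n (Sum.inl j) = n j := by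
  rw [expMap_apply, Finset.sum_eq_single j]
  · simp [prodExp]
  · intro k _ hk
    simp [prodExp, hk]
  · simp

theorem expMap_prodExp_inr (n : I →₀ ℕ) (j : I) : expMap prodExp n (Sum.inr j) = n j := by
  rw [expMap_apply, Finset.sum_eq_single j]
  · simp [prodExp]
  · intro k _ hk
    simp [prodExp, hk]
  · simp

theorem expMap_prodExp_injective : Function.Injective (expMap (prodExp (I := I))) := by
  intro n m h
  ext j
  have := DFunLike.congr_fun h (Sum.inl j)
  rwa [expMap_prodExp_inl, expMap_prodExp_inl] at this

theorem coeff_ofProd_expMap (f : MvPowerSeries I ℂ) (n : I →₀ ℕ) :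
    coeff (expMap prodExp n) (ofProd f) = coeff n f :=
  coeff_subst_expMap prodExp_ne X_mul_X_eq expMap_prodExp_injective f n

theorem ofProd_injective : Function.Injective (ofProd (I := I)) := by
  intro f g h
  ext n
  rw [← coeff_ofProd_expMap, h, coeff_ofProd_expMap]

theorem constantCoeff_ofProd (f : MvPowerSeries I ℂ) :
    constantCoeff (ofProd f) = constantCoeff f := by
  have := coeff_ofProd_expMap f 0
  rwa [show expMap (prodExp (I := I)) 0 = 0 from Finsupp.sum_zero_index,
    coeff_zero_eq_constantCoeff_apply, coeff_zero_eq_constantCoeff_apply] at this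

theorem ofProd_mul_inv {f : MvPowerSeries I ℂ} (hf : constantCoeff f ≠ 0) :
    ofProd f * ofProd f⁻¹ = 1 := by
  rw [← ofProd_mul, MvPowerSeries.mul_inv_cancel f hf, ofProd_one]

/-- If every monomial of `f` is a monomial in the products times `X i`, then `f` is `X i` times a
series in the products. -/
theorem exists_ofProd_mul_X {f : MvPowerSeries (I ⊕ I) ℂ} (i : I ⊕ I)
    (hf : ∀ n, coeff n f ≠ 0 → ∃ m, n = expMap prodExp m + Finsupp.single i 1) :
    ∃ a, f = ofProd a * X i := by
  refine ⟨ofCoeffs fun m => coeff (expMap prodExp m + Finsupp.single i 1) f, ?_⟩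
  set a : MvPowerSeries I ℂ := ofCoeffs fun m => coeff (expMap prodExp m + Finsupp.single i 1) f
  ext n
  by_cases h : ∃ l, n = l + Finsupp.single i 1
  · obtain ⟨l, rfl⟩ := h
    rw [X_def, coeff_add_mul_monomial, mul_one]
    by_cases hl : l ∈ Set.range (expMap prodExp)
    · obtain ⟨m, rfl⟩ := hl
      rw [coeff_ofProd_expMap]
      rfl
    · rw [ofProd, coeff_subst_notMem prodExp_ne X_mul_X_eq _ hl]
      by_contra hc
      obtain ⟨m, hm⟩ := hf _ hc
      exact hl ⟨m, (add_right_cancel hm).symm⟩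
  · have h1 : coeff n f = 0 := by
      by_contra hc
      obtain ⟨m, hm⟩ := hf _ hc
      exact h ⟨_, hm⟩
    rw [h1, X_def, coeff_mul_monomial, if_neg]
    intro hle
    exact h ⟨n - Finsupp.single i 1, (tsub_add_cancel_of_le hle).symm⟩

theorem subst_ofProd {W : Type} {G : I ⊕ I → MvPowerSeries W ℂ}
    (hG : ∀ i, constantCoeff (G i) = 0) (f : MvPowerSeries I ℂ) :
    subst G (ofProd f) = subst (fun k => G (Sum.inl k) * G (Sum.inr k)) f := by
  have hs := hasSubst_of_constantCoeff_zero hG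
  rw [ofProd, subst_comp_subst_apply hasSubst_prod hs]
  congr 1
  funext k
  rw [subst_mul hs, subst_X hs, subst_X hs]

/-- The map `ξ_j' = a_j(ξη) ξ_j`, `η_j' = b_j(ξη) η_j`. -/
def hatMap (a b : I → MvPowerSeries I ℂ) : FormalMap (I ⊕ I) :=
  ⟨Sum.elim (fun j => ofProd (a j) * X (Sum.inl j)) (fun j => ofProd (b j) * X (Sum.inr j)),
    by rintro (j | j) <;> simp⟩

/-- The map `ζ_j' = c_j(ζ) ζ_j`. -/
def scaleMap (c : I → MvPowerSeries I ℂ) : FormalMap I := ⟨fun k => c k * X k, by simp⟩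

theorem subst_hatMap_ofProd (a b : I → MvPowerSeries I ℂ) (f : MvPowerSeries I ℂ) :
    subst (hatMap a b).comp (ofProd f) = ofProd (subst (scaleMap (a * b)).comp f) := by
  rw [subst_ofProd (hatMap a b).zero_at, ofProd, subst_comp_subst_apply (scaleMap _).hasSubst
    hasSubst_prod]
  congr 1
  funext k
  change ofProd (a k) * X _ * (ofProd (b k) * X _) = ofProd (a k * b k * X k)
  rw [ofProd_mul, ofProd_mul, ofProd_X]
  ring

/-- The inner map multiplies ξ_k η_k by c_k d_k, so the coefficients of the outer map are evaluated
along `scaleMap (c * d)`. -/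
theorem hatMap_mul (a b c d : I → MvPowerSeries I ℂ) :
    hatMap a b * hatMap c d =
      hatMap (fun j => subst (scaleMap (c * d)).comp (a j) * c j)
        (fun j => subst (scaleMap (c * d)).comp (b j) * d j) := by
  ext1
  funext i
  rcases i with j | j
  · change subst (hatMap c d).comp (ofProd (a j) * X _) = ofProd (_ * c j) * X _
    rw [subst_mul (FormalMap.hasSubst _), subst_X (FormalMap.hasSubst _), subst_hatMap_ofProd,
      ofProd_mul, mul_assoc]
    rfl
  · change subst (hatMap c d).comp (ofProd (b j) * X _) = ofProd (_ * d j) * X _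
    rw [subst_mul (FormalMap.hasSubst _), subst_X (FormalMap.hasSubst _), subst_hatMap_ofProd,
      ofProd_mul, mul_assoc]
    rfl

theorem scaleMap_one : scaleMap (1 : I → MvPowerSeries I ℂ) = 1 := by
  ext1
  funext k
  exact one_mul _

/-- When c d = 1 the products ξ_k η_k are invariant, and the maps compose like diagonal matrices
over the ring of series in ξη. -/
theorem hatMap_mul_of_mul_eq_one (a b : I → MvPowerSeries I ℂ) {c d : I → MvPowerSeries I ℂ}
    (h : c * d = 1) : hatMap a b * hatMap c d = hatMap (a * c) (b * d) := by
  have hs : ∀ f : MvPowerSeries I ℂ, subst (1 : FormalMap I).comp f = f := fun f =>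
    congrFun subst_self f
  rw [hatMap_mul, h, scaleMap_one]
  simp only [hs]
  rfl

theorem hatMap_one : hatMap (1 : I → MvPowerSeries I ℂ) 1 = 1 := by
  ext1
  funext i
  rcases i with j | j
  · change ofProd 1 * X _ = X _
    rw [ofProd_one, one_mul]
  · change ofProd 1 * X _ = X _
    rw [ofProd_one, one_mul]

theorem X_ne_zero {V : Type} (i : V) : (X i : MvPowerSeries V ℂ) ≠ 0 := by
  intro h
  have := congrArg (coeff (Finsupp.single i 1)) h
  rw [coeff_index_single_self_X, coeff_zero] at this
  exact one_ne_zero this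

theorem hatMap_injective {a b a' b' : I → MvPowerSeries I ℂ} (h : hatMap a b = hatMap a' b') :
    a = a' ∧ b = b' := by
  constructor
  · funext j
    have := congrFun (congrArg FormalMap.comp h) (Sum.inl j)
    exact ofProd_injective (mul_right_cancel₀ (X_ne_zero _) this)
  · funext j
    have := congrFun (congrArg FormalMap.comp h) (Sum.inr j)
    exact ofProd_injective (mul_right_cancel₀ (X_ne_zero _) this)

theorem coeff_single_mul_X (f : MvPowerSeries (I ⊕ I) ℂ) (i k : I ⊕ I) :
    coeff (Finsupp.single k 1) (f * X i) = constantCoeff f * (1 : Matrix (I ⊕ I) (I ⊕ I) ℂ) i k := by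
  have h1 : AgreeTo 1 (f - C (constantCoeff f)) 0 := AgreeTo.one_of_constantCoeff (by simp)
  have h2 : AgreeTo 1 (X i : MvPowerSeries (I ⊕ I) ℂ) 0 :=
    AgreeTo.one_of_constantCoeff (constantCoeff_X i)
  have h3 := h1.mul_zero h2 (Finsupp.single k 1) (by simp)
  rw [sub_mul, map_sub, coeff_zero, sub_eq_zero, coeff_C_mul] at h3
  rw [h3, ← FormalMap.jac_one]
  rfl

theorem jac_hatMap (a b : I → MvPowerSeries I ℂ) :
    (hatMap a b).jac = Matrix.diagonal (Sum.elim (fun j => constantCoeff (a j))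
      fun j => constantCoeff (b j)) := by
  ext i k
  rw [← Matrix.mul_one (Matrix.diagonal _), Matrix.diagonal_mul]
  rcases i with j | j
  · change coeff _ (ofProd (a j) * X _) = _
    rw [coeff_single_mul_X, constantCoeff_ofProd]
    rfl
  · change coeff _ (ofProd (b j) * X _) = _
    rw [coeff_single_mul_X, constantCoeff_ofProd]
    rfl

/-- The exchange of `ξ` and `η`. -/
def swapMap : FormalMap (I ⊕ I) := ⟨fun i => X (Sum.swap i), fun _ => constantCoeff_X _⟩

theorem swapMap_mul_comp (F : FormalMap (I ⊕ I)) (i : I ⊕ I) :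
    (swapMap * F).comp i = F.comp (Sum.swap i) := subst_X F.hasSubst _

theorem swapMap_mul_self : (swapMap : FormalMap (I ⊕ I)) * swapMap = 1 := by
  ext1
  funext i
  rw [swapMap_mul_comp]
  change X (Sum.swap (Sum.swap i)) = X i
  rw [Sum.swap_swap]

theorem subst_swapMap_ofProd (f : MvPowerSeries I ℂ) :
    subst swapMap.comp (ofProd f) = ofProd f := by
  rw [subst_ofProd swapMap.zero_at, ofProd]
  congr 1
  funext k
  exact mul_comm _ _

theorem swapMap_mul_hatMap (a b : I → MvPowerSeries I ℂ) :
    swapMap * hatMap a b = hatMap b a * swapMap := by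
  ext1
  funext i
  rw [swapMap_mul_comp]
  rcases i with j | j
  · change ofProd (b j) * X _ = subst swapMap.comp (ofProd (b j) * X _)
    rw [subst_mul swapMap.hasSubst, subst_swapMap_ofProd, subst_X swapMap.hasSubst]
    rfl
  · change ofProd (a j) * X _ = subst swapMap.comp (ofProd (a j) * X _)
    rw [subst_mul swapMap.hasSubst, subst_swapMap_ofProd, subst_X swapMap.hasSubst]
    rfl

theorem hatSigma_eq (M : I → MvPowerSeries I ℂ) : hatSigma M = hatMap M fun j => (M j)⁻¹ := rfl

theorem hatTau_eq (L : I → MvPowerSeries I ℂ) :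
    hatTau L = hatMap L (fun j => (L j)⁻¹) * swapMap := by
  ext1
  funext i
  rcases i with j | j
  · change _ = subst swapMap.comp (ofProd (L j) * X _)
    rw [subst_mul swapMap.hasSubst, subst_swapMap_ofProd, subst_X swapMap.hasSubst]
    rfl
  · change _ = subst swapMap.comp (ofProd (L j)⁻¹ * X _)
    rw [subst_mul swapMap.hasSubst, subst_swapMap_ofProd, subst_X swapMap.hasSubst]
    rfl

theorem mul_inv_eq_one_of {L : I → MvPowerSeries I ℂ} (hL : ∀ j, constantCoeff (L j) ≠ 0) :
    (L * fun j => (L j)⁻¹) = 1 := by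
  funext j
  exact MvPowerSeries.mul_inv_cancel _ (hL j)

theorem hatTau_mul_self {L : I → MvPowerSeries I ℂ} (hL : ∀ j, constantCoeff (L j) ≠ 0) :
    hatTau L * hatTau L = 1 := by
  rw [hatTau_eq, mul_assoc, ← mul_assoc swapMap, swapMap_mul_hatMap, mul_assoc, swapMap_mul_self,
    mul_one, hatMap_mul_of_mul_eq_one, mul_inv_eq_one_of hL, mul_comm, mul_inv_eq_one_of hL,
    hatMap_one]
  rw [mul_comm, mul_inv_eq_one_of hL]

/-! ### The straightening map -/

theorem straighten_comp_inl (L : I → MvPowerSeries I ℂ) (j : I) :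
    (straighten L).comp (Sum.inl j) = X (Sum.inl j) + ofProd (L j) * X (Sum.inr j) := rfl

theorem straighten_comp_inr (L : I → MvPowerSeries I ℂ) (j : I) :
    (straighten L).comp (Sum.inr j) = X (Sum.inr j) - ofProd (L j)⁻¹ * X (Sum.inl j) := rfl

theorem jac_straighten_inl (L : I → MvPowerSeries I ℂ) (j : I) (k : I ⊕ I) :
    (straighten L).jac (Sum.inl j) k =
      (1 : Matrix (I ⊕ I) (I ⊕ I) ℂ) (Sum.inl j) k +
        constantCoeff (L j) * (1 : Matrix (I ⊕ I) (I ⊕ I) ℂ) (Sum.inr j) k := by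
  rw [FormalMap.jac_apply, straighten_comp_inl, map_add, coeff_single_mul_X, constantCoeff_ofProd,
    ← FormalMap.one_comp, ← FormalMap.jac_apply, FormalMap.jac_one]

theorem jac_straighten_inr (L : I → MvPowerSeries I ℂ) (j : I) (k : I ⊕ I) :
    (straighten L).jac (Sum.inr j) k =
      (1 : Matrix (I ⊕ I) (I ⊕ I) ℂ) (Sum.inr j) k -
        (constantCoeff (L j))⁻¹ * (1 : Matrix (I ⊕ I) (I ⊕ I) ℂ) (Sum.inl j) k := by
  rw [FormalMap.jac_apply, straighten_comp_inr, map_sub, coeff_single_mul_X, constantCoeff_ofProd,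
    ← FormalMap.one_comp, ← FormalMap.jac_apply, FormalMap.jac_one, constantCoeff_inv]

/-- The linear part splits into 2 × 2 blocks of determinant 2. -/
theorem isUnit_straighten {L : I → MvPowerSeries I ℂ} (hL : ∀ j, constantCoeff (L j) ≠ 0) :
    IsUnit (straighten L) := by
  refine FormalMap.isUnit_of_injective fun v hv => ?_
  have h1 : ∀ j, v (Sum.inl j) + constantCoeff (L j) * v (Sum.inr j) = 0 := by
    intro j
    have := congrFun hv (Sum.inl j)
    simpa [Matrix.mulVec, dotProduct, jac_straighten_inl, add_mul, Finset.sum_add_distrib,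
      Matrix.one_apply] using this
  have h2 : ∀ j, v (Sum.inr j) - (constantCoeff (L j))⁻¹ * v (Sum.inl j) = 0 := by
    intro j
    have := congrFun hv (Sum.inr j)
    simp only [Matrix.mulVec, dotProduct, jac_straighten_inr, sub_mul, Finset.sum_sub_distrib,
      Matrix.one_apply] at this
    simpa using this
  have h3 : ∀ j, v (Sum.inr j) = 0 := by
    intro j
    have a1 := h1 j
    have a2 := h2 j
    have a3 : v (Sum.inl j) = constantCoeff (L j) * v (Sum.inr j) := by
      field_simp [hL j] at a2
      linear_combination -a2
    have a4 : 2 * (constantCoeff (L j) * v (Sum.inr j)) = 0 := by linear_combination a1 - a3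
    simpa [hL j] using a4
  funext i
  rcases i with j | j
  · have := h1 j
    rw [h3 j] at this
    simpa using this
  · exact h3 j

theorem subst_hatTau_ofProd {L : I → MvPowerSeries I ℂ} (hL : ∀ j, constantCoeff (L j) ≠ 0)
    (f : MvPowerSeries I ℂ) : subst (hatTau L).comp (ofProd f) = ofProd f := by
  rw [subst_ofProd (hatTau L).zero_at, ofProd]
  congr 1
  funext k
  change ofProd (L k) * X _ * (ofProd (L k)⁻¹ * X _) = _
  linear_combination (X (Sum.inl k) * X (Sum.inr k)) * ofProd_mul_inv (hL k)

/-- The coefficients are invariant under τ̂₁ and behave as constants: ξ + Λη is fixed, and η - Λ⁻¹ξ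
changes sign. -/
theorem straighten_mul_hatTau {L : I → MvPowerSeries I ℂ} (hL : ∀ j, constantCoeff (L j) ≠ 0) :
    straighten L * hatTau L = flip Finset.univ * straighten L := by
  have hs := (hatTau L).hasSubst
  ext1
  funext i
  rw [flip_mul_comp]
  rcases i with j | j
  · change subst _ (X _ + ofProd (L j) * X _) = _
    rw [subst_add hs, subst_mul hs, subst_X hs, subst_X hs, subst_hatTau_ofProd hL]
    change ofProd (L j) * X _ + ofProd (L j) * (ofProd (L j)⁻¹ * X _) = _
    rw [straighten_comp_inl]
    simp only [parity, pow_zero, Finset.prod_const_one, map_one, one_mul]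
    linear_combination X (Sum.inl j) * ofProd_mul_inv (hL j)
  · change subst _ (X _ - ofProd (L j)⁻¹ * X _) = _
    rw [subst_sub hs, subst_mul hs, subst_X hs, subst_X hs, subst_hatTau_ofProd hL,
      prod_neg_one_pow_parity, if_pos (Finset.mem_univ _), straighten_comp_inr, map_neg, map_one]
    change ofProd (L j)⁻¹ * X _ - ofProd (L j)⁻¹ * (ofProd (L j) * X _) = _
    linear_combination -X (Sum.inr j) * ofProd_mul_inv (hL j)

theorem mapR_eq (ε : I → ℂ) : mapR ε = diagMap (Sum.elim ε ε) := by
  ext1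
  funext i
  rcases i with j | j <;> rfl

theorem mapR_eq_hatMap (ε : I → ℂ) : mapR ε = hatMap (fun j => C (ε j)) fun j => C (ε j) := by
  ext1
  funext i
  rcases i with j | j
  · change C _ * X _ = ofProd _ * X _
    rw [ofProd_C]
  · change C _ * X _ = ofProd _ * X _
    rw [ofProd_C]

theorem mapR_mul_self {ε : I → ℂ} (hε : ∀ j, ε j = 1 ∨ ε j = -1) : mapR ε * mapR ε = 1 := by
  rw [mapR_eq, diagMap_mul, ← diagMap_one]
  congr 1
  funext i
  rcases i with j | j <;> rcases hε j with h | h <;> simp [h]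

theorem mapR_mul (ε δ : I → ℂ) : mapR ε * mapR δ = mapR (ε * δ) := by
  rw [mapR_eq, mapR_eq, mapR_eq, diagMap_mul]
  congr 1
  funext i
  rcases i with j | j <;> rfl

theorem straighten_mul_mapR (L : I → MvPowerSeries I ℂ) {ε : I → ℂ}
    (hε : ∀ j, ε j = 1 ∨ ε j = -1) : straighten L * mapR ε = mapR ε * straighten L := by
  have hs := (mapR ε).hasSubst
  have hp : ∀ f : MvPowerSeries I ℂ, subst (mapR ε).comp (ofProd f) = ofProd f := by
    intro f
    rw [subst_ofProd (mapR ε).zero_at, ofProd]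
    congr 1
    funext k
    change C (ε k) * X _ * (C (ε k) * X _) = _
    rcases hε k with h | h <;> rw [h] <;> simp
  ext1
  funext i
  rw [mapR_eq ε, diagMap_mul_comp, ← mapR_eq]
  rcases i with j | j
  · change subst _ (X _ + ofProd (L j) * X _) = _
    rw [subst_add hs, subst_mul hs, subst_X hs, subst_X hs, hp, straighten_comp_inl]
    change C (ε j) * X _ + ofProd (L j) * (C (ε j) * X _) = C (ε j) * _
    ring
  · change subst _ (X _ - ofProd (L j)⁻¹ * X _) = _
    rw [subst_sub hs, subst_mul hs, subst_X hs, subst_X hs, hp, straighten_comp_inr]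
    change C (ε j) * X _ - ofProd (L j)⁻¹ * (C (ε j) * X _) = C (ε j) * _
    ring

/-- Squaring forgets the signs in the second block. This is why the automorphisms of a normal form
act trivially on z''. -/
theorem mapL_mul_sqMap {ε : I → ℂ} (hε : ∀ j, ε j = 1 ∨ ε j = -1) :
    mapL ε * sqMap = sqMap * mapR ε := by
  ext1
  funext i
  have hs := (sqMap (I := I)).hasSubst
  rcases i with j | j
  · rw [sqMap_mul_comp_inl]
    change subst _ (C (ε j) * X _) = C (ε j) * X _
    rw [subst_mul hs, subst_C, subst_X hs]
    rfl
  · rw [sqMap_mul_comp_inr]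
    change subst _ (X _) = (C (ε j) * X _) ^ 2
    rw [subst_X hs, mul_pow, ← map_pow]
    rcases hε j with h | h <;> rw [h] <;> simp [sqMap]

theorem mapL_mul_self {ε : I → ℂ} (hε : ∀ j, ε j = 1 ∨ ε j = -1) : mapL ε * mapL ε = 1 := by
  apply sqMap_cancel
  rw [mul_assoc, mapL_mul_sqMap hε, ← mul_assoc, mapL_mul_sqMap hε, mul_assoc, mapR_mul_self hε,
    mul_one, one_mul]

theorem signEquivariant_mapR (ε : I → ℂ) : SignEquivariant (mapR ε) := by
  intro S
  rw [mapR_eq, flip, Commute, SemiconjBy, diagMap_mul, diagMap_mul, mul_comm]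

end Products

/-! ### Submanifolds and their complexifications -/

section Manifolds

variable {I : Type} [Fintype I] [DecidableEq I]

/-- The projection `(z', w') ↦ (z', E(z', w'))`. -/
def graphMap (E : I → MvPowerSeries (I ⊕ I) ℂ) (hE : ∀ j, constantCoeff (E j) = 0) :
    FormalMap (I ⊕ I) :=
  ⟨Sum.elim (fun j => X (Sum.inl j)) E, by
    rintro (j | j)
    · exact constantCoeff_X _
    · exact hE j⟩

theorem graphMap_mul_comp_inl {E : I → MvPowerSeries (I ⊕ I) ℂ}
    (hE : ∀ j, constantCoeff (E j) = 0) (F : FormalMap (I ⊕ I)) (j : I) :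
    (graphMap E hE * F).comp (Sum.inl j) = F.comp (Sum.inl j) :=
  subst_X F.hasSubst _

theorem swap_involutive : Function.Involutive (Sum.swap : I ⊕ I → I ⊕ I) := Sum.swap_swap

/-- Maps between submanifolds are the maps compatible with a map of the complexifications that
commutes with the antiholomorphic involution. -/
theorem mapsManifold_iff {E₁ E₂ : I → MvPowerSeries (I ⊕ I) ℂ}
    (h₁ : ∀ j, constantCoeff (E₁ j) = 0) (h₂ : ∀ j, constantCoeff (E₂ j) = 0)
    (F : FormalMap (I ⊕ I)) :
    MapsManifold F E₁ E₂ ↔ ∃ T : FormalMap (I ⊕ I), FormalMap.conjBy Sum.swap Sum.swap T = T ∧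
      F * graphMap E₁ h₁ = graphMap E₂ h₂ * T := by
  constructor
  · intro h
    refine ⟨⟨Sum.elim (fun k => alongGraph E₁ F (Sum.inl k))
      (fun k => conjPull Sum.swap (alongGraph E₁ F (Sum.inl k))), ?_⟩, ?_, ?_⟩
    · have h0 : ∀ k, constantCoeff (alongGraph E₁ F (Sum.inl k)) = 0 := fun k =>
        (F * graphMap E₁ h₁).zero_at (Sum.inl k)
      rintro (k | k)
      · exact h0 k
      · exact constantCoeff_conjPull _ (h0 k)
    · ext1
      funext i
      rcases i with k | k
      · exact conjPull_conjPull swap_involutive _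
      · rfl
    · ext1
      funext i
      rcases i with k | k
      · rw [graphMap_mul_comp_inl]
        rfl
      · exact h k
  · rintro ⟨T, hT, hF⟩ j
    have h1 : ∀ k, T.comp (Sum.inl k) = alongGraph E₁ F (Sum.inl k) := fun k => by
      rw [← graphMap_mul_comp_inl h₂ T, ← hF]
      rfl
    have h2 : T.comp = Sum.elim (fun k => alongGraph E₁ F (Sum.inl k))
        (fun k => conjPull Sum.swap (alongGraph E₁ F (Sum.inl k))) := by
      funext i
      rcases i with k | k
      · exact h1 k
      · rw [← hT, Sum.elim_inr, ← h1]
        rfl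
    rw [← h2]
    exact congrFun (congrArg FormalMap.comp hF) (Sum.inr j)

end Manifolds

/-! ### The involution ρ, the multipliers, and the normal form written as a fold. -/

section NormalForm

variable {e h s : ℕ}

theorem rhoPerm_involutive : Function.Involutive (rhoPerm (e := e) (h := h) (s := s)) := by
  rintro ((k | k | k | k) | (k | k | k | k)) <;> rfl

theorem NormalizedMultipliers.ne_zero {lam : Idx e h s → ℂ} (hl : NormalizedMultipliers lam)
    (j : Idx e h s) : lam j ≠ 0 := by
  rcases j with k | k | k | k
  · obtain ⟨r, hr, hk⟩ := hl.ell k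
    rw [show lam (Sum.inl k) = r from hk]
    exact_mod_cast (zero_lt_one.trans hr).ne'
  · intro h0
    have := hl.hyp k
    rw [show lam (iH k) = 0 from h0] at this
    simp at this
  · intro h0
    have := hl.cpx k
    rw [show lam (iS k) = 0 from h0] at this
    simp at this
    linarith
  · have h1 := hl.cpx_pair k
    rw [show lam (Sum.inr (Sum.inr (Sum.inr k))) = _ from h1]
    have h2 := hl.cpx k
    refine inv_ne_zero ?_
    rw [Ne, _root_.map_eq_zero]
    intro h0
    rw [h0] at h2
    simp at h2
    linarith

end NormalForm

section NormalForm

variable {e h s : ℕ}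

theorem mapUV_eq_inl (lam : Idx e h s → ℂ) (L : Idx e h s → MvPowerSeries (Idx e h s) ℂ)
    (Ψ : (FormalMap (Idx e h s ⊕ Idx e h s))ˣ) (j : Idx e h s) :
    (mapUV lam L Ψ).comp (Sum.inl j) =
      C (1 / 2) * ((straighten L * ((Ψ⁻¹ : (FormalMap _)ˣ) : FormalMap _)).comp (Sum.inl j) -
        C (lam j) * (straighten L * ((Ψ⁻¹ : (FormalMap _)ˣ) : FormalMap _)).comp (Sum.inr j)) := by
  rw [mapUV, mul_assoc]
  set G := straighten L * ((Ψ⁻¹ : (FormalMap _)ˣ) : FormalMap (Idx e h s ⊕ Idx e h s))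
  have hs := G.hasSubst
  change subst G.comp (C (1 / 2) * (X _ - C (lam j) * X _)) = _
  rw [subst_mul hs, subst_C, subst_sub hs, subst_mul hs, subst_C, subst_X hs, subst_X hs]

theorem mapUV_eq_inr (lam : Idx e h s → ℂ) (L : Idx e h s → MvPowerSeries (Idx e h s) ℂ)
    (Ψ : (FormalMap (Idx e h s ⊕ Idx e h s))ˣ) (j : Idx e h s) :
    (mapUV lam L Ψ).comp (Sum.inr j) =
      C (1 / 2) * (C (lam j)⁻¹ *
        (straighten L * ((Ψ⁻¹ : (FormalMap _)ˣ) : FormalMap _)).comp (Sum.inl j) +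
        (straighten L * ((Ψ⁻¹ : (FormalMap _)ˣ) : FormalMap _)).comp (Sum.inr j)) := by
  rw [mapUV, mul_assoc]
  set G := straighten L * ((Ψ⁻¹ : (FormalMap _)ˣ) : FormalMap (Idx e h s ⊕ Idx e h s))
  have hs := G.hasSubst
  change subst G.comp (C (1 / 2) * (C (lam j)⁻¹ * X _ + X _)) = _
  rw [subst_mul hs, subst_C, subst_add hs, subst_mul hs, subst_C, subst_X hs, subst_X hs]

theorem C_half_add {V : Type} : (C (1 / 2) + C (1 / 2) : MvPowerSeries V ℂ) = 1 := by
  rw [← map_add, ← map_one C]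
  norm_num

variable {lam : Idx e h s → ℂ} {L : Idx e h s → MvPowerSeries (Idx e h s) ℂ}

/-- The linear factor E_{Λ(0)} cancels: U + λV gives back the first half of E_Λ⁻¹ Ψ⁻¹. -/
theorem normalPhi_inl (hl : ∀ j, lam j ≠ 0) (Ψ : (FormalMap (Idx e h s ⊕ Idx e h s))ˣ)
    (j : Idx e h s) :
    (normalPhi lam L Ψ).comp (Sum.inl j) =
      (straighten L * ((Ψ⁻¹ : (FormalMap _)ˣ) : FormalMap _)).comp (Sum.inl j) := by
  change (mapUV lam L Ψ).comp (Sum.inl j) + C (lam j) * (mapUV lam L Ψ).comp (Sum.inr j) = _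
  have h1 : (C (lam j) * C (lam j)⁻¹ : MvPowerSeries (Idx e h s ⊕ Idx e h s) ℂ) = 1 := by
    rw [← map_mul, mul_inv_cancel₀ (hl j), map_one]
  rw [mapUV_eq_inl, mapUV_eq_inr]
  set G := straighten L * ((Ψ⁻¹ : (FormalMap _)ˣ) : FormalMap (Idx e h s ⊕ Idx e h s))
  linear_combination G.comp (Sum.inl j) * C_half_add + C (1 / 2) * G.comp (Sum.inl j) * h1

theorem normalPhi_inr (hl : ∀ j, lam j ≠ 0) (Ψ : (FormalMap (Idx e h s ⊕ Idx e h s))ˣ)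
    (j : Idx e h s) :
    (normalPhi lam L Ψ).comp (Sum.inr j) = conjPull rhoPerm
      ((straighten L * ((Ψ⁻¹ : (FormalMap _)ˣ) : FormalMap _)).comp (Sum.inl j)) := by
  rw [← normalPhi_inl hl]
  rfl

/-- Here λ⁻¹U - V is minus the second half of E_Λ⁻¹ Ψ⁻¹, and the sign disappears in the square. -/
theorem normalE_eq (hl : ∀ j, lam j ≠ 0) (Ψ : (FormalMap (Idx e h s ⊕ Idx e h s))ˣ)
    (j : Idx e h s) :
    normalE lam L Ψ j = subst (normalPhi lam L Ψ).inv.comp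
      ((straighten L * ((Ψ⁻¹ : (FormalMap _)ˣ) : FormalMap _)).comp (Sum.inr j) ^ 2) := by
  rw [normalE]
  congr 1
  have h1 : (C (lam j) * C (lam j)⁻¹ : MvPowerSeries (Idx e h s ⊕ Idx e h s) ℂ) = 1 := by
    rw [← map_mul, mul_inv_cancel₀ (hl j), map_one]
  rw [mapUV_eq_inl, mapUV_eq_inr]
  set G := straighten L * ((Ψ⁻¹ : (FormalMap _)ˣ) : FormalMap (Idx e h s ⊕ Idx e h s))
  have h2 : C (lam j)⁻¹ * (C (1 / 2) * (G.comp (Sum.inl j) - C (lam j) * G.comp (Sum.inr j))) -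
      C (1 / 2) * (C (lam j)⁻¹ * G.comp (Sum.inl j) + G.comp (Sum.inr j)) =
      -G.comp (Sum.inr j) := by
    linear_combination -G.comp (Sum.inr j) * C_half_add - C (1 / 2) * G.comp (Sum.inr j) * h1
  rw [h2, neg_sq]

/-- The second block is the conjugate of the first, which is what makes this change of coordinates
carry ρ to ρ₀. -/
theorem conjBy_normalPhi (hl : ∀ j, lam j ≠ 0) (Ψ : (FormalMap (Idx e h s ⊕ Idx e h s))ˣ) :
    FormalMap.conjBy Sum.swap rhoPerm (normalPhi lam L Ψ) = normalPhi lam L Ψ := by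
  ext1
  funext i
  rw [FormalMap.conjBy_comp]
  rcases i with j | j
  · change conjPull rhoPerm ((normalPhi lam L Ψ).comp (Sum.inr j)) = _
    rw [normalPhi_inr hl, conjPull_conjPull rhoPerm_involutive, normalPhi_inl hl]
  · change conjPull rhoPerm ((normalPhi lam L Ψ).comp (Sum.inl j)) = _
    rw [normalPhi_inr hl, normalPhi_inl hl]

theorem constantCoeff_normalE (hl : ∀ j, lam j ≠ 0) (Ψ : (FormalMap (Idx e h s ⊕ Idx e h s))ˣ)
    (j : Idx e h s) : constantCoeff (normalE lam L Ψ j) = 0 := by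
  rw [normalE_eq hl]
  exact constantCoeff_subst_eq_zero (FormalMap.hasSubst _) (FormalMap.zero_at _)
    (by rw [map_pow, FormalMap.zero_at, zero_pow two_ne_zero])

/-- The equations of the normal form are designed for this identity, through which it is compared
with M: in real coordinates its projection is the fold preceded by `straighten L * Ψ⁻¹`. -/
theorem graphMap_normalE (hl : ∀ j, lam j ≠ 0) {Ψ : (FormalMap (Idx e h s ⊕ Idx e h s))ˣ}
    (Φ : (FormalMap (Idx e h s ⊕ Idx e h s))ˣ)
    (hΦ : (Φ : FormalMap (Idx e h s ⊕ Idx e h s)) = normalPhi lam L Ψ) :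
    graphMap (normalE lam L Ψ) (constantCoeff_normalE hl Ψ) *
        (Φ : FormalMap (Idx e h s ⊕ Idx e h s)) =
      sqMap * (straighten L * ((Ψ⁻¹ : (FormalMap _)ˣ) : FormalMap (Idx e h s ⊕ Idx e h s))) := by
  set G := straighten L * ((Ψ⁻¹ : (FormalMap _)ˣ) : FormalMap (Idx e h s ⊕ Idx e h s)) with hG
  have h1 : graphMap (normalE lam L Ψ) (constantCoeff_normalE hl Ψ) =
      sqMap * G * ((Φ⁻¹ : (FormalMap _)ˣ) : FormalMap (Idx e h s ⊕ Idx e h s)) := by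
    ext1
    funext i
    rcases i with j | j
    · rw [FormalMap.mul_comp, sqMap_mul_comp_inl, ← normalPhi_inl hl, ← hΦ,
        ← FormalMap.mul_comp, Units.mul_inv]
      rfl
    · rw [FormalMap.mul_comp, sqMap_mul_comp_inr]
      change normalE lam L Ψ j = _
      rw [normalE_eq hl, ← hG, ← hΦ, FormalMap.inv_eq]
  rw [h1, mul_assoc, Units.inv_mul, mul_one]

/-- Since Ψ is tangent to the identity, a kernel vector satisfies v_ξ + λ v_η = 0 together with the
ρ-conjugate equations. In each type of index the normalization of λ combines the two into (λ_j² - 1)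
v_η = 0, up to sign, and λ_j² ≠ 1 is the simplest case of non-resonance. -/
theorem isUnit_normalPhi (hl : NormalizedMultipliers lam)
    (hres : NonResonant fun j => lam j ^ 2) (hL0 : ∀ j, constantCoeff (L j) = lam j)
    {Ψ : (FormalMap (Idx e h s ⊕ Idx e h s))ˣ}
    (hΨ : (Ψ : FormalMap (Idx e h s ⊕ Idx e h s)).jac = 1) : IsUnit (normalPhi lam L Ψ) := by
  set G := straighten L * ((Ψ⁻¹ : (FormalMap _)ˣ) : FormalMap (Idx e h s ⊕ Idx e h s)) with hG
  have hjac : G.jac = (straighten L).jac := by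
    have h1 : ((Ψ⁻¹ : (FormalMap _)ˣ) : FormalMap (Idx e h s ⊕ Idx e h s)).jac = 1 := by
      have := congrArg FormalMap.jac (Units.inv_mul Ψ)
      rwa [FormalMap.jac_mul, hΨ, mul_one, FormalMap.jac_one] at this
    rw [hG, FormalMap.jac_mul, h1, mul_one]
  have hG1 : ∀ j k, G.jac (Sum.inl j) k =
      (1 : Matrix (Idx e h s ⊕ Idx e h s) (Idx e h s ⊕ Idx e h s) ℂ) (Sum.inl j) k +
        lam j * (1 : Matrix (Idx e h s ⊕ Idx e h s) (Idx e h s ⊕ Idx e h s) ℂ) (Sum.inr j) k := by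
    intro j k
    rw [hjac, jac_straighten_inl, hL0]
  have hne : ∀ j, lam j ^ 2 ≠ 1 := by
    intro j hj
    refine hres (Pi.single j 1) (by simp) ?_
    rw [Finset.prod_eq_single j]
    · simp [hj]
    · intro k _ hk
      simp [hk]
    · simp
  refine FormalMap.isUnit_of_injective fun v hv => ?_
  have h1 : ∀ j, v (Sum.inl j) + lam j * v (Sum.inr j) = 0 := by
    intro j
    have h2 : ∑ k, G.jac (Sum.inl j) k * v k = 0 := by
      have : ∑ k, (normalPhi lam L Ψ).jac (Sum.inl j) k * v k = 0 := congrFun hv (Sum.inl j)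
      rw [← this]
      refine Finset.sum_congr rfl fun k _ => ?_
      rw [FormalMap.jac_apply, FormalMap.jac_apply, normalPhi_inl hl.ne_zero]
    simpa only [hG1, add_mul, Finset.sum_add_distrib, Matrix.one_apply, ite_mul, one_mul, zero_mul,
      Finset.sum_ite_eq, Finset.mem_univ, if_true, mul_ite, mul_one, mul_zero] using h2
  have h2 : ∀ j, v (rhoPerm (Sum.inl j)) + starRingEnd ℂ (lam j) * v (rhoPerm (Sum.inr j)) = 0 := by
    intro j
    have h2 : ∑ k, starRingEnd ℂ (G.jac (Sum.inl j) (rhoPerm k)) * v k = 0 := by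
      have : ∑ k, (normalPhi lam L Ψ).jac (Sum.inr j) k * v k = 0 := congrFun hv (Sum.inr j)
      rw [← this]
      refine Finset.sum_congr rfl fun k _ => ?_
      rw [FormalMap.jac_apply _ (Sum.inr j), normalPhi_inr hl.ne_zero,
        coeff_conjPull rhoPerm_involutive, Finsupp.mapDomain_single]
      rfl
    -- Reindexing by ρ brings the conjugated row into the shape of the first block, with the
    -- coordinates of `v` permuted instead.
    rw [← Equiv.sum_comp (rhoPerm_involutive.toPerm rhoPerm)] at h2
    simp only [Function.Involutive.coe_toPerm, rhoPerm_involutive _] at h2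
    simpa only [hG1, map_add, map_mul, add_mul, Finset.sum_add_distrib, Matrix.one_apply, ite_mul,
      one_mul, zero_mul, Finset.sum_ite_eq, Finset.mem_univ, if_true, mul_ite, mul_one, mul_zero,
      apply_ite (starRingEnd ℂ), map_one, map_zero] using h2
  have h3 : ∀ j, v (Sum.inr j) = 0 := by
    rintro (k | k | k | k)
    · obtain ⟨r, hr, hk⟩ := hl.ell k
      have a1 := h1 (iE k)
      have a2 := h2 (iE k)
      have a3 := hne (iE k)
      rw [hk] at a1 a2 a3
      simp only [rhoPerm, Complex.conj_ofReal] at a2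
      have : (1 - (r : ℂ) ^ 2) * v (Sum.inr (iE k)) = 0 := by
        linear_combination a2 - r * a1
      exact (mul_eq_zero.1 this).resolve_left (sub_ne_zero.2 (Ne.symm a3))
    · have a1 := h1 (iH k)
      have a2 := h2 (iH k)
      have a3 := hne (iH k)
      simp only [rhoPerm] at a2
      have a4 : lam (iH k) * starRingEnd ℂ (lam (iH k)) = 1 := by
        rw [Complex.mul_conj, Complex.normSq_eq_norm_sq, hl.hyp k]
        simp
      have : (lam (iH k) ^ 2 - 1) * v (Sum.inr (iH k)) = 0 := by
        linear_combination lam (iH k) * a1 - lam (iH k) * a2 + v (Sum.inr (iH k)) * a4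
      exact (mul_eq_zero.1 this).resolve_left (sub_ne_zero.2 a3)
    · have a1 := h1 (iS k)
      have a2 := h2 (iT k)
      have a3 := hne (iS k)
      simp only [rhoPerm] at a2
      rw [hl.cpx_pair k, map_inv₀, Complex.conj_conj] at a2
      have a4 : lam (iS k) * (lam (iS k))⁻¹ = 1 := mul_inv_cancel₀ (hl.ne_zero _)
      have : (lam (iS k) ^ 2 - 1) * v (Sum.inr (iS k)) = 0 := by
        linear_combination lam (iS k) * a1 - lam (iS k) * a2 + v (Sum.inr (iS k)) * a4
      exact (mul_eq_zero.1 this).resolve_left (sub_ne_zero.2 a3)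
    · have a1 := h1 (iT k)
      have a2 := h2 (iS k)
      have a3 := hne (iT k)
      simp only [rhoPerm] at a2
      have a5 := hl.cpx_pair k
      have a6 : starRingEnd ℂ (lam (iS k)) = (lam (iT k))⁻¹ := by rw [a5, inv_inv]
      rw [a6] at a2
      have a4 : lam (iT k) * (lam (iT k))⁻¹ = 1 := mul_inv_cancel₀ (hl.ne_zero _)
      have : (lam (iT k) ^ 2 - 1) * v (Sum.inr (iT k)) = 0 := by
        linear_combination lam (iT k) * a1 - lam (iT k) * a2 + v (Sum.inr (iT k)) * a4
      exact (mul_eq_zero.1 this).resolve_left (sub_ne_zero.2 a3)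
  funext i
  rcases i with j | j
  · have := h1 j
    rw [h3 j] at this
    simpa using this
  · exact h3 j

end NormalForm

open scoped NNReal ENNReal

/-! ### Weighted norms of power series -/

section Norm

variable {V : Type}

/-- The norm `∑ |f_n| r^|n|`. -/
def wnorm (r : ℝ≥0) (f : MvPowerSeries V ℂ) : ℝ≥0∞ :=
  ∑' n : V →₀ ℕ, ‖coeff n f‖ₑ * (r : ℝ≥0∞) ^ n.degree

theorem le_wnorm (r : ℝ≥0) (f : MvPowerSeries V ℂ) (n : V →₀ ℕ) :
    ‖coeff n f‖ₑ * (r : ℝ≥0∞) ^ n.degree ≤ wnorm r f :=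
  ENNReal.le_tsum n

theorem wnorm_add_le (r : ℝ≥0) (f g : MvPowerSeries V ℂ) :
    wnorm r (f + g) ≤ wnorm r f + wnorm r g := by
  rw [wnorm, wnorm, wnorm, ← ENNReal.tsum_add]
  refine ENNReal.tsum_le_tsum fun n => ?_
  rw [← add_mul, map_add]
  gcongr
  exact enorm_add_le _ _

theorem wnorm_neg (r : ℝ≥0) (f : MvPowerSeries V ℂ) : wnorm r (-f) = wnorm r f := by
  simp [wnorm]

theorem wnorm_sub_le (r : ℝ≥0) (f g : MvPowerSeries V ℂ) :
    wnorm r (f - g) ≤ wnorm r f + wnorm r g := by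
  rw [sub_eq_add_neg, ← wnorm_neg r g]
  exact wnorm_add_le _ _ _

theorem wnorm_monomial (r : ℝ≥0) (n : V →₀ ℕ) (a : ℂ) :
    wnorm r (monomial n a) = ‖a‖ₑ * (r : ℝ≥0∞) ^ n.degree := by
  rw [wnorm, tsum_eq_single n]
  · rw [coeff_monomial_same]
  · intro m hm
    rw [coeff_monomial_ne hm, enorm_zero, zero_mul]

theorem wnorm_X (r : ℝ≥0) (i : V) : wnorm r (X i) = r := by
  rw [X_def, wnorm_monomial]
  simp

theorem wnorm_one (r : ℝ≥0) : wnorm r (1 : MvPowerSeries V ℂ) = 1 := by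
  rw [← monomial_zero_one, wnorm_monomial]
  simp

/-- The double sum for the product of norms is regrouped along antidiagonals, on which the power of
r is constant. -/
theorem wnorm_mul_le (r : ℝ≥0) (f g : MvPowerSeries V ℂ) :
    wnorm r (f * g) ≤ wnorm r f * wnorm r g := by
  classical
  have h1 : wnorm r f * wnorm r g = ∑' p : (V →₀ ℕ) × (V →₀ ℕ),
      (‖coeff p.1 f‖ₑ * (r : ℝ≥0∞) ^ p.1.degree) * (‖coeff p.2 g‖ₑ * (r : ℝ≥0∞) ^ p.2.degree) := by
    rw [ENNReal.tsum_prod', wnorm, wnorm, ← ENNReal.tsum_mul_right]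
    refine tsum_congr fun a => ?_
    rw [← ENNReal.tsum_mul_left]
  rw [h1, ← Finset.HasAntidiagonal.sigmaAntidiagonalEquivProd.tsum_eq, ENNReal.tsum_sigma']
  refine ENNReal.tsum_le_tsum fun n => ?_
  rw [coeff_mul, tsum_fintype]
  have h2 : ∀ b : Finset.HasAntidiagonal.antidiagonal n,
      (‖coeff (b : (V →₀ ℕ) × (V →₀ ℕ)).1 f‖ₑ * (r : ℝ≥0∞) ^ b.1.1.degree) *
        (‖coeff b.1.2 g‖ₑ * (r : ℝ≥0∞) ^ b.1.2.degree) =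
      ‖coeff b.1.1 f * coeff b.1.2 g‖ₑ * (r : ℝ≥0∞) ^ n.degree := by
    rintro ⟨b, hb⟩
    have hd : n.degree = b.1.degree + b.2.degree := by
      rw [← Finset.HasAntidiagonal.mem_antidiagonal.1 hb, map_add]
    rw [enorm_mul, hd, pow_add]
    ring
  have h3 : ∑ b : Finset.HasAntidiagonal.antidiagonal n,
      ‖coeff b.1.1 f * coeff b.1.2 g‖ₑ * (r : ℝ≥0∞) ^ n.degree =
      ∑ p ∈ Finset.HasAntidiagonal.antidiagonal n,
        ‖coeff p.1 f * coeff p.2 g‖ₑ * (r : ℝ≥0∞) ^ n.degree :=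
    Finset.sum_coe_sort (Finset.HasAntidiagonal.antidiagonal n)
      (fun p => ‖coeff p.1 f * coeff p.2 g‖ₑ * (r : ℝ≥0∞) ^ n.degree)
  refine le_trans ?_ (le_of_eq (h3.symm.trans (Finset.sum_congr rfl fun b _ => (h2 b).symm)))
  rw [← Finset.sum_mul]
  gcongr
  exact enorm_sum_le _ _

theorem wnorm_pow_le (r : ℝ≥0) (f : MvPowerSeries V ℂ) (k : ℕ) :
    wnorm r (f ^ k) ≤ wnorm r f ^ k := by
  induction k with
  | zero => rw [pow_zero, pow_zero, wnorm_one]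
  | succ k ih =>
    rw [pow_succ, pow_succ]
    exact (wnorm_mul_le _ _ _).trans (by gcongr)

theorem wnorm_prod_le {ι : Type} (r : ℝ≥0) (s : Finset ι) (f : ι → MvPowerSeries V ℂ) :
    wnorm r (∏ i ∈ s, f i) ≤ ∏ i ∈ s, wnorm r (f i) := by
  classical
  induction s using Finset.induction_on with
  | empty => rw [Finset.prod_empty, Finset.prod_empty, wnorm_one]
  | insert a s ha ih =>
    rw [Finset.prod_insert ha, Finset.prod_insert ha]
    exact (wnorm_mul_le _ _ _).trans (by gcongr)

/-- By submultiplicativity the norm of G^n is at most R^|n|, and the sums over exponents may be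
exchanged. As values lie in `ℝ≥0∞`, no summability has to be checked. -/
theorem wnorm_subst_le [Finite V] {W : Type} {r R : ℝ≥0} {G : V → MvPowerSeries W ℂ}
    (h0 : ∀ i, constantCoeff (G i) = 0) (hG : ∀ i, wnorm r (G i) ≤ R) (f : MvPowerSeries V ℂ) :
    wnorm r (subst G f) ≤ wnorm R f := by
  have hs := hasSubst_of_constantCoeff_zero h0
  have hmon : ∀ n : V →₀ ℕ, wnorm r (n.prod fun s k => G s ^ k) ≤ (R : ℝ≥0∞) ^ n.degree := by
    intro n
    refine (wnorm_prod_le _ _ _).trans ?_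
    rw [Finsupp.degree_apply, ← Finset.prod_pow_eq_pow_sum]
    exact Finset.prod_le_prod' fun i _ => (wnorm_pow_le _ _ _).trans (pow_le_pow_left' (hG i) _)
  have h1 : ∀ m, ‖coeff m (subst G f)‖ₑ ≤
      ∑' n, ‖coeff n f‖ₑ * ‖coeff m (n.prod fun s k => G s ^ k)‖ₑ := by
    intro m
    rw [coeff_subst hs, finsum_eq_sum _ (coeff_subst_finite hs f m)]
    refine (enorm_sum_le _ _).trans ?_
    refine le_trans (le_of_eq (Finset.sum_congr rfl fun n _ => ?_)) (ENNReal.sum_le_tsum _)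
    rw [smul_eq_mul, enorm_mul]
  calc wnorm r (subst G f)
      ≤ ∑' m : W →₀ ℕ, (∑' n, ‖coeff n f‖ₑ * ‖coeff m (n.prod fun s k => G s ^ k)‖ₑ) *
          (r : ℝ≥0∞) ^ m.degree := ENNReal.tsum_le_tsum fun m => by gcongr; exact h1 m
    _ = ∑' n, ‖coeff n f‖ₑ * wnorm r (n.prod fun s k => G s ^ k) := by
        simp only [wnorm, ← ENNReal.tsum_mul_left, ← ENNReal.tsum_mul_right]
        rw [ENNReal.tsum_comm]
        simp only [mul_assoc]
    _ ≤ wnorm R f := ENNReal.tsum_le_tsum fun n => by gcongr; exact hmon n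

/-- Shrinking the radius by a gains a factor a^d on a series of order d. Order 1 is what
compositions need, order 2 what inversion needs. -/
theorem wnorm_scale_le {d : ℕ} {a r : ℝ≥0} (ha : a ≤ 1) {f : MvPowerSeries V ℂ}
    (hf : AgreeTo d f 0) : wnorm (a * r) f ≤ (a : ℝ≥0∞) ^ d * wnorm r f := by
  rw [wnorm, wnorm, ← ENNReal.tsum_mul_left]
  refine ENNReal.tsum_le_tsum fun n => ?_
  rcases lt_or_ge n.degree d with h | h
  · rw [hf n h, coeff_zero, enorm_zero, zero_mul]
    exact zero_le
  · rw [ENNReal.coe_mul, mul_pow]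
    have : (a : ℝ≥0∞) ^ n.degree ≤ (a : ℝ≥0∞) ^ d :=
      pow_le_pow_right_of_le_one' (by exact_mod_cast ha) h
    calc ‖coeff n f‖ₑ * ((a : ℝ≥0∞) ^ n.degree * (r : ℝ≥0∞) ^ n.degree)
        ≤ ‖coeff n f‖ₑ * ((a : ℝ≥0∞) ^ d * (r : ℝ≥0∞) ^ n.degree) := by gcongr
      _ = _ := by ring

theorem wnorm_mono {a r : ℝ≥0} (h : a ≤ r) (f : MvPowerSeries V ℂ) : wnorm a f ≤ wnorm r f :=
  ENNReal.tsum_le_tsum fun n => by gcongr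

/-- A finite set of exponents lies in a box, over which the sum factors into partial geometric sums.
-/
theorem tsum_pow_degree_lt_top [Finite V] {r : ℝ≥0} (hr : r < 1) :
    ∑' n : V →₀ ℕ, (r : ℝ≥0∞) ^ n.degree < ∞ := by
  classical
  have := Fintype.ofFinite V
  have hg : ∑' k : ℕ, (r : ℝ≥0∞) ^ k ≠ ∞ := by
    rw [ENNReal.tsum_geometric]
    refine ENNReal.inv_ne_top.2 ?_
    rw [Ne, tsub_eq_zero_iff_le, not_le]
    exact_mod_cast hr
  refine lt_of_le_of_lt (b := ∏ _v : V, ∑' k : ℕ, (r : ℝ≥0∞) ^ k) ?_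
    (ENNReal.prod_lt_top fun _ _ => hg.lt_top)
  rw [ENNReal.tsum_eq_iSup_sum]
  refine iSup_le fun S => ?_
  let N : ℕ := S.sup (fun n => n.degree) + 1
  calc ∑ n ∈ S, (r : ℝ≥0∞) ^ n.degree
      = ∑ n ∈ S.map ⟨fun n : V →₀ ℕ => (n : V → ℕ), DFunLike.coe_injective⟩,
          ∏ v, (r : ℝ≥0∞) ^ n v := by
        rw [Finset.sum_map]
        refine Finset.sum_congr rfl fun n _ => ?_
        rw [Finset.prod_pow_eq_pow_sum, Finsupp.degree_eq_sum]
        rfl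
    _ ≤ ∑ n ∈ Fintype.piFinset fun _ : V => Finset.range N, ∏ v, (r : ℝ≥0∞) ^ n v := by
        refine Finset.sum_le_sum_of_subset fun n hn => ?_
        rw [Finset.mem_map] at hn
        obtain ⟨m, hm, rfl⟩ := hn
        rw [Fintype.mem_piFinset]
        intro v
        rw [Finset.mem_range]
        refine Nat.lt_succ_of_le (le_trans ?_ (Finset.le_sup (f := fun n => n.degree) hm))
        exact Finsupp.le_degree v m
    _ = ∏ _v : V, ∑ k ∈ Finset.range N, (r : ℝ≥0∞) ^ k :=
        (Finset.prod_univ_sum _ _).symm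
    _ ≤ _ := Finset.prod_le_prod' fun v _ => ENNReal.sum_le_tsum _

theorem isConvergent_of_wnorm {r : ℝ≥0} (hr : 0 < r) {f : MvPowerSeries V ℂ}
    (hf : wnorm r f < ∞) : IsConvergent f := by
  refine ⟨(wnorm r f).toReal, (r : ℝ)⁻¹, by positivity, fun n => ?_⟩
  have h1 := ENNReal.toReal_mono hf.ne (le_wnorm r f n)
  rw [ENNReal.toReal_mul, ENNReal.toReal_pow, ENNReal.coe_toReal, toReal_enorm] at h1
  rw [inv_pow, ← div_eq_mul_inv, le_div_iff₀ (by positivity)]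
  exact h1

theorem IsConvergent.exists_wnorm [Finite V] {f : MvPowerSeries V ℂ} (hf : IsConvergent f) :
    ∃ r : ℝ≥0, 0 < r ∧ wnorm r f < ∞ := by
  obtain ⟨C, R, hR, hn⟩ := hf
  have hC : 0 ≤ C := by
    have := (norm_nonneg _).trans (hn 0)
    simpa using this
  lift R to ℝ≥0 using hR.le
  lift C to ℝ≥0 using hC
  have hR' : R ≠ 0 := by
    rintro rfl
    simp at hR
  refine ⟨R⁻¹ / 2, by positivity, ?_⟩
  have key : ∀ n : V →₀ ℕ, ‖coeff n f‖ₑ * ((R⁻¹ / 2 : ℝ≥0) : ℝ≥0∞) ^ n.degree ≤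
      C * ((1 / 2 : ℝ≥0) : ℝ≥0∞) ^ n.degree := by
    intro n
    have h1 : ‖coeff n f‖ₑ ≤ ((C * R ^ n.degree : ℝ≥0) : ℝ≥0∞) := by
      rw [enorm_eq_nnnorm, ENNReal.coe_le_coe, ← NNReal.coe_le_coe]
      simpa using hn n
    calc _ ≤ ((C * R ^ n.degree : ℝ≥0) : ℝ≥0∞) * ((R⁻¹ / 2 : ℝ≥0) : ℝ≥0∞) ^ n.degree := by gcongr
      _ = _ := by
        rw [← ENNReal.coe_pow, ← ENNReal.coe_mul, ← ENNReal.coe_pow, ← ENNReal.coe_mul, mul_assoc,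
          ← mul_pow, ← mul_div_assoc, mul_inv_cancel₀ hR']
  refine (ENNReal.tsum_le_tsum key).trans_lt ?_
  rw [ENNReal.tsum_mul_left]
  exact ENNReal.mul_lt_top ENNReal.coe_lt_top (tsum_pow_degree_lt_top (by norm_num [NNReal.half_lt_self]))

/-- A common radius for finitely many convergent series. -/
theorem exists_common_radius [Finite V] {ι : Type} [Finite ι] {f : ι → MvPowerSeries V ℂ}
    (hf : ∀ i, IsConvergent (f i)) : ∃ r : ℝ≥0, 0 < r ∧ ∀ i, wnorm r (f i) < ∞ := by
  have := Fintype.ofFinite ι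
  choose r hr hf using fun i => (hf i).exists_wnorm
  rcases isEmpty_or_nonempty ι with h | h
  · exact ⟨1, one_pos, fun i => (h.false i).elim⟩
  · refine ⟨Finset.univ.inf' Finset.univ_nonempty r, ?_, fun i => ?_⟩
    · rw [Finset.lt_inf'_iff]
      exact fun i _ => hr i
    · exact (wnorm_mono (Finset.inf'_le _ (Finset.mem_univ i)) _).trans_lt (hf i)

namespace IsConvergent

variable {f g : MvPowerSeries V ℂ}

section

variable [Finite V]

theorem add (hf : IsConvergent f) (hg : IsConvergent g) : IsConvergent (f + g) := by
  obtain ⟨r, hr, hn⟩ := exists_common_radius (f := ![f, g]) (by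
    intro i
    fin_cases i
    exacts [hf, hg])
  exact isConvergent_of_wnorm hr ((wnorm_add_le _ _ _).trans_lt
    (ENNReal.add_lt_top.2 ⟨hn 0, hn 1⟩))

theorem mul (hf : IsConvergent f) (hg : IsConvergent g) : IsConvergent (f * g) := by
  obtain ⟨r, hr, hn⟩ := exists_common_radius (f := ![f, g]) (by
    intro i
    fin_cases i
    exacts [hf, hg])
  exact isConvergent_of_wnorm hr ((wnorm_mul_le _ _ _).trans_lt (ENNReal.mul_lt_top (hn 0) (hn 1)))

theorem neg (hf : IsConvergent f) : IsConvergent (-f) := by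
  obtain ⟨r, hr, hn⟩ := hf.exists_wnorm
  exact isConvergent_of_wnorm hr (by rwa [wnorm_neg])

theorem sub (hf : IsConvergent f) (hg : IsConvergent g) : IsConvergent (f - g) := by
  rw [sub_eq_add_neg]
  exact hf.add hg.neg

theorem monomial (n : V →₀ ℕ) (a : ℂ) : IsConvergent (MvPowerSeries.monomial n a) :=
  isConvergent_of_wnorm one_pos (by rw [wnorm_monomial]; simp [enorm_lt_top])

theorem X (i : V) : IsConvergent (MvPowerSeries.X i : MvPowerSeries V ℂ) := monomial _ _

theorem C (a : ℂ) : IsConvergent (MvPowerSeries.C a : MvPowerSeries V ℂ) := monomial _ _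

theorem pow (hf : IsConvergent f) (k : ℕ) : IsConvergent (f ^ k) := by
  obtain ⟨r, hr, hn⟩ := hf.exists_wnorm
  exact isConvergent_of_wnorm hr ((wnorm_pow_le _ _ _).trans_lt (ENNReal.pow_lt_top hn))

theorem sum {ι : Type} (s : Finset ι) {f : ι → MvPowerSeries V ℂ}
    (hf : ∀ i ∈ s, IsConvergent (f i)) : IsConvergent (∑ i ∈ s, f i) := by
  classical
  induction s using Finset.induction_on with
  | empty =>
    rw [Finset.sum_empty, ← map_zero MvPowerSeries.C]
    exact C 0
  | insert a s ha ih =>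
    rw [Finset.sum_insert ha]
    exact (hf a (Finset.mem_insert_self _ _)).add
      (ih fun i hi => hf i (Finset.mem_insert_of_mem hi))

theorem subst {W : Type} [Finite W] {G : V → MvPowerSeries W ℂ}
    (hf : IsConvergent f) (h0 : ∀ i, constantCoeff (G i) = 0) (hG : ∀ i, IsConvergent (G i)) :
    IsConvergent (MvPowerSeries.subst G f) := by
  obtain ⟨R, hR, hfR⟩ := hf.exists_wnorm
  obtain ⟨r, hr, hn⟩ := exists_common_radius hG
  have := Fintype.ofFinite V
  let M : ℝ≥0 := ∑ i, (wnorm r (G i)).toNNReal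
  let a : ℝ≥0 := min 1 (R / (M + 1))
  have ha : 0 < a := by positivity
  refine isConvergent_of_wnorm (r := a * r) (by positivity) (lt_of_le_of_lt ?_ hfR)
  refine wnorm_subst_le h0 (fun i => ?_) f
  refine (wnorm_scale_le (min_le_left _ _) (AgreeTo.one_of_constantCoeff (h0 i))).trans ?_
  rw [pow_one, ← ENNReal.coe_toNNReal (hn i).ne, ← ENNReal.coe_mul, ENNReal.coe_le_coe]
  have h1 : (wnorm r (G i)).toNNReal ≤ M :=
    Finset.single_le_sum (f := fun i => (wnorm r (G i)).toNNReal) (fun _ _ => zero_le)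
      (Finset.mem_univ i)
  calc a * (wnorm r (G i)).toNNReal ≤ R / (M + 1) * (M + 1) := by
        gcongr
        · exact min_le_right _ _
        · exact h1.trans (le_add_of_nonneg_right zero_le_one)
    _ = R := div_mul_cancel₀ _ (by positivity)

end

theorem map_conj (hf : IsConvergent f) : IsConvergent (MvPowerSeries.map (starRingEnd ℂ) f) := by
  obtain ⟨C, r, hr, hn⟩ := hf
  exact ⟨C, r, hr, fun n => by simpa using hn n⟩

theorem conjPull [Finite V] (π : V → V) (hf : IsConvergent f) : IsConvergent (conjPull π f) :=
  hf.map_conj.subst (fun k => constantCoeff_X (π k)) (fun k => X (π k))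

end IsConvergent

end Norm

/-! ### Convergence of compositions and inverses. -/

namespace FormalMap

variable {V : Type} [Fintype V]

theorem Convergent.mul {F G : FormalMap V} (hF : F.Convergent) (hG : G.Convergent) :
    (F * G).Convergent := fun i => (hF i).subst G.zero_at hG

theorem convergent_one : (1 : FormalMap V).Convergent := fun i => IsConvergent.X i

theorem convergent_ofMatrix (A : Matrix V V ℂ) : (ofMatrix A).Convergent := fun _ =>
  IsConvergent.sum _ fun _ _ => (IsConvergent.C _).mul (IsConvergent.X _)

theorem Convergent.conjBy {F : FormalMap V} (hF : F.Convergent) (π₁ π₂ : V → V) :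
    (FormalMap.conjBy π₁ π₂ F).Convergent := fun _ => (hF _).conjPull _

variable [DecidableEq V]

/-- Choose r so that N = F - id has norm at most r at radius 2r. The iteration G ↦ id - N ∘ G then
keeps all approximations within norm 2r at radius r, and the inverse inherits this bound coefficient
by coefficient. -/
theorem Convergent.limInv {F : FormalMap V} (hF : F.Convergent) (hj : F.jac = 1) :
    (limInv F).Convergent := by
  have hN : ∀ i, IsConvergent (F.comp i - X i) := fun i => (hF i).sub (IsConvergent.X i)
  obtain ⟨r₀, hr₀, hn⟩ := exists_common_radius hN
  let M : ℝ≥0 := ∑ i, (wnorm r₀ (F.comp i - X i)).toNNReal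
  -- As N has order 2, passing from r₀ to a r₀ multiplies its norm by at most a². One factor a goes
  -- into r = a r₀ / 2; the other, at most r₀ / (2 (M + 1)), absorbs the size of N.
  let a : ℝ≥0 := min 1 (r₀ / (2 * (M + 1)))
  have ha : 0 < a := by positivity
  let r : ℝ≥0 := a * r₀ / 2
  have hr : 0 < r := by positivity
  have h2r : 2 * r = a * r₀ := by
    simp only [r]
    field_simp
  have hNr : ∀ i, wnorm (2 * r) (F.comp i - X i) ≤ r := by
    intro i
    rw [h2r]
    refine (wnorm_scale_le (min_le_left _ _)
      (AgreeTo.sub_zero_iff.2 (agreeTo_X_of_jac hj i))).trans ?_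
    rw [← ENNReal.coe_toNNReal (hn i).ne, ← ENNReal.coe_pow, ← ENNReal.coe_mul, ENNReal.coe_le_coe]
    have h1 : (wnorm r₀ (F.comp i - X i)).toNNReal ≤ M :=
      Finset.single_le_sum (f := fun i => (wnorm r₀ (F.comp i - X i)).toNNReal)
        (fun _ _ => zero_le) (Finset.mem_univ i)
    calc a ^ 2 * (wnorm r₀ (F.comp i - X i)).toNNReal
        ≤ a * (r₀ / (2 * (M + 1))) * (M + 1) := by
          rw [sq]
          gcongr
          · exact min_le_right _ _
          · exact h1.trans (le_add_of_nonneg_right zero_le_one)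
      _ = r := by
          simp only [r]
          field_simp
  have hG : ∀ k i, wnorm r ((approxInv F k).comp i) ≤ ((2 * r : ℝ≥0) : ℝ≥0∞) := by
    intro k
    induction k with
    | zero =>
      intro i
      change wnorm r (X i) ≤ _
      rw [wnorm_X, ENNReal.coe_le_coe]
      exact le_mul_of_one_le_left (zero_le) (by norm_num)
    | succ k ih =>
      intro i
      change wnorm r (X i - subst (approxInv F k).comp (F.comp i - X i)) ≤ _
      refine (wnorm_sub_le _ _ _).trans ?_
      rw [wnorm_X, two_mul, ENNReal.coe_add]
      gcongr
      exact (wnorm_subst_le (approxInv F k).zero_at ih _).trans (hNr i)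
  intro i
  refine ⟨2 * r, (r : ℝ)⁻¹, by positivity, fun n => ?_⟩
  have h1 := ENNReal.toReal_mono ENNReal.coe_ne_top ((le_wnorm r _ n).trans (hG n.degree i))
  rw [ENNReal.toReal_mul, ENNReal.toReal_pow, ENNReal.coe_toReal, toReal_enorm] at h1
  rw [inv_pow, ← div_eq_mul_inv, le_div_iff₀ (by positivity), coeff_limInv]
  simpa using h1

theorem Convergent.inv {u : (FormalMap V)ˣ} (hu : (u : FormalMap V).Convergent) :
    ((u⁻¹ : (FormalMap V)ˣ) : FormalMap V).Convergent := by
  obtain ⟨A, hA⟩ := isUnit_iff_jac.1 u.isUnit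
  obtain ⟨b, hb⟩ := isUnit_ofMatrix (A := (↑A⁻¹ : Matrix V V ℂ)) ⟨A⁻¹, rfl⟩
  have hbc : (b : FormalMap V).Convergent := hb ▸ convergent_ofMatrix _
  have h1 : ((b : FormalMap V) * (u : FormalMap V)).jac = 1 := by
    rw [hb, jac_mul, jac_ofMatrix, ← hA, Units.inv_mul]
  have h2 := (hbc.mul hu).limInv h1
  have h3 := mul_limInv h1
  set G := FormalMap.limInv ((b : FormalMap V) * (u : FormalMap V))
  rw [mul_assoc] at h3
  have h4 : (u : FormalMap V) * (G * b) = 1 := by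
    rw [← mul_assoc, ← Units.inv_eq_of_mul_eq_one_right h3, Units.inv_mul]
  rw [Units.inv_eq_of_mul_eq_one_right h4]
  exact h2.mul hbc

end FormalMap

/-! ### Square roots, inverses and logarithms of power series -/

section Functions

variable {V : Type} [Finite V]

/-- The map `x ↦ x + x² / 2` of one variable. -/
def halfSquareMap : FormalMap Unit := ⟨fun i => X i + C (1 / 2) * X i ^ 2, fun i => by simp⟩

theorem jac_halfSquareMap : halfSquareMap.jac = 1 := by
  ext i k
  rw [FormalMap.jac_apply]
  change coeff _ (X i + C (1 / 2) * X i ^ 2) = _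
  rw [map_add, coeff_C_mul, X_pow_eq, coeff_monomial_ne, mul_zero, add_zero, ← FormalMap.one_comp,
    ← FormalMap.jac_apply, FormalMap.jac_one]
  intro h
  have := congrArg Finsupp.degree h
  simp at this

/-- Since (1 + u)² = 1 + 2 (u + u²/2), it suffices to invert x + x²/2 in one variable and evaluate
the inverse at v/2. Convergence comes from the inverse map. -/
theorem exists_sqrt_one_add {v : MvPowerSeries V ℂ} (hv : constantCoeff v = 0) :
    ∃ u : MvPowerSeries V ℂ, constantCoeff u = 0 ∧ (1 + u) ^ 2 = 1 + v ∧
      (IsConvergent v → IsConvergent u) := by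
  obtain ⟨F, hF⟩ := FormalMap.isUnit_of_jac_eq_one jac_halfSquareMap
  set G : FormalMap Unit := ((F⁻¹ : (FormalMap Unit)ˣ) : FormalMap Unit) with hG
  have h1 : (halfSquareMap * G).comp () = X () := by
    rw [← hF, hG, Units.mul_inv, FormalMap.one_comp]
  have h2 : G.comp () + C (1 / 2) * G.comp () ^ 2 = X () := by
    rw [← h1]
    change _ = subst G.comp (X () + C (1 / 2) * X () ^ 2)
    rw [subst_add G.hasSubst, subst_mul G.hasSubst, subst_C, subst_pow G.hasSubst,
      subst_X G.hasSubst]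
  have hw : ∀ _ : Unit, constantCoeff (C (1 / 2) * v) = 0 := fun _ => by rw [map_mul, hv, mul_zero]
  have hs := hasSubst_of_constantCoeff_zero hw
  refine ⟨subst (fun _ => C (1 / 2) * v) (G.comp ()),
    constantCoeff_subst_eq_zero hs hw (G.zero_at _), ?_, ?_⟩
  · have h3 := congrArg (subst (fun _ : Unit => C (1 / 2) * v)) h2
    rw [subst_add hs, subst_mul hs, subst_C, subst_pow hs, subst_X hs] at h3
    have h4 : (C (1 / 2) + C (1 / 2) : MvPowerSeries V ℂ) = 1 := by
      rw [← map_add, ← map_one C]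
      norm_num
    set u := subst (fun _ : Unit => C (1 / 2) * v) (G.comp ())
    linear_combination 2 * h3 + (v - u ^ 2) * h4
  · intro hc
    have hFc : (F : FormalMap Unit).Convergent := by
      rw [hF]
      exact fun i => (IsConvergent.X _).add ((IsConvergent.C _).mul ((IsConvergent.X _).pow 2))
    exact (FormalMap.Convergent.inv hFc ()).subst hw fun _ => (IsConvergent.C _).mul hc

/-- In a domain only a sign is open, and the nonzero constant term decides it. This passes
identities from squares such as M = Λ² to their square roots. -/
theorem eq_of_sq_eq {f g : MvPowerSeries V ℂ} (h : f ^ 2 = g ^ 2)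
    (h0 : constantCoeff f = constantCoeff g) (hne : constantCoeff f ≠ 0) : f = g := by
  rcases sq_eq_sq_iff_eq_or_eq_neg.1 h with h1 | h1
  · exact h1
  · exfalso
    rw [h1, map_neg] at h0 hne
    have : constantCoeff g = 0 := by linear_combination (-1 / 2) * h0
    rw [this, neg_zero] at hne
    exact hne rfl

theorem exists_sqrt {q : MvPowerSeries V ℂ} (hq : constantCoeff q = 1) :
    ∃ b : MvPowerSeries V ℂ, constantCoeff b = 1 ∧ b ^ 2 = q := by
  obtain ⟨u, hu, h, -⟩ := exists_sqrt_one_add (v := q - 1) (by simp [hq])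
  exact ⟨1 + u, by simp [hu], by rw [h]; ring⟩

theorem IsConvergent.of_sq {g : MvPowerSeries V ℂ} (hg : IsConvergent (g ^ 2))
    (h0 : constantCoeff g ≠ 0) : IsConvergent g := by
  have hv : IsConvergent (MvPowerSeries.C ((constantCoeff g) ^ 2)⁻¹ * g ^ 2 - 1) := by
    rw [← map_one MvPowerSeries.C]
    exact ((IsConvergent.C _).mul hg).sub (IsConvergent.C 1)
  obtain ⟨u, hu, h, hc⟩ := exists_sqrt_one_add
    (v := MvPowerSeries.C ((constantCoeff g) ^ 2)⁻¹ * g ^ 2 - 1) (by simp [h0])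
  have h1 : g = MvPowerSeries.C (constantCoeff g) * (1 + u) := by
    refine eq_of_sq_eq ?_ (by simp [hu]) h0
    rw [mul_pow, h, add_sub_cancel, ← mul_assoc, ← map_pow, ← map_mul,
      mul_inv_cancel₀ (pow_ne_zero _ h0), map_one, one_mul]
  rw [h1, mul_add, mul_one]
  exact (IsConvergent.C _).add ((IsConvergent.C _).mul (hc hv))

theorem isConvergent_of_bounded {f : MvPowerSeries Unit ℂ} (hf : ∀ n, ‖coeff n f‖ ≤ 1) :
    IsConvergent f := ⟨1, 1, one_pos, fun n => by simpa using hf n⟩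

/-- The inverse is a geometric series in u = 1 - f / f(0). -/
theorem IsConvergent.inv {f : MvPowerSeries V ℂ} (hf : IsConvergent f)
    (h0 : constantCoeff f ≠ 0) : IsConvergent f⁻¹ := by
  let g : MvPowerSeries Unit ℂ := PowerSeries.mk (1 : ℕ → ℂ)
  have hg : g * (1 - MvPowerSeries.X ()) = 1 := PowerSeries.mk_one_mul_one_sub_eq_one ℂ
  have hgc : IsConvergent g := isConvergent_of_bounded fun n => by
    change ‖(1 : ℂ)‖ ≤ 1
    simp
  set u : MvPowerSeries V ℂ := 1 - MvPowerSeries.C (constantCoeff f)⁻¹ * f with hu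
  have hu0 : ∀ _ : Unit, constantCoeff u = 0 := fun _ => by simp [hu, h0]
  have huc : IsConvergent u := by
    rw [hu, ← map_one MvPowerSeries.C]
    exact (IsConvergent.C 1).sub ((IsConvergent.C _).mul hf)
  have hs := hasSubst_of_constantCoeff_zero hu0
  have h1 := congrArg (MvPowerSeries.subst (fun _ : Unit => u)) hg
  have hone : MvPowerSeries.subst (fun _ : Unit => u) (1 : MvPowerSeries Unit ℂ) = 1 := by
    rw [← map_one MvPowerSeries.C, subst_C, map_one]
  rw [subst_mul hs, subst_sub hs, subst_X hs, hone] at h1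
  have h2 : f⁻¹ = MvPowerSeries.C (constantCoeff f)⁻¹ *
      MvPowerSeries.subst (fun _ : Unit => u) g := by
    rw [MvPowerSeries.inv_eq_iff_mul_eq_one h0, ← h1, hu]
    ring
  rw [h2]
  exact (IsConvergent.C _).mul (hgc.subst hu0 fun _ => huc)

theorem constantCoeff_logArg {f : MvPowerSeries V ℂ} (hf : constantCoeff f ≠ 0) :
    constantCoeff (C (constantCoeff f)⁻¹ * f - 1) = 0 := by simp [hf]

theorem constantCoeff_logQuot {f : MvPowerSeries V ℂ} (hf : constantCoeff f ≠ 0) :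
    constantCoeff (logQuot f) = 0 :=
  constantCoeff_subst_eq_zero
    (hasSubst_of_constantCoeff_zero fun _ => constantCoeff_logArg hf)
    (fun _ => constantCoeff_logArg hf) PowerSeries.constantCoeff_log

theorem IsConvergent.logQuot {f : MvPowerSeries V ℂ} (hf : IsConvergent f)
    (h0 : constantCoeff f ≠ 0) : IsConvergent (logQuot f) := by
  have hlog : IsConvergent (V := Unit) (PowerSeries.log ℂ) := isConvergent_of_bounded fun n => by
    have hn : n = Finsupp.single () (n ()) := by
      ext
      simp
    have h1 : coeff n (PowerSeries.log ℂ : MvPowerSeries Unit ℂ) =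
        PowerSeries.coeff (n ()) (PowerSeries.log ℂ) := by
      conv_lhs => rw [hn]
      rfl
    rw [h1, PowerSeries.coeff_log]
    split_ifs with h
    · simp
    · have h2 : (1 : ℝ) ≤ (n () : ℝ) := by exact_mod_cast Nat.one_le_iff_ne_zero.2 h
      simp only [map_div₀, map_pow, map_neg, map_one, map_natCast, norm_div, norm_pow, norm_neg,
        norm_one, one_pow, Complex.norm_natCast]
      rw [div_le_one (by linarith)]
      exact h2
  refine hlog.subst (fun _ => constantCoeff_logArg h0) fun _ => ?_
  rw [← map_one MvPowerSeries.C]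
  exact ((IsConvergent.C _).mul hf).sub (IsConvergent.C 1)

theorem constantCoeff_subst_zero {W : Type} {G : V → MvPowerSeries W ℂ}
    (hG : ∀ i, constantCoeff (G i) = 0) (f : MvPowerSeries V ℂ) :
    constantCoeff (subst G f) = constantCoeff f := by
  have hs := hasSubst_of_constantCoeff_zero hG
  conv_lhs => rw [← add_sub_cancel (C (constantCoeff f)) f]
  rw [subst_add hs, subst_C, map_add, constantCoeff_C,
    constantCoeff_subst_eq_zero hs hG (by simp), add_zero]

theorem subst_logQuot {W : Type} {G : V → MvPowerSeries W ℂ}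
    (hG : ∀ i, constantCoeff (G i) = 0) {f : MvPowerSeries V ℂ} (hf : constantCoeff f ≠ 0) :
    subst G (logQuot f) = logQuot (subst G f) := by
  have hs := hasSubst_of_constantCoeff_zero hG
  have hone : subst G (1 : MvPowerSeries V ℂ) = 1 := by
    rw [← map_one C, subst_C, map_one]
  rw [logQuot, logQuot, PowerSeries.subst, PowerSeries.subst,
    subst_comp_subst_apply (hasSubst_of_constantCoeff_zero fun _ => constantCoeff_logArg hf) hs]
  congr 1
  funext _
  rw [subst_sub hs, subst_mul hs, subst_C, hone, constantCoeff_subst_zero hG]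

end Functions

/-! ### Resonances -/

section Resonance

variable {V : Type} [Fintype V] [DecidableEq V]

/-- Composing with the diagonal map multiplies the n-th coefficient of component i by d^n on one
side and by d_i on the other, so only resonant monomials may occur. -/
theorem commute_diagMap_iff {F : FormalMap V} {d : V → ℂ} :
    Commute F (diagMap d) ↔
      ∀ i n, coeff n (F.comp i) ≠ 0 → ∏ k, d k ^ n k = d i := by
  constructor
  · intro h i n hn
    have h1 := congrArg (fun G => coeff n (FormalMap.comp G i)) h.eq
    simp only [FormalMap.mul_comp F, coeff_subst_diagMap, diagMap_mul_comp, coeff_C_mul] at h1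
    exact mul_right_cancel₀ hn h1
  · intro h
    ext1
    funext i
    ext n
    rw [FormalMap.mul_comp, coeff_subst_diagMap, diagMap_mul_comp, coeff_C_mul]
    by_cases hn : coeff n (F.comp i) = 0
    · rw [hn, mul_zero, mul_zero]
    · rw [h i n hn]

open Classical in
/-- The part of a formal map commuting with a diagonal map. -/
def resonantPart (d : V → ℂ) (F : FormalMap V) : FormalMap V :=
  ⟨fun i => ofCoeffs fun n => if ∏ k, d k ^ n k = d i then coeff n (F.comp i) else 0, fun i => by
    rw [← coeff_zero_eq_constantCoeff_apply, coeff_ofCoeffs, coeff_zero_eq_constantCoeff_apply,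
      F.zero_at, ite_self]⟩

open Classical in
theorem coeff_resonantPart (d : V → ℂ) (F : FormalMap V) (i : V) (n : V →₀ ℕ) :
    coeff n ((resonantPart d F).comp i) =
      if ∏ k, d k ^ n k = d i then coeff n (F.comp i) else 0 := rfl

theorem commute_resonantPart (d : V → ℂ) (F : FormalMap V) :
    Commute (resonantPart d F) (diagMap d) := by
  rw [commute_diagMap_iff]
  intro i n hn
  rw [coeff_resonantPart] at hn
  by_contra hc
  exact hn (if_neg hc)

/-- A map intertwining two maps in Poincaré-Dulac normal form with the same diagonal linear part
commutes with this linear part. -/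
theorem commute_diagMap_of_intertwine {A A' W : FormalMap V} {d : V → ℂ}
    (hA : Commute A (diagMap d)) (hA' : Commute A' (diagMap d)) (hj : A.jac = Matrix.diagonal d)
    (hj' : A'.jac = Matrix.diagonal d) (h : A' * W = W * A) : Commute W (diagMap d) := by
  have hlin : ∀ {B : FormalMap V}, B.jac = Matrix.diagonal d → ∀ i,
      AgreeTo 2 (B.comp i) ((diagMap d).comp i) := by
    intro B hB i
    have := FormalMap.agreeTo_linPart B i
    rwa [FormalMap.linPart_eq, hB, ← diagMap_eq] at this
  have key : ∀ D : ℕ, ∀ i (n : V →₀ ℕ), n.degree < D → ∏ k, d k ^ n k ≠ d i →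
      coeff n (W.comp i) = 0 := by
    intro D
    induction D with
    | zero => exact fun i n hn => absurd hn (by simp)
    | succ D ih =>
      intro i n hn hne
      rcases Nat.lt_succ_iff_lt_or_eq.1 hn with hn' | hn'
      · exact ih i n hn' hne
      rcases D with _ | e
      · rw [Finsupp.degree_eq_zero_iff] at hn'
        rw [hn', coeff_zero_eq_constantCoeff_apply, W.zero_at]
      -- Below degree e + 1 the map `W` equals its resonant part `R`, whose compositions with `A`
      -- and `A'` have no term at the non-resonant `n`. Only the linear effect of W - R remains: d_i
      -- times the coefficient on one side, d^n times it on the other.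
      set R := resonantPart d W with hR
      have hRc : Commute R (diagMap d) := commute_resonantPart d W
      have hWR : ∀ i, AgreeTo (e + 1) (W.comp i) (R.comp i) := by
        intro i m hm
        rw [hR, coeff_resonantPart]
        split_ifs with hc
        · rfl
        · exact ih i m hm hc
      have hz : ∀ {B : FormalMap V}, Commute B (diagMap d) → coeff n (B.comp i) = 0 := by
        intro B hB
        by_contra hc
        exact hne (commute_diagMap_iff.1 hB i n hc)
      have h1 : coeff n ((A' * W).comp i) = d i * coeff n (W.comp i) := by
        have hs : ∀ B : FormalMap V, subst B.comp (A'.comp i - (diagMap d).comp i) =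
            (A' * B).comp i - C (d i) * B.comp i := fun B => by
          rw [subst_sub B.hasSubst, ← FormalMap.mul_comp, ← FormalMap.mul_comp, diagMap_mul_comp]
        have h2 := AgreeTo.subst_right W.zero_at R.zero_at
          (AgreeTo.sub_zero_iff.2 (hlin hj' i)) hWR n (by omega)
        rw [hs, hs, map_sub, map_sub, hz (hA'.mul_left hRc), coeff_C_mul, coeff_C_mul,
          hz hRc, mul_zero, sub_zero, sub_eq_zero] at h2
        exact h2
      have h3 : coeff n ((W * A).comp i) = (∏ k, d k ^ n k) * coeff n (W.comp i) := by
        have h2 := AgreeTo.subst_right (e := 1) A.zero_at (diagMap d).zero_at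
          (AgreeTo.sub_zero_iff.2 (hWR i)) (hlin hj) n (by omega)
        rw [coeff_subst_diagMap, map_sub, hz hRc, sub_zero, subst_sub A.hasSubst, map_sub,
          ← FormalMap.mul_comp, ← FormalMap.mul_comp, hz (hRc.mul_left hA), sub_zero] at h2
        exact h2
      rw [h, h3] at h1
      by_contra hc
      exact hne (mul_right_cancel₀ hc h1)
  rw [commute_diagMap_iff]
  intro i n hn
  by_contra hc
  exact hn (key (n.degree + 1) i n (Nat.lt_succ_self _) hc)

end Resonance

/-! ### Centralizer of the linear part of σ̂. -/

section Centralizer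

variable {I : Type} [Fintype I] [DecidableEq I]

/-- The eigenvalues of the linear part of `σ̂`. -/
def sigmaEig (mu : I → ℂ) : I ⊕ I → ℂ := Sum.elim mu fun j => (mu j)⁻¹

/-- A resonance says μ^(n_ξ - n_η) = μ_j^{±1}, and non-resonance makes the exponent vector unique.
So n_ξ and n_η differ only by one unit at j, and the monomial is a product of ξ_k η_k times one
coordinate. -/
theorem exists_of_resonant {mu : I → ℂ} (hmu : ∀ j, mu j ≠ 0) (hres : NonResonant mu)
    {i : I ⊕ I} {n : I ⊕ I →₀ ℕ} (h : ∏ k, sigmaEig mu k ^ n k = sigmaEig mu i) :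
    ∃ m, n = expMap prodExp m + Finsupp.single i 1 := by
  have h1 : ∏ j, mu j ^ ((n (Sum.inl j) : ℤ) - n (Sum.inr j)) = sigmaEig mu i := by
    rw [← h, Fintype.prod_sum_type, ← Finset.prod_mul_distrib]
    refine Finset.prod_congr rfl fun j _ => ?_
    rw [zpow_sub₀ (hmu j), zpow_natCast, zpow_natCast, div_eq_mul_inv]
    simp [sigmaEig]
  have hδ : ∀ c : I → ℤ, ∏ j, mu j ^ c j = sigmaEig mu i →
      ∀ c' : I → ℤ, ∏ j, mu j ^ c' j = sigmaEig mu i → c = c' := by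
    intro c hc c' hc'
    by_contra hne
    refine hres (c - c') (sub_ne_zero.2 hne) ?_
    simp only [Pi.sub_apply, zpow_sub₀ (hmu _)]
    rw [Finset.prod_div_distrib, hc, hc', div_self]
    rw [← hc]
    exact Finset.prod_ne_zero_iff.2 fun j _ => zpow_ne_zero _ (hmu j)
  rcases i with j | j
  · have h2 := hδ _ h1 (Pi.single j 1) (by
      rw [Finset.prod_eq_single j]
      · simp [sigmaEig]
      · intro k _ hk
        simp [hk]
      · simp)
    have h3 : ∀ k, n (Sum.inl k) = n (Sum.inr k) + Finsupp.single j 1 k := by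
      intro k
      have := congrFun h2 k
      by_cases hk : k = j
      · subst hk
        rw [Pi.single_eq_same] at this
        rw [Finsupp.single_eq_same]
        omega
      · rw [Pi.single_eq_of_ne hk] at this
        rw [Finsupp.single_eq_of_ne hk]
        omega
    refine ⟨Finsupp.equivFunOnFinite.symm fun k => n (Sum.inr k), ?_⟩
    ext i
    rcases i with k | k
    · rw [Finsupp.add_apply, expMap_prodExp_inl, h3]
      simp [Finsupp.single_apply]
    · rw [Finsupp.add_apply, expMap_prodExp_inr]
      simp
  · have h2 := hδ _ h1 (Pi.single j (-1)) (by
      rw [Finset.prod_eq_single j]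
      · simp [sigmaEig]
      · intro k _ hk
        simp [hk]
      · simp)
    have h3 : ∀ k, n (Sum.inr k) = n (Sum.inl k) + Finsupp.single j 1 k := by
      intro k
      have := congrFun h2 k
      by_cases hk : k = j
      · subst hk
        rw [Pi.single_eq_same] at this
        rw [Finsupp.single_eq_same]
        omega
      · rw [Pi.single_eq_of_ne hk] at this
        rw [Finsupp.single_eq_of_ne hk]
        omega
    refine ⟨Finsupp.equivFunOnFinite.symm fun k => n (Sum.inl k), ?_⟩
    ext i
    rcases i with k | k
    · rw [Finsupp.add_apply, expMap_prodExp_inl]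
      simp
    · rw [Finsupp.add_apply, expMap_prodExp_inr, h3]
      simp [Finsupp.single_apply]

theorem exists_hatMap_of_commute {mu : I → ℂ} (hmu : ∀ j, mu j ≠ 0) (hres : NonResonant mu)
    {W : FormalMap (I ⊕ I)} (hW : Commute W (diagMap (sigmaEig mu))) :
    ∃ a b, W = hatMap a b := by
  have h : ∀ i, ∃ a, W.comp i = ofProd a * X i := fun i =>
    exists_ofProd_mul_X i fun n hn => exists_of_resonant hmu hres (commute_diagMap_iff.1 hW i n hn)
  choose a ha using h
  refine ⟨fun j => a (Sum.inl j), fun j => a (Sum.inr j), ?_⟩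
  ext1
  funext i
  rw [ha]
  rcases i with j | j <;> rfl

theorem diagMap_sigmaEig (mu : I → ℂ) :
    diagMap (sigmaEig mu) = hatMap (fun j => C (mu j)) fun j => C (mu j)⁻¹ := by
  ext1
  funext i
  rcases i with j | j
  · change C _ * X _ = ofProd _ * X _
    rw [ofProd_C]
    rfl
  · change C _ * X _ = ofProd _ * X _
    rw [ofProd_C]
    rfl

theorem commute_hatMap_diagMap {mu : I → ℂ} (hmu : ∀ j, mu j ≠ 0)
    (a b : I → MvPowerSeries I ℂ) : Commute (hatMap a b) (diagMap (sigmaEig mu)) := by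
  have h1 : ((fun j => C (mu j)) * fun j => C (mu j)⁻¹ : I → MvPowerSeries I ℂ) = 1 := by
    funext j
    rw [Pi.mul_apply, ← map_mul, mul_inv_cancel₀ (hmu j), map_one]
    rfl
  rw [Commute, SemiconjBy, diagMap_sigmaEig, hatMap_mul_of_mul_eq_one a b h1, hatMap_mul]
  simp only [subst_C]
  rw [mul_comm a, mul_comm b]
  rfl

theorem jac_hatSigma {M : I → MvPowerSeries I ℂ} {mu : I → ℂ} (hM : ∀ j, constantCoeff (M j) = mu j) :
    (hatSigma M).jac = Matrix.diagonal (sigmaEig mu) := by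
  rw [hatSigma_eq, jac_hatMap]
  congr 1
  funext i
  rcases i with j | j
  · exact hM j
  · change constantCoeff (M j)⁻¹ = (mu j)⁻¹
    rw [constantCoeff_inv, hM]

/-- The formal map with components `F`, for `F` in rest normal form. -/
theorem isUnit_of_isRestNormalForm {F : FormalMap I} (hF : IsRestNormalForm F.comp) :
    F.jac = 1 := by
  ext i k
  rw [← FormalMap.jac_one, FormalMap.jac_apply, FormalMap.jac_apply, FormalMap.one_comp]
  have := hF i (Finsupp.single k 1)
  rw [map_sub] at this
  by_contra hc
  have := (this (sub_ne_zero.2 hc)).1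
  simp at this

end Centralizer

/-! ### The logarithm of M̂ and the centralizer of σ̂. -/

section LogM

variable {e h s : ℕ}

/-- The normalizing factors in the definition of `logM`. -/
def logFactor : Idx e h s → ℂ
  | .inl _ => 1
  | .inr _ => -Complex.I

theorem logM_eq (M : Idx e h s → MvPowerSeries (Idx e h s) ℂ) (j : Idx e h s) :
    logM M j = C (logFactor j) * logQuot (M j) := by
  rcases j with k | k
  · simp [logM, logFactor]
  · rfl

/-- `logM` as a formal map. -/
def logMap (M : Idx e h s → MvPowerSeries (Idx e h s) ℂ) (hM : ∀ j, constantCoeff (M j) ≠ 0) :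
    FormalMap (Idx e h s) :=
  ⟨logM M, fun j => by rw [logM_eq, map_mul, constantCoeff_logQuot (hM j), mul_zero]⟩

theorem logMap_mul_comp {M : Idx e h s → MvPowerSeries (Idx e h s) ℂ}
    (hM : ∀ j, constantCoeff (M j) ≠ 0) (F : FormalMap (Idx e h s)) (j : Idx e h s) :
    (logMap M hM * F).comp j = C (logFactor j) * logQuot (subst F.comp (M j)) := by
  rw [FormalMap.mul_comp]
  change subst F.comp (logM M j) = _
  rw [logM_eq, subst_mul F.hasSubst, subst_C, subst_logQuot F.zero_at (hM j)]

/-- If `M ∘ B = M`, where `log M` is tangent to the identity, then `B` is the identity. -/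
theorem eq_one_of_subst_eq {M : Idx e h s → MvPowerSeries (Idx e h s) ℂ}
    (hM0 : ∀ j, constantCoeff (M j) ≠ 0) (hM : IsRestNormalForm (logM M))
    {B : FormalMap (Idx e h s)} (hB : ∀ j, subst B.comp (M j) = M j) : B = 1 := by
  have h1 : (logMap M hM0).jac = 1 := isUnit_of_isRestNormalForm hM
  obtain ⟨u, hu⟩ := FormalMap.isUnit_of_jac_eq_one h1
  have h2 : logMap M hM0 * B = logMap M hM0 := by
    ext1
    funext j
    rw [logMap_mul_comp, hB, ← logM_eq]
    rfl
  rw [← hu] at h2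
  exact (Units.mul_right_inj u).1 (h2.trans (mul_one _).symm)

/-- The invertible maps commuting with `σ̂`. -/
theorem exists_of_commute_hatSigma {M : Idx e h s → MvPowerSeries (Idx e h s) ℂ}
    {mu : Idx e h s → ℂ} (hmu : ∀ j, mu j ≠ 0) (hres : NonResonant mu)
    (hM0 : ∀ j, constantCoeff (M j) = mu j) (hM : IsRestNormalForm (logM M))
    {W : FormalMap (Idx e h s ⊕ Idx e h s)} (hW : Commute W (hatSigma M)) (hWu : IsUnit W) :
    ∃ a b, a * b = 1 ∧ W = hatMap a b := by
  have hM0' : ∀ j, constantCoeff (M j) ≠ 0 := fun j => by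
    rw [hM0]
    exact hmu j
  have hc := commute_hatMap_diagMap hmu M fun j => (M j)⁻¹
  have hj := jac_hatSigma hM0
  obtain ⟨a, b, rfl⟩ := exists_hatMap_of_commute hmu hres
    (commute_diagMap_of_intertwine hc hc hj hj hW.eq.symm)
  refine ⟨a, b, ?_, rfl⟩
  have ha : ∀ j, a j ≠ 0 := by
    intro j hj
    have h1 := FormalMap.isUnit_iff_jac.1 hWu
    rw [jac_hatMap, Matrix.isUnit_iff_isUnit_det, Matrix.det_diagonal] at h1
    exact Finset.prod_ne_zero_iff.1 h1.ne_zero (Sum.inl j) (Finset.mem_univ _) (by simp [hj])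
  have h1 := hW.eq
  rw [hatSigma_eq, hatMap_mul_of_mul_eq_one a b (mul_inv_eq_one_of hM0'), hatMap_mul] at h1
  -- Commutation compares a_j M_j with a_j (M_j ∘ B), where B scales ζ_k by a_k b_k. So B preserves
  -- M and is the identity by `eq_one_of_subst_eq`, that is, a b = 1.
  have h2 : ∀ j, subst (scaleMap (a * b)).comp (M j) = M j := by
    intro j
    have := congrFun (hatMap_injective h1).1 j
    simp only [Pi.mul_apply] at this
    rw [mul_comm] at this
    exact (mul_right_cancel₀ (ha j) this).symm
  have h3 := eq_one_of_subst_eq hM0' hM h2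
  funext j
  have h4 := congrFun (congrArg FormalMap.comp h3) j
  change (a * b) j * X j = X j at h4
  exact mul_right_cancel₀ (X_ne_zero j) (h4.trans (one_mul _).symm)

end LogM

/-! ### Conjugation by ρ and reversible factorizations of σ̂. -/

section Involutions

variable {e h s : ℕ}

/-- The permutation of the indices induced by `ρ` on the products `ξ_j η_j`. -/
def idxPerm : Idx e h s → Idx e h s
  | .inl k => iE k
  | .inr (.inl k) => iH k
  | .inr (.inr (.inl k)) => iT k
  | .inr (.inr (.inr k)) => iS k

/-- Conjugation by `ρ`. -/
def rhoConj (F : FormalMap (Idx e h s ⊕ Idx e h s)) : FormalMap (Idx e h s ⊕ Idx e h s) :=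
  FormalMap.conjBy rhoPerm rhoPerm F

theorem rhoConj_mul (F G : FormalMap (Idx e h s ⊕ Idx e h s)) :
    rhoConj (F * G) = rhoConj F * rhoConj G :=
  (FormalMap.conjBy_mul rhoPerm_involutive F G).symm

theorem rhoConj_one : rhoConj (1 : FormalMap (Idx e h s ⊕ Idx e h s)) = 1 :=
  FormalMap.conjBy_one rhoPerm_involutive

theorem rhoConj_rhoConj (F : FormalMap (Idx e h s ⊕ Idx e h s)) : rhoConj (rhoConj F) = F :=
  FormalMap.conjBy_conjBy rhoPerm_involutive rhoPerm_involutive F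

theorem conjPull_mul {V : Type} [Finite V] (π : V → V) (f g : MvPowerSeries V ℂ) :
    conjPull π (f * g) = conjPull π f * conjPull π g := by
  rw [← conjPullHom_apply, map_mul, conjPullHom_apply, conjPullHom_apply]

theorem conjPull_one {V : Type} [Finite V] (π : V → V) :
    conjPull π (1 : MvPowerSeries V ℂ) = 1 := by
  rw [← conjPullHom_apply, map_one]

theorem conjPull_ofProd (f : MvPowerSeries (Idx e h s) ℂ) :
    conjPull rhoPerm (ofProd f) = ofProd (conjPull idxPerm f) := by
  have hX : HasSubst (fun k => (X (idxPerm k) : MvPowerSeries (Idx e h s) ℂ)) :=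
    hasSubst_of_constantCoeff_zero fun k => constantCoeff_X _
  rw [ofProd, conjPull_subst _ constantCoeff_X_mul_X, ofProd, conjPull,
    subst_comp_subst_apply hX hasSubst_prod]
  congr 1
  funext k
  rw [conjPull_mul, conjPull_X, conjPull_X, subst_X hasSubst_prod]
  rcases k with k | k | k | k
  · exact mul_comm _ _
  · rfl
  · rfl
  · rfl

/-- The coefficients of the conjugate by `ρ` of a map `ξ_j' = a_j(ξη) ξ_j`, `η_j' = b_j(ξη) η_j`. -/
def conjFamily (a b : Idx e h s → MvPowerSeries (Idx e h s) ℂ) :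
    Idx e h s → MvPowerSeries (Idx e h s) ℂ
  | .inl k => conjPull idxPerm (b (iE k))
  | .inr j => conjPull idxPerm (a (idxPerm (.inr j)))

theorem conjFamily_mul (a b c d : Idx e h s → MvPowerSeries (Idx e h s) ℂ) :
    conjFamily (a * c) (b * d) = conjFamily a b * conjFamily c d := by
  funext j
  rcases j with k | j
  · exact conjPull_mul _ _ _
  · exact conjPull_mul _ _ _

theorem constantCoeff_conjPull_eq {V : Type} [Finite V] (π : V → V) (f : MvPowerSeries V ℂ) :
    constantCoeff (conjPull π f) = starRingEnd ℂ (constantCoeff f) := by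
  rw [conjPull, constantCoeff_subst_zero (fun k => constantCoeff_X (π k)), constantCoeff_map]

theorem rhoConj_hatMap (a b : Idx e h s → MvPowerSeries (Idx e h s) ℂ) :
    rhoConj (hatMap a b) = hatMap (conjFamily a b) (conjFamily b a) := by
  have key : ∀ (f : MvPowerSeries (Idx e h s) ℂ) (i : Idx e h s ⊕ Idx e h s),
      conjPull rhoPerm (ofProd f * X i) = ofProd (conjPull idxPerm f) * X (rhoPerm i) := by
    intro f i
    rw [conjPull_mul, conjPull_ofProd, conjPull_X]
  ext1
  funext i
  rcases i with (k | k | k | k) | (k | k | k | k) <;> exact key _ _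

theorem rhoConj_swapMap : rhoConj (swapMap : FormalMap (Idx e h s ⊕ Idx e h s)) = swapMap := by
  ext1
  funext i
  change conjPull rhoPerm (X (Sum.swap (rhoPerm i))) = X (Sum.swap i)
  rw [conjPull_X]
  rcases i with (k | k | k | k) | (k | k | k | k) <;> rfl

variable {lam : Idx e h s → ℂ} {M L : Idx e h s → MvPowerSeries (Idx e h s) ℂ}

theorem inv_family_sq (hLM : ∀ j, L j ^ 2 = M j) (hL : ∀ j, constantCoeff (L j) ≠ 0) :
    ((fun j => (L j)⁻¹) * fun j => (L j)⁻¹) = fun j => (M j)⁻¹ := by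
  funext j
  have hM : constantCoeff (M j) ≠ 0 := by
    rw [← hLM, map_pow]
    exact pow_ne_zero _ (hL j)
  rw [eq_comm, MvPowerSeries.inv_eq_iff_mul_eq_one hM, ← hLM]
  have := MvPowerSeries.mul_inv_cancel _ (hL j)
  simp only [Pi.mul_apply]
  linear_combination (L j * (L j)⁻¹ + 1) * this

/-- Reversibility, ρσ̂ρ = σ̂⁻¹, gives the corresponding identity for M = Λ². Extracting the root
leaves a sign in each component, settled at the origin by the normalization of λ: real, of modulus
one, or paired by λ_{s+s_*} = conj(λ_s)⁻¹. -/
theorem conjFamily_of_reverse (hlam : NormalizedMultipliers lam)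
    (hL0 : ∀ j, constantCoeff (L j) = lam j) (hLM : ∀ j, L j ^ 2 = M j)
    (hrev : rhoConj (hatSigma M) * hatSigma M = 1) :
    conjFamily L (fun j => (L j)⁻¹) * L = 1 := by
  have hL : ∀ j, constantCoeff (L j) ≠ 0 := fun j => by
    rw [hL0]
    exact hlam.ne_zero j
  have hM : ∀ j, constantCoeff (M j) ≠ 0 := fun j => by
    rw [← hLM, map_pow]
    exact pow_ne_zero _ (hL j)
  rw [hatSigma_eq, rhoConj_hatMap, hatMap_mul_of_mul_eq_one _ _ (mul_inv_eq_one_of hM),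
    ← hatMap_one] at hrev
  have h1 := (hatMap_injective hrev).1
  have hMM : M = L * L := by
    funext j
    rw [← hLM, sq]
    rfl
  rw [← inv_family_sq hLM hL, hMM, conjFamily_mul] at h1
  have hconst : ∀ j, constantCoeff ((conjFamily L (fun j => (L j)⁻¹) * L) j) = 1 := by
    rintro (k | k | k | k)
    · obtain ⟨r, hr, hk⟩ := hlam.ell k
      change constantCoeff (conjPull idxPerm (L (iE k))⁻¹ * L (iE k)) = 1
      rw [map_mul, constantCoeff_conjPull_eq, constantCoeff_inv, hL0, hk, ← Complex.ofReal_inv,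
        Complex.conj_ofReal, ← Complex.ofReal_mul, inv_mul_cancel₀ (by linarith), Complex.ofReal_one]
    · change constantCoeff (conjPull idxPerm (L (iH k)) * L (iH k)) = 1
      rw [map_mul, constantCoeff_conjPull_eq, hL0, mul_comm, Complex.mul_conj,
        Complex.normSq_eq_norm_sq, hlam.hyp k]
      simp
    · change constantCoeff (conjPull idxPerm (L (iT k)) * L (iS k)) = 1
      rw [map_mul, constantCoeff_conjPull_eq, hL0, hL0, hlam.cpx_pair, map_inv₀, Complex.conj_conj,
        inv_mul_cancel₀ (hlam.ne_zero _)]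
    · change constantCoeff (conjPull idxPerm (L (iS k)) * L (iT k)) = 1
      rw [map_mul, constantCoeff_conjPull_eq, hL0, hL0, hlam.cpx_pair, mul_inv_cancel₀]
      rw [Ne, _root_.map_eq_zero]
      exact hlam.ne_zero _
  funext j
  refine eq_of_sq_eq ?_ (by rw [hconst]; simp) (by rw [hconst]; exact one_ne_zero)
  have h2 := congrFun h1 j
  simp only [Pi.mul_apply, Pi.one_apply] at h2 ⊢
  linear_combination h2

/-- Conjugation by ρ inverts the coefficients of τ̂₁, by the reality of Λ. Equivalently, τ̂₁ times
its ρ-conjugate is σ̂, the model factorization. -/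
theorem rhoConj_hatTau (hlam : NormalizedMultipliers lam)
    (hL0 : ∀ j, constantCoeff (L j) = lam j) (hLM : ∀ j, L j ^ 2 = M j)
    (hrev : rhoConj (hatSigma M) * hatSigma M = 1) :
    rhoConj (hatTau L) = hatTau L * hatSigma M := by
  have hL : ∀ j, constantCoeff (L j) ≠ 0 := fun j => by
    rw [hL0]
    exact hlam.ne_zero j
  have hM : ∀ j, constantCoeff (M j) ≠ 0 := fun j => by
    rw [← hLM, map_pow]
    exact pow_ne_zero _ (hL j)
  have h1 := conjFamily_of_reverse hlam hL0 hLM hrev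
  have hLi := mul_inv_eq_one_of hL
  set Li : Idx e h s → MvPowerSeries (Idx e h s) ℂ := fun j => (L j)⁻¹ with hLidef
  have hMM : M = L * L := by
    funext j
    rw [← hLM, sq]
    rfl
  have h2 : conjFamily L Li = Li := by
    calc conjFamily L Li = conjFamily L Li * (L * Li) := by rw [hLi, mul_one]
      _ = Li := by rw [← mul_assoc, h1, one_mul]
  have h3 : conjFamily Li L = L := by
    have h4 : conjFamily (L * Li) (Li * L) = 1 := by
      rw [mul_comm Li L, hLi]
      funext j
      rcases j with j | j
      · exact conjPull_one _
      · exact conjPull_one _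
    rw [conjFamily_mul, h2] at h4
    calc conjFamily Li L = L * (Li * conjFamily Li L) := by rw [← mul_assoc, hLi, one_mul]
      _ = L := by rw [h4, mul_one]
  have hMi : (fun j => (M j)⁻¹) * M = 1 := by
    rw [mul_comm]
    exact mul_inv_eq_one_of hM
  rw [hatTau_eq, ← hLidef, hatSigma_eq, rhoConj_mul, rhoConj_hatMap, rhoConj_swapMap, h2, h3,
    mul_assoc, swapMap_mul_hatMap, ← mul_assoc, hatMap_mul_of_mul_eq_one _ _ hMi,
    ← inv_family_sq hLM hL, ← hLidef, hMM]
  congr 2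
  · rw [← mul_assoc, hLi, one_mul]
  · rw [← mul_assoc, mul_comm Li L, hLi, one_mul]

/-- τ̂₁ exchanges ξ and η and with them the two coefficient families. For b d = 1 this means that
τ̂₁ conjugates the map to its inverse. -/
theorem swapMap_hatTau_comm {b d : Idx e h s → MvPowerSeries (Idx e h s) ℂ}
    (hbd : b * d = 1) (hL : ∀ j, constantCoeff (L j) ≠ 0) :
    hatTau L * hatMap b d = hatMap d b * hatTau L := by
  rw [hatTau_eq, mul_assoc, swapMap_mul_hatMap, ← mul_assoc, ← mul_assoc,
    hatMap_mul_of_mul_eq_one _ _ (by rw [mul_comm, hbd]),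
    hatMap_mul_of_mul_eq_one _ _ (mul_inv_eq_one_of hL), mul_comm L d, mul_comm _ b]

theorem commute_hatMap {a b c d : Idx e h s → MvPowerSeries (Idx e h s) ℂ} (hab : a * b = 1)
    (hcd : c * d = 1) : Commute (hatMap a b) (hatMap c d) := by
  rw [Commute, SemiconjBy, hatMap_mul_of_mul_eq_one _ _ hcd, hatMap_mul_of_mul_eq_one _ _ hab,
    mul_comm a, mul_comm b]

/-- The hypotheses on the multipliers and on the normal form of `σ`. -/
structure SigmaData (lam : Idx e h s → ℂ) (M L : Idx e h s → MvPowerSeries (Idx e h s) ℂ) :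
    Prop where
  lam_norm : NormalizedMultipliers lam
  nonres : NonResonant fun j => lam j ^ 2
  L_zero : ∀ j, constantCoeff (L j) = lam j
  L_sq : ∀ j, L j ^ 2 = M j
  rest : IsRestNormalForm (logM M)

namespace SigmaData

theorem L_ne (hd : SigmaData lam M L) (j : Idx e h s) : constantCoeff (L j) ≠ 0 := by
  rw [hd.L_zero]
  exact hd.lam_norm.ne_zero j

theorem M_zero (hd : SigmaData lam M L) (j : Idx e h s) : constantCoeff (M j) = lam j ^ 2 := by
  rw [← hd.L_sq, map_pow, hd.L_zero]

theorem mu_ne (hd : SigmaData lam M L) (j : Idx e h s) : lam j ^ 2 ≠ 0 :=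
  pow_ne_zero _ (hd.lam_norm.ne_zero j)

theorem M_ne (hd : SigmaData lam M L) (j : Idx e h s) : constantCoeff (M j) ≠ 0 := by
  rw [hd.M_zero]
  exact hd.mu_ne j

theorem exists_hatMap (hd : SigmaData lam M L) {W : FormalMap (Idx e h s ⊕ Idx e h s)}
    (hW : Commute W (hatSigma M)) (hWu : IsUnit W) : ∃ a b, a * b = 1 ∧ W = hatMap a b :=
  exists_of_commute_hatSigma hd.mu_ne hd.nonres hd.M_zero hd.rest hW hWu

theorem jac_hatTau (hd : SigmaData lam M L) :
    (hatTau L).jac = (hatTau fun j => C (lam j)).jac := by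
  rw [hatTau_eq, hatTau_eq, FormalMap.jac_mul, FormalMap.jac_mul, jac_hatMap, jac_hatMap]
  congr 3
  · funext j
    simp [hd.L_zero]
  · funext j
    rw [constantCoeff_inv, constantCoeff_inv, constantCoeff_C, hd.L_zero]

/-- A reversible factorization of `σ̂` is conjugate to the standard one. -/
theorem exists_conj_hatTau (hd : SigmaData lam M L) {τ : FormalMap (Idx e h s ⊕ Idx e h s)}
    (hτ : τ * τ = 1) (hσ : τ * rhoConj τ = hatSigma M) (hj : τ.jac = (hatTau L).jac) :
    rhoConj (hatTau L) = hatTau L * hatSigma M ∧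
    ∃ b d : Idx e h s → MvPowerSeries (Idx e h s) ℂ, b * d = 1 ∧
      rhoConj (hatMap b d) = hatMap b d ∧ τ * hatMap b d = hatMap b d * hatTau L := by
  have hrr : rhoConj τ * rhoConj τ = 1 := by rw [← rhoConj_mul, hτ, rhoConj_one]
  have hrev : rhoConj (hatSigma M) * hatSigma M = 1 := by
    rw [← hσ, rhoConj_mul, rhoConj_rhoConj]
    calc rhoConj τ * τ * (τ * rhoConj τ) = rhoConj τ * (τ * τ) * rhoConj τ := by
          simp only [mul_assoc]
      _ = 1 := by rw [hτ, mul_one, hrr]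
  have hR := rhoConj_hatTau hd.lam_norm hd.L_zero hd.L_sq hrev
  refine ⟨hR, ?_⟩
  set t := hatTau L with ht
  set σ := hatSigma M with hσdef
  have htt : t * t = 1 := hatTau_mul_self hd.L_ne
  have htσ : t * σ * (t * σ) = 1 := by rw [← hR, ← rhoConj_mul, htt, rhoConj_one]
  have hτσ : rhoConj τ = τ * σ := by rw [← hσ, ← mul_assoc, hτ, one_mul]
  have hσtσ : σ * t * σ = t := by
    calc σ * t * σ = t * t * (σ * t * σ) := by rw [htt, one_mul]
      _ = t * (t * σ * (t * σ)) := by simp only [mul_assoc]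
      _ = t := by rw [htσ, mul_one]
  have hσu : IsUnit σ := by
    refine ⟨⟨σ, t * σ * t, ?_, ?_⟩, rfl⟩
    · rw [← mul_assoc, ← mul_assoc, hσtσ, htt]
    · calc t * σ * t * σ = t * σ * (t * σ) := by simp only [mul_assoc]
        _ = 1 := htσ
  have hστσ : σ * τ * σ = τ := by
    have h1 : τ * σ * (τ * σ) = 1 := by rw [← hτσ, hrr]
    calc σ * τ * σ = τ * τ * (σ * τ * σ) := by rw [hτ, one_mul]
      _ = τ * (τ * σ * (τ * σ)) := by simp only [mul_assoc]
      _ = τ := by rw [h1, mul_one]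
  -- Both involutions satisfy σ τ σ = τ, so each conjugates σ to its inverse and their product
  -- commutes with it.
  have hc : Commute (τ * t) σ := by
    obtain ⟨u, hu⟩ := hσu
    change τ * t * σ = σ * (τ * t)
    have h1 : σ * (τ * t * σ) = σ * (σ * (τ * t)) := by
      calc σ * (τ * t * σ) = σ * τ * (t * σ) := by simp only [mul_assoc]
        _ = σ * (σ * τ * σ) * (t * σ) := by rw [hστσ]
        _ = σ * (σ * τ) * (σ * t * σ) := by simp only [mul_assoc]
        _ = σ * (σ * (τ * t)) := by rw [hσtσ]; simp only [mul_assoc]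
    rw [← hu] at h1 ⊢
    exact (Units.mul_right_inj u).1 h1
  have hcj : (τ * t).jac = 1 := by
    rw [FormalMap.jac_mul, hj, ← FormalMap.jac_mul, htt, FormalMap.jac_one]
  obtain ⟨q, q', hqq, hq⟩ := hd.exists_hatMap hc (FormalMap.isUnit_of_jac_eq_one hcj)
  have hq0 : ∀ j, constantCoeff (q j) = 1 := by
    intro j
    rw [hq, jac_hatMap] at hcj
    have := congrFun (congrFun hcj (Sum.inl j)) (Sum.inl j)
    rwa [Matrix.diagonal_apply_eq, Matrix.one_apply_eq] at this
  -- This gives T with T² = τ τ̂₁. As τ̂₁ T = T⁻¹ τ̂₁, it follows that τ T = (τ τ̂₁)(τ̂₁ T) = T² T⁻¹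
  -- τ̂₁ = T τ̂₁.
  choose b hb0 hb using fun j => exists_sqrt (hq0 j)
  have hb0' : ∀ j, constantCoeff (b j) ≠ 0 := fun j => by
    rw [hb0]
    exact one_ne_zero
  let d : Idx e h s → MvPowerSeries (Idx e h s) ℂ := fun j => (b j)⁻¹
  have hbd : b * d = 1 := mul_inv_eq_one_of hb0'
  have hd0 : ∀ j, constantCoeff (d j) = 1 := fun j => by
    simp [d, hb0]
  have hbb : b * b = q := by
    funext j
    rw [← hb, sq]
    rfl
  have hdd : d * d = q' := by
    calc d * d = d * d * (q * q') := by rw [hqq, mul_one]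
      _ = (b * d) * (b * d) * q' := by rw [← hbb]; ring
      _ = q' := by rw [hbd, one_mul, one_mul]
  have hTT : hatMap b d * hatMap b d = τ * t := by
    rw [hatMap_mul_of_mul_eq_one _ _ hbd, hbb, hdd, hq]
  have hRc : rhoConj (τ * t) = τ * t := by
    rw [rhoConj_mul, hτσ, hR]
    calc τ * σ * (t * σ) = τ * (σ * t * σ) := by simp only [mul_assoc]
      _ = τ * t := by rw [hσtσ]
  refine ⟨b, d, hbd, ?_, ?_⟩
  -- T² is invariant under conjugation by ρ, and a square root with constant coefficients 1 is
  -- unique, so T is invariant too.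
  · have h1 : hatMap (conjFamily b d * conjFamily b d) (conjFamily d b * conjFamily d b) =
        hatMap (b * b) (d * d) := by
      rw [← conjFamily_mul, ← conjFamily_mul, ← rhoConj_hatMap, hbb, hdd, ← hq, hRc]
    have hone : ∀ (a c : Idx e h s → MvPowerSeries (Idx e h s) ℂ),
        (∀ j, constantCoeff (a j) = 1) → (∀ j, constantCoeff (c j) = 1) →
        ∀ j, constantCoeff (conjFamily a c j) = 1 := by
      rintro a c ha hc (k | k)
      · change constantCoeff (conjPull _ _) = 1
        rw [constantCoeff_conjPull_eq, hc, map_one]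
      · change constantCoeff (conjPull _ _) = 1
        rw [constantCoeff_conjPull_eq, ha, map_one]
    have h2 := hatMap_injective h1
    rw [rhoConj_hatMap]
    congr 1
    · funext j
      refine eq_of_sq_eq ?_ (by rw [hone b d hb0 hd0, hb0])
        (by rw [hone b d hb0 hd0]; exact one_ne_zero)
      rw [sq, sq]
      exact congrFun h2.1 j
    · funext j
      refine eq_of_sq_eq ?_ (by rw [hone d b hd0 hb0, hd0])
        (by rw [hone d b hd0 hb0]; exact one_ne_zero)
      rw [sq, sq]
      exact congrFun h2.2 j
  · have h1 := swapMap_hatTau_comm hbd hd.L_ne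
    have h2 : hatMap b d * hatMap d b = 1 := by
      rw [hatMap_mul_of_mul_eq_one _ _ (by rw [mul_comm, hbd]), hbd, mul_comm d b, hbd, hatMap_one]
    calc τ * hatMap b d = τ * (t * t) * hatMap b d := by rw [htt, mul_one]
      _ = τ * t * (t * hatMap b d) := by simp only [mul_assoc]
      _ = hatMap b d * hatMap b d * (hatMap d b * t) := by rw [hTT, h1]
      _ = hatMap b d * (hatMap b d * hatMap d b) * t := by simp only [mul_assoc]
      _ = hatMap b d * t := by rw [h2, mul_one]

/-- The maps commuting with `τ̂₁` and `ρ`. -/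
theorem eq_mapR (hd : SigmaData lam M L) (hR : rhoConj (hatTau L) = hatTau L * hatSigma M)
    {T : FormalMap (Idx e h s ⊕ Idx e h s)} (hT : IsUnit T) (hTR : rhoConj T = T)
    (hTt : Commute T (hatTau L)) : ∃ ε, IsRealSign ε ∧ T = mapR ε := by
  have htt := hatTau_mul_self hd.L_ne
  have hσ : hatSigma M = hatTau L * rhoConj (hatTau L) := by rw [hR, ← mul_assoc, htt, one_mul]
  -- By reality `T` also commutes with the ρ-conjugate of τ̂₁, hence with their product σ̂.
  have hTσ : Commute T (hatSigma M) := by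
    rw [hσ]
    refine hTt.mul_right ?_
    have := congrArg rhoConj hTt.eq
    rwa [rhoConj_mul, rhoConj_mul, hTR] at this
  obtain ⟨a, b, hab, rfl⟩ := hd.exists_hatMap hTσ hT
  -- Commuting with τ̂₁, which interchanges the families, forces a = b. With a b = 1 this leaves
  -- only signs.
  have h1 : hatMap a b = hatMap b a := by
    have h2 : hatMap b a * hatTau L = hatMap a b * hatTau L := by
      rw [hTt.eq, swapMap_hatTau_comm hab hd.L_ne]
    calc hatMap a b = hatMap a b * (hatTau L * hatTau L) := by rw [htt, mul_one]
      _ = hatMap b a := by rw [← mul_assoc, ← h2, mul_assoc, htt, mul_one]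
  obtain ⟨rfl, -⟩ := hatMap_injective h1
  have h2 : ∀ j, a j = 1 ∨ a j = -1 := by
    intro j
    rw [← mul_self_eq_one_iff]
    exact congrFun hab j
  let ε : Idx e h s → ℂ := fun j => constantCoeff (a j)
  have h3 : ∀ j, a j = C (ε j) := by
    intro j
    rcases h2 j with h | h <;> simp [ε, h]
  have h4 : ∀ j, ε j = 1 ∨ ε j = -1 := by
    intro j
    rcases h2 j with h | h <;> simp [ε, h]
  refine ⟨ε, ⟨h4, fun k => ?_⟩, ?_⟩
  · rw [rhoConj_hatMap] at hTR
    have h5 := congrFun (hatMap_injective hTR).1 (iS k)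
    change conjPull idxPerm (a (iT k)) = a (iS k) at h5
    have h6 := congrArg constantCoeff h5
    rw [constantCoeff_conjPull_eq] at h6
    change starRingEnd ℂ (ε (iT k)) = ε (iS k) at h6
    rw [← h6]
    rcases h4 (iT k) with h | h <;> simp [h]
  · rw [mapR_eq_hatMap]
    congr 1 <;> funext j <;> exact h3 j

theorem rhoConj_mapR {ε : Idx e h s → ℂ} (hε : IsRealSign ε) : rhoConj (mapR ε) = mapR ε := by
  have hconj : ∀ j, starRingEnd ℂ (ε j) = ε j := by
    intro j
    rcases hε.1 j with h | h <;> simp [h]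
  rw [mapR_eq_hatMap, rhoConj_hatMap]
  have : conjFamily (fun j => C (ε j)) (fun j => C (ε j)) = fun j => C (ε j) := by
    funext j
    rcases j with k | k | k | k
    · change conjPull idxPerm (C (ε (iE k))) = C (ε (iE k))
      rw [conjPull_C, hconj]
    · change conjPull idxPerm (C (ε (iH k))) = C (ε (iH k))
      rw [conjPull_C, hconj]
    · change conjPull idxPerm (C (ε (iT k))) = C (ε (iS k))
      rw [conjPull_C, hconj, hε.2]
    · change conjPull idxPerm (C (ε (iS k))) = C (ε (iT k))
      rw [conjPull_C, hconj, hε.2]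
  rw [this]

/-- The coordinates in which `ρ₀`, `τ₁` and `σ` are simultaneously in normal form. -/
theorem exists_coordinates (hd : SigmaData lam M L)
    {τ : (FormalMap (Idx e h s ⊕ Idx e h s))ˣ}
    (hτ : (τ : FormalMap (Idx e h s ⊕ Idx e h s)) * τ = 1)
    (hσ : HasSigmaNormalForm (τ : FormalMap (Idx e h s ⊕ Idx e h s)) lam M) :
    rhoConj (hatTau L) = hatTau L * hatSigma M ∧
    ∃ Θ : (FormalMap (Idx e h s ⊕ Idx e h s))ˣ,
      FormalMap.conjBy Sum.swap rhoPerm (Θ : FormalMap (Idx e h s ⊕ Idx e h s)) = Θ ∧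
      (τ : FormalMap (Idx e h s ⊕ Idx e h s)) * Θ = Θ * hatTau L ∧
      sigmaOf (τ : FormalMap (Idx e h s ⊕ Idx e h s)) * Θ = Θ * hatSigma M := by
  obtain ⟨Θ, hΘρ, hΘσ, hΘj⟩ := hσ
  -- `t` is τ₁ in the coordinates `Θ`. Since these carry ρ to ρ₀, the ρ-conjugate of `t` is τ₂.
  set t : FormalMap (Idx e h s ⊕ Idx e h s) :=
    ((Θ⁻¹ : (FormalMap _)ˣ) : FormalMap (Idx e h s ⊕ Idx e h s)) * τ * Θ with ht
  have hΘt : (Θ : FormalMap (Idx e h s ⊕ Idx e h s)) * t = τ * Θ := by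
    rw [ht, mul_assoc, ← mul_assoc (Θ : FormalMap (Idx e h s ⊕ Idx e h s)), Units.mul_inv, one_mul]
  have htt : t * t = 1 := by
    rw [← Units.mul_right_inj Θ, ← mul_assoc, hΘt, mul_assoc, hΘt, ← mul_assoc, hτ, one_mul,
      mul_one]
  have hρt : (Θ : FormalMap (Idx e h s ⊕ Idx e h s)) * rhoConj t =
      FormalMap.conjBy Sum.swap Sum.swap (τ : FormalMap (Idx e h s ⊕ Idx e h s)) * Θ := by
    conv_lhs => rw [← hΘρ]
    conv_rhs => rw [← hΘρ]
    rw [rhoConj, FormalMap.conjBy_mul rhoPerm_involutive, hΘt,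
      FormalMap.conjBy_mul swap_involutive]
  have hts : t * rhoConj t = hatSigma M := by
    rw [← Units.mul_right_inj Θ, ← mul_assoc, hΘt, mul_assoc, hρt, ← mul_assoc, ← hΘσ]
    rfl
  have htj : t.jac = (hatTau L).jac := by
    have h1 : ((Θ : FormalMap (Idx e h s ⊕ Idx e h s)) * t).jac =
        ((Θ : FormalMap (Idx e h s ⊕ Idx e h s)) * hatTau L).jac := by
      rw [hΘt, hΘj, FormalMap.jac_mul, FormalMap.jac_mul, hd.jac_hatTau]
    have h2 : ∀ F : FormalMap (Idx e h s ⊕ Idx e h s), F.jac =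
        ((Θ⁻¹ : (FormalMap _)ˣ) : FormalMap (Idx e h s ⊕ Idx e h s)).jac *
          ((Θ : FormalMap (Idx e h s ⊕ Idx e h s)) * F).jac := fun F => by
      rw [← FormalMap.jac_mul, ← mul_assoc, Units.inv_mul, one_mul]
    rw [h2 t, h1, ← h2]
  obtain ⟨hR, b, d, hbd, hbρ, hbt⟩ := hd.exists_conj_hatTau htt hts htj
  refine ⟨hR, ?_⟩
  have hT : IsUnit (hatMap b d) := by
    refine ⟨⟨hatMap b d, hatMap d b, ?_, ?_⟩, rfl⟩
    · rw [hatMap_mul_of_mul_eq_one _ _ (by rw [mul_comm, hbd]), hbd, mul_comm d b, hbd, hatMap_one]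
    · rw [hatMap_mul_of_mul_eq_one _ _ hbd, hbd, mul_comm d b, hbd, hatMap_one]
  obtain ⟨T, hT⟩ := hT
  refine ⟨Θ * T, ?_, ?_, ?_⟩
  · rw [Units.val_mul, hT, ← FormalMap.conjBy_mul rhoPerm_involutive, hΘρ]
    congr 1
  · rw [Units.val_mul, hT, ← mul_assoc, ← hΘt, mul_assoc, hbt, mul_assoc]
  -- The correcting map commutes with σ̂, so the normal form of σ survives the change of
  -- coordinates.
  · rw [Units.val_mul, hT, ← mul_assoc, hΘσ, mul_assoc, mul_assoc]
    congr 1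
    rw [hatSigma_eq]
    exact (commute_hatMap hbd (mul_inv_eq_one_of hd.M_ne)).eq.symm

end SigmaData

end Involutions

/-! ### Linearization of finite groups of formal maps -/

section Linearization

variable {V : Type} [Fintype V] [DecidableEq V]

theorem subst_sum {W ι : Type} {G : V → MvPowerSeries W ℂ} (hG : HasSubst G) (s : Finset ι)
    (f : ι → MvPowerSeries V ℂ) : subst G (∑ i ∈ s, f i) = ∑ i ∈ s, subst G (f i) := by
  simp only [← coe_substAlgHom hG, map_sum]

/-- A finite group of formal maps is linearized by averaging. -/
theorem exists_linearization (G : Subgroup (FormalMap V)ˣ) [Finite G] :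
    ∃ B : FormalMap V, B.jac = 1 ∧
      (∀ g ∈ G, B * (g : FormalMap V) = (g : FormalMap V).linPart * B) ∧
      ((∀ g ∈ G, (g : FormalMap V).Convergent) → B.Convergent) ∧
      ∀ i, (∀ g ∈ G, (g : FormalMap V).comp i = X i) → B.comp i = X i := by
  have := Fintype.ofFinite G
  have hcard : (Fintype.card G : ℂ) ≠ 0 := Nat.cast_ne_zero.2 Fintype.card_ne_zero
  -- Each term is (Dg)⁻¹ ∘ g, tangent to the identity. Since A_{g'} ∘ g = Dg ∘ A_{g'g}, translating
  -- the summation index shows that the average intertwines g with Dg.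
  let A : G → FormalMap V := fun g =>
    ((g⁻¹ : G) : (FormalMap V)ˣ).val.linPart * (g : (FormalMap V)ˣ).val
  have hAj : ∀ g : G, (A g).jac = 1 := by
    intro g
    rw [FormalMap.jac_mul, FormalMap.linPart_eq, FormalMap.jac_ofMatrix, ← FormalMap.jac_mul,
      Subgroup.coe_inv, Units.inv_mul, FormalMap.jac_one]
  have hAg : ∀ g g' : G, A g' * (g : (FormalMap V)ˣ).val =
      (g : (FormalMap V)ˣ).val.linPart * A (g' * g) := by
    intro g g'
    simp only [A]
    rw [← mul_assoc (FormalMap.linPart _), ← FormalMap.linPart_mul, ← Units.val_mul,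
      ← Subgroup.coe_mul, mul_inv_rev, mul_inv_cancel_left, Subgroup.coe_mul, Units.val_mul,
      mul_assoc]
  let B : FormalMap V := ⟨fun i => C (Fintype.card G : ℂ)⁻¹ * ∑ g : G, (A g).comp i, fun i => by
    simp [FormalMap.zero_at]⟩
  refine ⟨B, ?_, ?_, ?_, ?_⟩
  · ext i k
    change coeff _ (C _ * ∑ g : G, (A g).comp i) = _
    rw [coeff_C_mul, map_sum]
    have : ∀ g : G, coeff (Finsupp.single k 1) ((A g).comp i) = (1 : Matrix V V ℂ) i k := by
      intro g
      rw [← FormalMap.jac_apply, hAj]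
    simp only [this, Finset.sum_const, Finset.card_univ, nsmul_eq_mul]
    rw [inv_mul_cancel_left₀ hcard]
  · intro g hg
    ext1
    funext i
    rw [FormalMap.linPart_eq, FormalMap.ofMatrix_mul_comp, FormalMap.mul_comp]
    simp only [B]
    rw [subst_mul (FormalMap.hasSubst _), subst_C, subst_sum (FormalMap.hasSubst _)]
    have h1 : ∀ g' : G, subst (g : FormalMap V).comp ((A g').comp i) =
        ∑ k, C ((g : FormalMap V).jac i k) * (A (g' * ⟨g, hg⟩)).comp k := by
      intro g'
      rw [← FormalMap.ofMatrix_mul_comp, ← FormalMap.linPart_eq, ← hAg ⟨g, hg⟩ g']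
      rfl
    simp only [h1]
    rw [Finset.sum_comm, Finset.mul_sum]
    refine Finset.sum_congr rfl fun k _ => ?_
    rw [← Finset.mul_sum, mul_left_comm]
    congr 2
    exact Equiv.sum_comp (Equiv.mulRight (⟨g, hg⟩ : G)) fun g' => (A g').comp k
  · intro hG i
    refine (IsConvergent.C _).mul (IsConvergent.sum _ fun g _ => ?_)
    exact (FormalMap.convergent_ofMatrix _).mul (hG _ g.2) i
  · intro i hi
    have h1 : ∀ g : G, (A g).comp i = X i := by
      intro g
      have h2 : (((g⁻¹ : G) : (FormalMap V)ˣ) : FormalMap V).linPart.comp i = X i := by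
        rw [FormalMap.linPart_eq, FormalMap.ofMatrix_comp]
        simp only [FormalMap.jac_apply]
        rw [hi _ (g⁻¹).2, Finset.sum_eq_single i]
        · rw [coeff_index_single_self_X, map_one, one_mul]
        · intro k _ hk
          rw [coeff_index_single_X, if_neg hk, map_zero, zero_mul]
        · simp
      change subst (g : (FormalMap V)ˣ).val.comp _ = _
      rw [h2, subst_X (FormalMap.hasSubst _), hi _ g.2]
    change C _ * ∑ g : G, (A g).comp i = X i
    simp only [h1, Finset.sum_const, Finset.card_univ, nsmul_eq_mul]
    rw [← map_natCast (C (σ := V) (R := ℂ)), ← mul_assoc, ← map_mul, inv_mul_cancel₀ hcard,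
      map_one, one_mul]

end Linearization

/-! ### Deck transformations -/

section Decks

variable {I : Type} [Fintype I] [DecidableEq I]

theorem coeff_single_two_sq {V : Type} {f : MvPowerSeries V ℂ} (hf : constantCoeff f = 0) (k : V) :
    coeff (Finsupp.single k 2) (f ^ 2) = coeff (Finsupp.single k 1) f ^ 2 := by
  classical
  rw [sq, coeff_mul, Finsupp.antidiagonal_single, Finset.sum_map]
  simp [Finset.Nat.antidiagonal_succ, hf, sq]

/-- The pure squares suffice: the coefficient of X_k² in f² is the square of the k-th derivative of
f at 0. -/
theorem coeff_of_sq_agreeTo {V : Type} [DecidableEq V] {f : MvPowerSeries V ℂ}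
    (hf : constantCoeff f = 0) {i : V} (h : AgreeTo 3 (f ^ 2) (X i ^ 2)) :
    ∀ k, coeff (Finsupp.single k 1) f ^ 2 = if k = i then 1 else 0 := by
  intro k
  have h1 := h (Finsupp.single k 2) (by simp)
  rw [coeff_single_two_sq hf, coeff_single_two_sq (constantCoeff_X i), coeff_index_single_X] at h1
  rw [h1]
  split_ifs <;> simp

theorem IsConvergent.unsquare {f : MvPowerSeries (I ⊕ I) ℂ} (hf : IsConvergent f) :
    IsConvergent (unsquare f) := by
  obtain ⟨K, r, hr, hn⟩ := hf
  have hK : 0 ≤ K := by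
    have := (norm_nonneg _).trans (hn 0)
    simpa using this
  refine ⟨K, max r 1 ^ 2, by positivity, fun n => (hn (expMap sqExp n)).trans ?_⟩
  refine mul_le_mul_of_nonneg_left ?_ hK
  rw [← pow_mul]
  refine (pow_le_pow_left₀ hr.le (le_max_left r 1) _).trans
    (pow_le_pow_right₀ (le_max_right r 1) ?_)
  rw [Finsupp.degree_eq_sum, Finsupp.degree_eq_sum, Fintype.sum_sum_type, Fintype.sum_sum_type,
    mul_add, Finset.mul_sum, Finset.mul_sum]
  refine add_le_add (Finset.sum_le_sum fun j _ => ?_) (Finset.sum_le_sum fun j _ => ?_)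
  · rw [expMap_sqExp_inl]
    omega
  · rw [expMap_sqExp_inr]
    omega

/-- A map through which a convergent map factors over `sqMap` is convergent. -/
theorem convergent_of_fold {F H : FormalMap (I ⊕ I)} (h : F * sqMap = H) (hH : H.Convergent) :
    F.Convergent := by
  intro i
  rw [← unsquare_subst (F.comp i)]
  have := congrFun (congrArg FormalMap.comp h) i
  rw [FormalMap.mul_comp] at this
  rw [this]
  exact (hH i).unsquare

theorem convergent_sqMap : (sqMap : FormalMap (I ⊕ I)).Convergent := by
  rintro (j | j)
  · exact IsConvergent.X _
  · exact (IsConvergent.X _).pow 2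

/-- The group of deck transformations. -/
def deckGroup (E : I → MvPowerSeries (I ⊕ I) ℂ) : Subgroup (FormalMap (I ⊕ I))ˣ where
  carrier := deckTransformations E
  one_mem' := ⟨FormalMap.convergent_one, fun _ => rfl, fun j => congrFun subst_self (E j)⟩
  mul_mem' := by
    rintro a b ⟨ha, ha1, ha2⟩ ⟨hb, hb1, hb2⟩
    refine ⟨ha.mul hb, fun j => ?_, fun j => ?_⟩
    · rw [Units.val_mul, FormalMap.mul_comp, ha1, subst_X (FormalMap.hasSubst _), hb1]
    · conv_rhs => rw [← hb2 j, ← ha2 j]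
      rw [subst_comp_subst_apply (FormalMap.hasSubst _) (FormalMap.hasSubst _)]
      rfl
  inv_mem' := by
    rintro a ⟨ha, ha1, ha2⟩
    have key : ∀ f : MvPowerSeries (I ⊕ I) ℂ, subst (a : FormalMap (I ⊕ I)).comp f = f →
        subst ((a⁻¹ : (FormalMap (I ⊕ I))ˣ) : FormalMap (I ⊕ I)).comp f = f := by
      intro f hf
      conv_lhs => rw [← hf]
      rw [subst_comp_subst_apply (FormalMap.hasSubst _) (FormalMap.hasSubst _)]
      change subst ((a : FormalMap (I ⊕ I)) *
        ((a⁻¹ : (FormalMap (I ⊕ I))ˣ) : FormalMap (I ⊕ I))).comp f = f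
      rw [Units.mul_inv]
      exact congrFun subst_self f
    refine ⟨ha.inv, fun j => ?_, fun j => key _ (ha2 j)⟩
    have := key (X (Sum.inl j)) (by rw [subst_X (FormalMap.hasSubst _), ha1])
    rwa [subst_X (FormalMap.hasSubst _)] at this

theorem jac_flip (S : Finset I) : (flip S).jac =
    Matrix.diagonal (Sum.elim 1 fun k => if k ∈ S then -1 else 1) := jac_diagMap _

theorem linPart_flip (S : Finset I) : (flip S).linPart = flip S := by
  rw [FormalMap.linPart_eq, jac_flip, ← diagMap_eq, flip]

variable {E : I → MvPowerSeries (I ⊕ I) ℂ} {c d : I → ℂ}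

/-- The linear parts of the deck transformations are sign changes. -/
theorem exists_flip_of_deck (hc : ∀ j, c j ≠ 0)
    (hQ : ∀ j, AgreeTo 3 (E j) (C (c j) * X (Sum.inr j) ^ 2 + C (d j) * X (Sum.inl j) ^ 2))
    {τ : (FormalMap (I ⊕ I))ˣ} (hτ : τ ∈ deckTransformations E) :
    ∃ S, (τ : FormalMap (I ⊕ I)).jac = (flip S).jac := by
  obtain ⟨-, hl, hE⟩ := hτ
  have hs := (τ : FormalMap (I ⊕ I)).hasSubst
  -- As `τ` fixes the first block and preserves `E`, the terms with coefficient `d` cancel in degree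
  -- two, leaving a comparison of squares.
  have h1 : ∀ j, AgreeTo 3 ((τ : FormalMap (I ⊕ I)).comp (Sum.inr j) ^ 2) (X (Sum.inr j) ^ 2) := by
    intro j n hn
    have h2 := ((hQ j).subst (FormalMap.zero_at (τ : FormalMap (I ⊕ I)))).symm.trans
      ((hE j ▸ hQ j : AgreeTo 3 (subst (τ : FormalMap (I ⊕ I)).comp (E j)) _)) n hn
    rw [subst_add hs, subst_mul hs, subst_mul hs, subst_C, subst_C, subst_pow hs, subst_pow hs,
      subst_X hs, subst_X hs, hl, map_add, map_add, add_left_inj, coeff_C_mul, coeff_C_mul] at h2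
    exact mul_left_cancel₀ (hc j) h2
  have h2 := fun j => coeff_of_sq_agreeTo (FormalMap.zero_at (τ : FormalMap (I ⊕ I)) _) (h1 j)
  classical
  refine ⟨Finset.univ.filter fun j => (τ : FormalMap (I ⊕ I)).jac (Sum.inr j) (Sum.inr j) = -1, ?_⟩
  rw [jac_flip]
  ext i k
  rcases i with j | j
  · rw [FormalMap.jac_apply, hl, coeff_index_single_X, Matrix.diagonal_apply]
    by_cases hk : k = Sum.inl j
    · simp [hk]
    · rw [if_neg hk, if_neg (Ne.symm hk)]
  · rw [Matrix.diagonal_apply]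
    have h3 := h2 j k
    rw [← FormalMap.jac_apply] at h3
    by_cases hk : k = Sum.inr j
    · subst hk
      rw [if_pos rfl] at h3
      rw [if_pos rfl, Sum.elim_inr]
      simp only [Finset.mem_filter, Finset.mem_univ, true_and]
      split_ifs with h4
      · exact h4
      · exact (mul_self_eq_one_iff.1 (by rw [← sq, h3])).resolve_right h4
    · rw [if_neg hk] at h3
      rw [if_neg (Ne.symm hk)]
      exact pow_eq_zero_iff two_ne_zero |>.1 h3

/-- Coordinates in which the deck transformations are the sign changes, when the quadratic terms
are diagonal. -/
theorem exists_fold_coordinates_of_diagonal (hE : ∀ j, IsConvergent (E j)) (hc : ∀ j, c j ≠ 0)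
    (hQ : ∀ j, AgreeTo 3 (E j) (C (c j) * X (Sum.inr j) ^ 2 + C (d j) * X (Sum.inl j) ^ 2))
    (hD : ConditionD E) (h0 : ∀ j, constantCoeff (E j) = 0) :
    ∃ B F : (FormalMap (I ⊕ I))ˣ, (B : FormalMap (I ⊕ I)).Convergent ∧
      (F : FormalMap (I ⊕ I)).Convergent ∧ (B : FormalMap (I ⊕ I)).jac = 1 ∧
      graphMap E h0 = (F : FormalMap (I ⊕ I)) * sqMap * (B : FormalMap (I ⊕ I)) ∧
      ∀ τ ∈ deckTransformations E,
        ((B : FormalMap (I ⊕ I)) * (τ : FormalMap (I ⊕ I)) =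
          (τ : FormalMap (I ⊕ I)).linPart * B) := by
  have hfin : (deckTransformations E).Finite :=
    Set.finite_of_ncard_ne_zero (by rw [hD]; positivity)
  have : Finite (deckGroup E) := hfin
  obtain ⟨B₀, hBj, hBτ, hBc, hBl⟩ := exists_linearization (deckGroup E)
  obtain ⟨B, rfl⟩ := FormalMap.isUnit_of_jac_eq_one hBj
  have hBc := hBc fun g hg => hg.1
  have hBl : ∀ j, (B : FormalMap (I ⊕ I)).comp (Sum.inl j) = X (Sum.inl j) :=
    fun j => hBl _ fun g hg => hg.2.1 j
  choose! σ hσ using fun (τ : (FormalMap (I ⊕ I))ˣ) (hτ : τ ∈ deckTransformations E) =>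
    exists_flip_of_deck hc hQ hτ
  -- In the linearizing coordinates a deck transformation is determined by its linear part. So the
  -- 2^p of them have distinct sign patterns, and by counting every subset occurs.
  have hinj : Set.InjOn σ (deckTransformations E) := by
    intro τ hτ τ' hτ' h
    have h1 : (τ : FormalMap (I ⊕ I)).linPart = (τ' : FormalMap (I ⊕ I)).linPart := by
      rw [FormalMap.linPart_eq, FormalMap.linPart_eq, hσ τ hτ, hσ τ' hτ', h]
    have h2 := hBτ τ hτ
    rw [h1, ← hBτ τ' hτ'] at h2
    exact Units.ext ((Units.mul_right_inj B).1 h2)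
  have hsurj : σ '' deckTransformations E = Set.univ := by
    refine Set.eq_of_subset_of_ncard_le (Set.subset_univ _) ?_
    rw [hinj.ncard_image, hD, Set.ncard_univ, Nat.card_eq_fintype_card,
      Fintype.card_finset]
  let Bi : FormalMap (I ⊕ I) := ((B⁻¹ : (FormalMap (I ⊕ I))ˣ) : FormalMap (I ⊕ I))
  have hBBi : (B : FormalMap (I ⊕ I)) * Bi = 1 := Units.mul_inv B
  have hBiB : Bi * (B : FormalMap (I ⊕ I)) = 1 := Units.inv_mul B
  have hBij : Bi.jac = 1 := by
    have := congrArg FormalMap.jac hBiB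
    rwa [FormalMap.jac_mul, hBj, mul_one, FormalMap.jac_one] at this
  have hBil : ∀ j, Bi.comp (Sum.inl j) = X (Sum.inl j) := by
    intro j
    have := congrFun (congrArg FormalMap.comp hBBi) (Sum.inl j)
    rwa [FormalMap.mul_comp, hBl, subst_X Bi.hasSubst] at this
  -- In these coordinates the defining functions are invariant under every sign change, hence are
  -- series in (x, y²).
  let G : I → MvPowerSeries (I ⊕ I) ℂ := fun j => subst Bi.comp (E j)
  have hG0 : ∀ j, constantCoeff (G j) = 0 := fun j =>
    constantCoeff_subst_eq_zero Bi.hasSubst Bi.zero_at (h0 j)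
  have hGflip : ∀ j S, subst (flip S).comp (G j) = G j := by
    intro j S
    obtain ⟨τ, hτ, rfl⟩ : S ∈ σ '' deckTransformations E := hsurj ▸ Set.mem_univ S
    have h1 : Bi * flip (σ τ) = (τ : FormalMap (I ⊕ I)) * Bi := by
      have h2 := hBτ τ hτ
      rw [FormalMap.linPart_eq, hσ τ hτ, ← FormalMap.linPart_eq, linPart_flip] at h2
      calc Bi * flip (σ τ) = Bi * (flip (σ τ) * (B : FormalMap (I ⊕ I))) * Bi := by
            simp only [mul_assoc, hBBi, mul_one]
        _ = Bi * (B : FormalMap (I ⊕ I)) * (τ : FormalMap (I ⊕ I)) * Bi := by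
            rw [← h2]; simp only [mul_assoc]
        _ = (τ : FormalMap (I ⊕ I)) * Bi := by rw [hBiB, one_mul]
    change subst _ (subst _ _) = subst _ _
    rw [subst_comp_subst_apply Bi.hasSubst (flip _).hasSubst]
    change subst (Bi * flip (σ τ)).comp (E j) = _
    rw [h1]
    change subst (fun i => subst Bi.comp ((τ : FormalMap (I ⊕ I)).comp i)) (E j) = _
    rw [← subst_comp_subst_apply (FormalMap.hasSubst _) Bi.hasSubst, hτ.2.2 j]
  have hGu : ∀ j, subst sqMap.comp (unsquare (G j)) = G j := fun j =>
    subst_unsquare fun n hn => coeff_eq_zero_of_flip (hGflip j) n hn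
  have hexp0 : expMap sqExp (0 : I ⊕ I →₀ ℕ) = 0 := Finsupp.sum_zero_index
  let F₀ : FormalMap (I ⊕ I) := ⟨Sum.elim (fun j => X (Sum.inl j)) fun j => unsquare (G j), by
    rintro (j | j)
    · exact constantCoeff_X _
    · change constantCoeff (unsquare (G j)) = 0
      rw [← coeff_zero_eq_constantCoeff_apply, unsquare, coeff_ofCoeffs, hexp0,
        coeff_zero_eq_constantCoeff_apply, hG0]⟩
  have hF₀ : F₀ * sqMap = graphMap E h0 * Bi := by
    ext1
    funext i
    rcases i with j | j
    · rw [graphMap_mul_comp_inl, hBil]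
      exact subst_X sqMap.hasSubst _
    · exact hGu j
  have hGQ : ∀ j, AgreeTo 3 (G j) (C (c j) * X (Sum.inr j) ^ 2 + C (d j) * X (Sum.inl j) ^ 2) := by
    intro j
    have h1 : AgreeTo 2 (E j) 0 := by
      refine ((hQ j).mono (by norm_num)).trans ?_
      have hX : ∀ (a : ℂ) (i : I ⊕ I), AgreeTo 2 (C a * X i ^ 2 : MvPowerSeries (I ⊕ I) ℂ) 0 := by
        intro a i
        have h2 := AgreeTo.one_of_constantCoeff (constantCoeff_X (R := ℂ) i)
        have h3 := (AgreeTo.zero_deg (C a : MvPowerSeries (I ⊕ I) ℂ) 0).mul_zero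
          (h2.mul_zero h2)
        rw [sq]
        exact h3
      simpa using (hX (c j) (Sum.inr j)).add (hX (d j) (Sum.inl j))
    have h2 := AgreeTo.subst_right (e := 1) Bi.zero_at (1 : FormalMap (I ⊕ I)).zero_at h1
      fun i => FormalMap.agreeTo_X_of_jac hBij i
    refine AgreeTo.trans h2 ?_
    have h3 : subst (1 : FormalMap (I ⊕ I)).comp (E j) = E j := congrFun subst_self (E j)
    rw [h3]
    exact hQ j
  -- Replacing y² by y makes c_j y_j² linear while d_j x_j² stays quadratic, so c_j ≠ 0 is exactly
  -- invertibility.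
  have hF₀j : F₀.jac = Matrix.diagonal (Sum.elim 1 c) := by
    ext i k
    rcases i with j | j
    · change coeff _ (X _) = _
      rw [coeff_index_single_X, Matrix.diagonal_apply]
      by_cases hk : k = Sum.inl j
      · simp [hk]
      · rw [if_neg hk, if_neg (Ne.symm hk)]
    · change coeff _ (unsquare (G j)) = _
      rw [unsquare, coeff_ofCoeffs, expMap_single, Matrix.diagonal_apply]
      have h1 : (sqExp k).degree < 3 := by
        rcases k with k | k <;> simp [sqExp]
      rw [hGQ j _ h1, map_add, coeff_C_mul, coeff_C_mul, X_pow_eq, X_pow_eq, coeff_monomial,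
        coeff_monomial]
      have h3 : ¬ sqExp k = Finsupp.single (Sum.inl j) 2 := by
        rcases k with k | k
        · simp [sqExp, Finsupp.single_eq_single_iff]
        · simp [sqExp, Finsupp.single_eq_single_iff]
      have h4 : sqExp k = Finsupp.single (Sum.inr j) 2 ↔ Sum.inr j = k := by
        rcases k with k | k
        · simp [sqExp, Finsupp.single_eq_single_iff]
        · simp [sqExp, Finsupp.single_eq_single_iff, eq_comm]
      rw [if_neg h3, mul_zero, add_zero, mul_ite, mul_one, mul_zero]
      by_cases h5 : Sum.inr j = k
      · rw [if_pos h5, if_pos (h4.2 h5), Sum.elim_inr]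
      · rw [if_neg h5, if_neg (mt h4.1 h5)]
  have hF₀u : IsUnit F₀ := by
    rw [FormalMap.isUnit_iff_jac, hF₀j, Matrix.isUnit_diagonal, Pi.isUnit_iff]
    rintro (j | j)
    · exact isUnit_one
    · exact (hc j).isUnit
  obtain ⟨F, hF⟩ := hF₀u
  refine ⟨B, F, hBc, ?_, hBj, ?_, fun τ hτ => hBτ τ hτ⟩
  · rw [hF]
    refine convergent_of_fold hF₀ (FormalMap.Convergent.mul ?_ hBc.inv)
    rintro (j | j)
    · exact IsConvergent.X _
    · exact hE j
  · rw [hF, hF₀, mul_assoc, hBiB, mul_one]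

end Decks

/-! ### Completing the squares, and the linear part of the comparison map. -/

section Shear

variable {I : Type} [Fintype I] [DecidableEq I]

/-- The linear change of coordinates `x_j = z_j`, `y_j = w_{π j} + α_j z_j`. -/
def shear (π : I → I) (α : I → ℂ) : FormalMap (I ⊕ I) :=
  ⟨Sum.elim (fun j => X (Sum.inl j)) fun j => X (Sum.inr (π j)) + C (α j) * X (Sum.inl j), by
    rintro (j | j) <;> simp⟩

/-- The inverse of `shear`. -/
def shearInv (π : I → I) (α : I → ℂ) : FormalMap (I ⊕ I) :=
  ⟨Sum.elim (fun j => X (Sum.inl j))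
    fun j => X (Sum.inr (π j)) - C (α (π j)) * X (Sum.inl (π j)), by
    rintro (j | j) <;> simp⟩

variable {π : I → I} {α : I → ℂ}

theorem subst_shearInv (hπ : Function.Involutive π) (j : I) :
    subst (shearInv π α).comp (X (Sum.inr (π j)) + C (α j) * X (Sum.inl j)) = X (Sum.inr j) := by
  rw [subst_add (FormalMap.hasSubst _), subst_mul (FormalMap.hasSubst _), subst_C,
    subst_X (FormalMap.hasSubst _), subst_X (FormalMap.hasSubst _)]
  simp only [shearInv, Sum.elim_inl, Sum.elim_inr, hπ j]
  ring

theorem shear_mul_shearInv (hπ : Function.Involutive π) : shear π α * shearInv π α = 1 := by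
  ext1
  funext i
  rcases i with j | j
  · exact subst_X (FormalMap.hasSubst _) _
  · exact subst_shearInv hπ j

theorem shearInv_mul_shear (hπ : Function.Involutive π) : shearInv π α * shear π α = 1 := by
  ext1
  funext i
  rcases i with j | j
  · exact subst_X (FormalMap.hasSubst _) _
  · change subst (shear π α).comp (X _ - C _ * X _) = X _
    rw [subst_sub (FormalMap.hasSubst _), subst_mul (FormalMap.hasSubst _), subst_C,
      subst_X (FormalMap.hasSubst _), subst_X (FormalMap.hasSubst _)]
    simp only [shear, Sum.elim_inl, Sum.elim_inr, hπ j]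
    ring

theorem convergent_shear : (shear π α).Convergent := by
  rintro (j | j)
  · exact IsConvergent.X _
  · exact (IsConvergent.X _).add ((IsConvergent.C _).mul (IsConvergent.X _))

/-- Deck transformations in other coordinates. -/
theorem conj_mem_deckTransformations {E : I → MvPowerSeries (I ⊕ I) ℂ} {A : (FormalMap (I ⊕ I))ˣ}
    (hAc : (A : FormalMap (I ⊕ I)).Convergent)
    (hAl : ∀ j, (A : FormalMap (I ⊕ I)).comp (Sum.inl j) = X (Sum.inl j))
    (hAl' : ∀ j, ((A⁻¹ : (FormalMap (I ⊕ I))ˣ) : FormalMap (I ⊕ I)).comp (Sum.inl j) =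
      X (Sum.inl j))
    {τ : (FormalMap (I ⊕ I))ˣ} (hτ : τ ∈ deckTransformations E) :
    A * τ * A⁻¹ ∈ deckTransformations fun j =>
      subst ((A⁻¹ : (FormalMap (I ⊕ I))ˣ) : FormalMap (I ⊕ I)).comp (E j) := by
  obtain ⟨h1, h2, h3⟩ := hτ
  refine ⟨(hAc.mul h1).mul hAc.inv, fun j => ?_, fun j => ?_⟩
  · rw [Units.val_mul, Units.val_mul, FormalMap.mul_comp, FormalMap.mul_comp, hAl,
      subst_X (FormalMap.hasSubst _), h2, subst_X (FormalMap.hasSubst _), hAl']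
  · rw [subst_comp_subst_apply (FormalMap.hasSubst _) (FormalMap.hasSubst _)]
    change subst (((A⁻¹ : (FormalMap (I ⊕ I))ˣ) : FormalMap (I ⊕ I)) *
      ((A * τ * A⁻¹ : (FormalMap (I ⊕ I))ˣ) : FormalMap (I ⊕ I))).comp (E j) = _
    rw [← Units.val_mul, mul_assoc A, inv_mul_cancel_left, Units.val_mul]
    change _ = subst _ (E j)
    conv_rhs => rw [← h3 j]
    rw [subst_comp_subst_apply (FormalMap.hasSubst _) (FormalMap.hasSubst _)]
    rfl

theorem ncard_deckTransformations {E : I → MvPowerSeries (I ⊕ I) ℂ} {A : (FormalMap (I ⊕ I))ˣ}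
    (hAc : (A : FormalMap (I ⊕ I)).Convergent)
    (hAl : ∀ j, (A : FormalMap (I ⊕ I)).comp (Sum.inl j) = X (Sum.inl j))
    (hAl' : ∀ j, ((A⁻¹ : (FormalMap (I ⊕ I))ˣ) : FormalMap (I ⊕ I)).comp (Sum.inl j) =
      X (Sum.inl j)) :
    (deckTransformations fun j =>
      subst ((A⁻¹ : (FormalMap (I ⊕ I))ˣ) : FormalMap (I ⊕ I)).comp (E j)).ncard =
    (deckTransformations E).ncard := by
  rw [← Set.ncard_image_of_injective (deckTransformations E) (MulAut.conj A).injective]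
  congr 1
  ext τ
  constructor
  · intro hτ
    refine ⟨A⁻¹ * τ * A, ?_, by rw [MulAut.conj_apply]; group⟩
    have h1 := conj_mem_deckTransformations (A := A⁻¹) hAc.inv hAl' (by rwa [inv_inv]) hτ
    rw [inv_inv] at h1
    have h2 : (fun j => subst (A : FormalMap (I ⊕ I)).comp
        (subst ((A⁻¹ : (FormalMap (I ⊕ I))ˣ) : FormalMap (I ⊕ I)).comp (E j))) = E := by
      funext j
      rw [subst_comp_subst_apply (FormalMap.hasSubst _) (FormalMap.hasSubst _)]
      change subst (((A⁻¹ : (FormalMap (I ⊕ I))ˣ) : FormalMap (I ⊕ I)) *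
        (A : FormalMap (I ⊕ I))).comp (E j) = _
      rw [Units.inv_mul]
      exact congrFun subst_self (E j)
    rwa [h2] at h1
  · rintro ⟨τ', hτ', rfl⟩
    exact conj_mem_deckTransformations hAc hAl hAl' hτ'

/-- The rank of a sign change minus the identity is the number of signs -1 and does not change under
conjugation. By rank–nullity a fixed space of dimension p in dimension 2p leaves p of them. -/
theorem eq_univ_of_finrank {A A' : Matrix (I ⊕ I) (I ⊕ I) ℂ} {S : Finset I} (hA : A * A' = 1)
    (h : Module.finrank ℂ (LinearMap.ker (Matrix.toLin' (A' * (flip S).jac * A - 1))) =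
      Fintype.card I) : S = Finset.univ := by
  have hA' := mul_eq_one_comm.1 hA
  have h1 : A' * (flip S).jac * A - 1 = A' * ((flip S).jac - 1) * A := by
    rw [mul_sub, sub_mul, mul_one, hA']
  have h2 := LinearMap.finrank_range_add_finrank_ker (Matrix.toLin' (A' * (flip S).jac * A - 1))
  rw [h, Module.finrank_fintype_fun_eq_card, Fintype.card_sum] at h2
  have h3 : (A' * (flip S).jac * A - 1).rank = Fintype.card I := by
    rw [Matrix.rank, ← Matrix.toLin'_apply']
    omega
  rw [h1, Matrix.rank_mul_eq_left_of_isUnit_det _ _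
      ((Matrix.isUnit_iff_isUnit_det A).1 ⟨⟨A, A', hA, hA'⟩, rfl⟩),
    Matrix.rank_mul_eq_right_of_isUnit_det _ _
      ((Matrix.isUnit_iff_isUnit_det A').1 ⟨⟨A', A, hA', hA⟩, rfl⟩), jac_flip,
    ← Matrix.diagonal_one, Matrix.diagonal_sub, Matrix.rank_diagonal, Fintype.card_subtype] at h3
  have h4 : (Finset.univ.filter fun i : I ⊕ I =>
      (Sum.elim 1 (fun k => if k ∈ S then -1 else 1) : I ⊕ I → ℂ) i - 1 ≠ 0) =
      S.map Function.Embedding.inr := by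
    ext i
    rcases i with j | j
    · simp
    · by_cases hj : j ∈ S
      · simp [hj]
        norm_num
      · simp [hj]
  rw [h4, Finset.card_map] at h3
  exact (Finset.card_eq_iff_eq_univ S).1 h3

/-- Coordinates in which the principal deck transformation is a sign change. -/
theorem exists_fold_coordinates {E : I → MvPowerSeries (I ⊕ I) ℂ} {c d : I → ℂ}
    (hπ : Function.Involutive π) (hE : ∀ j, IsConvergent (E j)) (hc : ∀ j, c j ≠ 0)
    (hQ : ∀ j, AgreeTo 3 (E j) (C (c j) * (X (Sum.inr (π j)) + C (α j) * X (Sum.inl j)) ^ 2 +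
      C (d j) * X (Sum.inl j) ^ 2))
    (hD : ConditionD E) (h0 : ∀ j, constantCoeff (E j) = 0) :
    ∃ B F : (FormalMap (I ⊕ I))ˣ, (B : FormalMap (I ⊕ I)).Convergent ∧
      (F : FormalMap (I ⊕ I)).Convergent ∧ (B : FormalMap (I ⊕ I)).jac = (shear π α).jac ∧
      graphMap E h0 = (F : FormalMap (I ⊕ I)) * sqMap * (B : FormalMap (I ⊕ I)) ∧
      ∀ τ, IsPrincipalDeck E τ → (B : FormalMap (I ⊕ I)) * (τ : FormalMap (I ⊕ I)) =
          flip Finset.univ * (B : FormalMap (I ⊕ I)) := by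
  let A : (FormalMap (I ⊕ I))ˣ :=
    ⟨shear π α, shearInv π α, shear_mul_shearInv hπ, shearInv_mul_shear hπ⟩
  have hAc : (A : FormalMap (I ⊕ I)).Convergent := convergent_shear
  let E' : I → MvPowerSeries (I ⊕ I) ℂ := fun j =>
    subst ((A⁻¹ : (FormalMap (I ⊕ I))ˣ) : FormalMap (I ⊕ I)).comp (E j)
  have hs : HasSubst (shearInv π α).comp := FormalMap.hasSubst _
  have hQ' : ∀ j, AgreeTo 3 (E' j) (C (c j) * X (Sum.inr j) ^ 2 + C (d j) * X (Sum.inl j) ^ 2) := by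
    intro j
    have h1 := (hQ j).subst (shearInv π α).zero_at
    rw [subst_add hs, subst_mul hs, subst_mul hs, subst_pow hs, subst_pow hs, subst_C, subst_C,
      subst_shearInv hπ, subst_X hs] at h1
    exact h1
  have h0' : ∀ j, constantCoeff (E' j) = 0 := fun j =>
    constantCoeff_subst_eq_zero (FormalMap.hasSubst _) (FormalMap.zero_at _) (h0 j)
  obtain ⟨B, F, hB, hF, hBj, hgr, hBτ⟩ := exists_fold_coordinates_of_diagonal
    (fun j => (hE j).subst (FormalMap.zero_at _) hAc.inv) hc hQ'
    ((ncard_deckTransformations hAc (fun _ => rfl) fun _ => rfl).trans hD) h0'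
  refine ⟨B * A, F, hB.mul hAc, hF, ?_, ?_, ?_⟩
  · rw [Units.val_mul, FormalMap.jac_mul, hBj, one_mul]
  · rw [Units.val_mul, ← mul_assoc, ← hgr]
    have : graphMap E' h0' =
        graphMap E h0 * ((A⁻¹ : (FormalMap (I ⊕ I))ˣ) : FormalMap (I ⊕ I)) := by
      ext1
      funext i
      rcases i with j | j
      · exact (graphMap_mul_comp_inl h0 (shearInv π α) j).symm
      · rfl
    rw [this, mul_assoc, Units.inv_mul, mul_one]
  · rintro τ ⟨hτ, hrank⟩
    have h1 := conj_mem_deckTransformations (A := A) hAc (fun _ => rfl) (fun _ => rfl) hτ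
    obtain ⟨S, hS⟩ := exists_flip_of_deck hc hQ' h1
    have h2 := hBτ _ h1
    have h3 : (τ : FormalMap (I ⊕ I)).jac = (shearInv π α).jac * (flip S).jac * (shear π α).jac := by
      rw [← hS, ← FormalMap.jac_mul, ← FormalMap.jac_mul]
      congr 1
      change ((τ : (FormalMap (I ⊕ I))ˣ) : FormalMap (I ⊕ I)) =
        ((A⁻¹ * (A * τ * A⁻¹) * A : (FormalMap (I ⊕ I))ˣ) : FormalMap (I ⊕ I))
      congr 1
      group
    have h4 : S = Finset.univ := by
      refine eq_univ_of_finrank (A := (shear π α).jac) (A' := (shearInv π α).jac) ?_ (h3 ▸ hrank)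
      rw [← FormalMap.jac_mul, shear_mul_shearInv hπ, FormalMap.jac_one]
    rw [FormalMap.linPart_eq, hS, ← FormalMap.linPart_eq, linPart_flip, h4] at h2
    have h5 : ((A * τ : (FormalMap (I ⊕ I))ˣ) : FormalMap (I ⊕ I)) =
        ((A * τ * A⁻¹ * A : (FormalMap (I ⊕ I))ˣ) : FormalMap (I ⊕ I)) := by
      congr 1
      group
    rw [Units.val_mul, mul_assoc, ← Units.val_mul, h5, Units.val_mul, ← mul_assoc, h2, mul_assoc]

/-- The shear mixes only z_j and w_{π j}, so it respects any labelling that gives these two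
coordinates the same label. -/
theorem jac_shear_mul_diagonal (hπ : Function.Involutive π) (d : I → ℂ) :
    (shear π α).jac * Matrix.diagonal (Sum.elim d (d ∘ π)) =
      Matrix.diagonal (Sum.elim d d) * (shear π α).jac := by
  ext i k
  rw [Matrix.mul_diagonal, Matrix.diagonal_mul]
  have hX : ∀ (i' k' : I ⊕ I) (p q : ℂ), (k' = i' → p = q) →
      coeff (Finsupp.single k' 1) (X i' : MvPowerSeries (I ⊕ I) ℂ) * p =
        q * coeff (Finsupp.single k' 1) (X i' : MvPowerSeries (I ⊕ I) ℂ) := by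
    intro i' k' p q hpq
    rw [coeff_index_single_X]
    split_ifs with h
    · rw [hpq h, one_mul, mul_one]
    · simp
  rcases i with j | j
  · refine hX (Sum.inl j) k _ _ ?_
    rintro rfl
    rfl
  · change coeff (Finsupp.single k 1) (X (Sum.inr (π j)) + C (α j) * X (Sum.inl j) :
        MvPowerSeries (I ⊕ I) ℂ) * _ = _ * coeff (Finsupp.single k 1)
          (X (Sum.inr (π j)) + C (α j) * X (Sum.inl j) : MvPowerSeries (I ⊕ I) ℂ)
    rw [map_add, coeff_C_mul, add_mul, mul_add, mul_assoc, mul_left_comm (Sum.elim d d (Sum.inr j)),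
      hX (Sum.inr (π j)) k _ (Sum.elim d d (Sum.inr j) : ℂ), hX (Sum.inl j) k _
        (Sum.elim d d (Sum.inr j) : ℂ)]
    · rintro rfl
      rfl
    · rintro rfl
      simp [hπ j]

/-- The linear part of the change of coordinates between the fold coordinates and the coordinates
of the normal form preserves the splitting and the pairs of coordinates. -/
theorem folds_linPart {mu lam : I → ℂ} (hπ : Function.Involutive π) (hmu : ∀ j, mu j ≠ 0)
    (hres : NonResonant mu) (hlam : ∀ j, lam j ≠ 0) {M L : I → MvPowerSeries I ℂ}
    (hM : ∀ j, constantCoeff (M j) = mu j) (hL : ∀ j, constantCoeff (L j) = lam j)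
    {B Θ Y : (FormalMap (I ⊕ I))ˣ} {τ : FormalMap (I ⊕ I)}
    (hB : (B : FormalMap (I ⊕ I)).jac = (shear π α).jac)
    (hBτ : (B : FormalMap (I ⊕ I)) * τ = flip Finset.univ * (B : FormalMap (I ⊕ I)))
    (hΘτ : τ * (Θ : FormalMap (I ⊕ I)) = (Θ : FormalMap (I ⊕ I)) * hatTau L)
    (hΘσ : sigmaOf τ * (Θ : FormalMap (I ⊕ I)) = (Θ : FormalMap (I ⊕ I)) * hatSigma M)
    (hY : (Y : FormalMap (I ⊕ I)) * (B * Θ : (FormalMap (I ⊕ I))ˣ) = straighten L) :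
    Folds (Y : FormalMap (I ⊕ I)).linPart := by
  have hL0 : ∀ j, constantCoeff (L j) ≠ 0 := fun j => by
    rw [hL]
    exact hlam j
  obtain ⟨b, hb⟩ := FormalMap.isUnit_iff_jac.1 B.isUnit
  obtain ⟨θ, hθ⟩ := FormalMap.isUnit_iff_jac.1 Θ.isUnit
  have hBτj : (b : Matrix _ _ ℂ) * τ.jac = (flip Finset.univ).jac * (b : Matrix _ _ ℂ) := by
    rw [hb, ← FormalMap.jac_mul, hBτ, FormalMap.jac_mul]
  have hP : ∀ d : I → ℂ, (b : Matrix _ _ ℂ) * Matrix.diagonal (Sum.elim d (d ∘ π)) =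
      Matrix.diagonal (Sum.elim d d) * (b : Matrix _ _ ℂ) := by
    intro d
    rw [hb, hB, jac_shear_mul_diagonal hπ]
  have hτP : ∀ d : I → ℂ, τ.jac * Matrix.diagonal (Sum.elim d (d ∘ π)) =
      Matrix.diagonal (Sum.elim d (d ∘ π)) * τ.jac := by
    intro d
    have hcomm : (flip Finset.univ).jac * Matrix.diagonal (Sum.elim d d) =
        Matrix.diagonal (Sum.elim d d) * (flip (Finset.univ : Finset I)).jac := by
      rw [jac_flip, Matrix.diagonal_mul_diagonal, Matrix.diagonal_mul_diagonal]
      congr 1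
      funext i
      exact mul_comm _ _
    rw [← Units.mul_right_inj b]
    calc (b : Matrix _ _ ℂ) * (τ.jac * Matrix.diagonal (Sum.elim d (d ∘ π)))
        = (b : Matrix _ _ ℂ) * τ.jac * Matrix.diagonal (Sum.elim d (d ∘ π)) := by rw [mul_assoc]
      _ = (flip Finset.univ).jac * ((b : Matrix _ _ ℂ) * Matrix.diagonal (Sum.elim d (d ∘ π))) := by
          rw [hBτj, mul_assoc]
      _ = Matrix.diagonal (Sum.elim d d) * ((flip Finset.univ).jac * (b : Matrix _ _ ℂ)) := by
          rw [hP, ← mul_assoc, hcomm, mul_assoc]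
      _ = (b : Matrix _ _ ℂ) * Matrix.diagonal (Sum.elim d (d ∘ π)) * τ.jac := by
          rw [← hBτj, hP, mul_assoc]
      _ = (b : Matrix _ _ ℂ) * (Matrix.diagonal (Sum.elim d (d ∘ π)) * τ.jac) := mul_assoc _ _ _
  have hτ'P : ∀ d : I → ℂ, (FormalMap.conjBy Sum.swap Sum.swap τ).jac *
      Matrix.diagonal (Sum.elim d (d ∘ π)) =
      Matrix.diagonal (Sum.elim d (d ∘ π)) * (FormalMap.conjBy Sum.swap Sum.swap τ).jac := by
    intro d
    ext i k
    have h1 := congrFun (congrFun (hτP (star d ∘ π)) (Sum.swap i)) (Sum.swap k)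
    rw [Matrix.mul_diagonal, Matrix.diagonal_mul] at h1 ⊢
    rw [FormalMap.jac_conjBy swap_involutive]
    have h2 : ∀ i : I ⊕ I, starRingEnd ℂ ((Sum.elim (star d ∘ π) ((star d ∘ π) ∘ π) : I ⊕ I → ℂ)
        (Sum.swap i)) = (Sum.elim d (d ∘ π) : I ⊕ I → ℂ) i := by
      rintro (i | i)
      · simp [hπ i]
      · simp
    rw [← h2, ← h2, ← map_mul, h1, map_mul]
  -- Distinct labels mark the pairs (z_j, w_{π j}): a matrix commuting with `P` preserves each pair.
  -- The linear parts of τ₁ and τ₂ do so, and therefore that of σ does.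
  let d : I → ℂ := fun j => ((Fintype.equivFin I j : ℕ) : ℂ)
  have hd : Function.Injective d := fun i j hij =>
    (Fintype.equivFin I).injective (Fin.ext (Nat.cast_injective hij))
  let P : Matrix (I ⊕ I) (I ⊕ I) ℂ := Matrix.diagonal (Sum.elim d (d ∘ π))
  have hσP : (sigmaOf τ).jac * P = P * (sigmaOf τ).jac := by
    rw [sigmaOf, FormalMap.jac_mul, mul_assoc, hτ'P, ← mul_assoc, hτP, mul_assoc]
  have hστ : (sigmaOf τ).jac * (θ : Matrix _ _ ℂ) = (θ : Matrix _ _ ℂ) * Matrix.diagonal (sigmaEig mu) := by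
    rw [hθ, ← FormalMap.jac_mul, hΘσ, FormalMap.jac_mul, jac_hatSigma hM]
  have hττ : τ.jac * (θ : Matrix _ _ ℂ) = (θ : Matrix _ _ ℂ) * (hatTau L).jac := by
    rw [hθ, ← FormalMap.jac_mul, hΘτ, FormalMap.jac_mul]
  let D : Matrix (I ⊕ I) (I ⊕ I) ℂ :=
    ((θ⁻¹ : (Matrix (I ⊕ I) (I ⊕ I) ℂ)ˣ) : Matrix (I ⊕ I) (I ⊕ I) ℂ) * P * (θ : Matrix _ _ ℂ)
  have hθD : (θ : Matrix _ _ ℂ) * D = P * (θ : Matrix _ _ ℂ) := by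
    simp only [D]
    rw [mul_assoc, Units.mul_inv_cancel_left]
  have hDcomm : ∀ A e : Matrix (I ⊕ I) (I ⊕ I) ℂ, A * P = P * A →
      A * (θ : Matrix _ _ ℂ) = (θ : Matrix _ _ ℂ) * e → D * e = e * D := by
    intro A e hAP hAe
    rw [← Units.mul_right_inj θ, ← mul_assoc, hθD, mul_assoc, ← hAe, ← mul_assoc, ← hAP, mul_assoc,
      ← hθD, ← mul_assoc, hAe, mul_assoc]
  have hDe := hDcomm _ _ hσP hστ
  have hDT := hDcomm _ _ (hτP d) hττ
  -- `D` is `P` seen in the normal-form coordinates. It commutes with the linear part of σ̂, so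
  -- non-resonance makes it diagonal; commuting with that of τ̂₁ then makes its entries at ξ_j and
  -- η_j equal.
  obtain ⟨p, q, hpq⟩ := exists_hatMap_of_commute hmu hres (W := FormalMap.ofMatrix D) (by
    rw [diagMap_eq, Commute, SemiconjBy, ← FormalMap.ofMatrix_mul, ← FormalMap.ofMatrix_mul, hDe])
  have hDd := congrArg FormalMap.jac hpq
  rw [FormalMap.jac_ofMatrix, jac_hatMap] at hDd
  set δ : I → ℂ := fun j => constantCoeff (p j) with hδ
  have hqδ : (fun j => constantCoeff (q j)) = δ := by
    funext j
    have h1 := congrFun (congrFun hDT (Sum.inl j)) (Sum.inr j)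
    have h2 : (hatTau L).jac (Sum.inl j) (Sum.inr j) = lam j := by
      change coeff _ (ofProd (L j) * X (Sum.inr j)) = _
      rw [coeff_single_mul_X, constantCoeff_ofProd, hL, Matrix.one_apply_eq, mul_one]
    rw [hDd, Matrix.diagonal_mul, Matrix.mul_diagonal, h2, mul_comm] at h1
    exact (mul_left_cancel₀ (hlam j) h1).symm
  rw [hqδ] at hDd
  have hSD : (straighten L).jac * D = D * (straighten L).jac := by
    rw [hDd]
    ext i k
    rw [Matrix.mul_diagonal, Matrix.diagonal_mul]
    rcases i with j | j
    · rw [jac_straighten_inl]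
      rcases k with k | k <;> by_cases h : j = k <;> simp [Matrix.one_apply, h, mul_comm]
    · rw [jac_straighten_inr]
      rcases k with k | k <;> by_cases h : j = k <;> simp [Matrix.one_apply, h, mul_comm]
  have hYj : (Y : FormalMap (I ⊕ I)).jac * (b : Matrix _ _ ℂ) * (θ : Matrix _ _ ℂ) = (straighten L).jac := by
    rw [hb, hθ, ← FormalMap.jac_mul, ← FormalMap.jac_mul, mul_assoc, ← Units.val_mul, hY]
  have hYP : (Y : FormalMap (I ⊕ I)).jac * Matrix.diagonal (Sum.elim d d) =
      D * (Y : FormalMap (I ⊕ I)).jac := by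
    rw [← Units.mul_left_inj b, ← Units.mul_left_inj θ]
    calc (Y : FormalMap (I ⊕ I)).jac * Matrix.diagonal (Sum.elim d d) * (b : Matrix _ _ ℂ) * (θ : Matrix _ _ ℂ)
        = (Y : FormalMap (I ⊕ I)).jac * (Matrix.diagonal (Sum.elim d d) * (b : Matrix _ _ ℂ)) * (θ : Matrix _ _ ℂ) := by
          simp only [mul_assoc]
      _ = (Y : FormalMap (I ⊕ I)).jac * (b : Matrix _ _ ℂ) * (P * (θ : Matrix _ _ ℂ)) := by
          rw [← hP]
          simp only [P, mul_assoc]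
      _ = (Y : FormalMap (I ⊕ I)).jac * (b : Matrix _ _ ℂ) * (θ : Matrix _ _ ℂ) * D := by
          rw [← hθD]
          simp only [mul_assoc]
      _ = D * (Y : FormalMap (I ⊕ I)).jac * (b : Matrix _ _ ℂ) * (θ : Matrix _ _ ℂ) := by
          rw [hYj, hSD, ← hYj]
          simp only [mul_assoc]
  -- A nonzero entry requires matching labels. As the labels `d` are distinct, each row has at most
  -- one nonzero entry per block, the monomial shape required by `folds_of_monomial`.
  have hentry : ∀ i k, (Y : FormalMap (I ⊕ I)).jac i k ≠ 0 →
      (Sum.elim d d : I ⊕ I → ℂ) k = (Sum.elim δ δ : I ⊕ I → ℂ) i := by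
    intro i k hne
    have h1 := congrFun (congrFun hYP i) k
    rw [hDd, Matrix.mul_diagonal, Matrix.diagonal_mul, mul_comm] at h1
    exact mul_right_cancel₀ hne h1
  have hYZ : (Y : FormalMap (I ⊕ I)) * flip Finset.univ =
      flip Finset.univ * (Y : FormalMap (I ⊕ I)) := by
    rw [← Units.mul_left_inj B, ← Units.mul_left_inj Θ, mul_assoc (Y : FormalMap (I ⊕ I)), ← hBτ]
    calc (Y : FormalMap (I ⊕ I)) * ((B : FormalMap (I ⊕ I)) * τ) * (Θ : FormalMap (I ⊕ I))
        = (Y : FormalMap (I ⊕ I)) * (B : FormalMap (I ⊕ I)) * (τ * (Θ : FormalMap (I ⊕ I))) := by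
          simp only [mul_assoc]
      _ = (Y : FormalMap (I ⊕ I)) * (B * Θ : (FormalMap (I ⊕ I))ˣ) * hatTau L := by
          rw [hΘτ, Units.val_mul]
          simp only [mul_assoc]
      _ = flip Finset.univ * (Y : FormalMap (I ⊕ I)) * (B : FormalMap (I ⊕ I)) * (Θ : FormalMap (I ⊕ I)) := by
          rw [hY, straighten_mul_hatTau hL0, ← hY, Units.val_mul]
          simp only [mul_assoc]
  have hYZj : ∀ i k, (Y : FormalMap (I ⊕ I)).jac i k *
      (Sum.elim 1 (fun _ => -1) : I ⊕ I → ℂ) k =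
      (Sum.elim 1 (fun _ => -1) : I ⊕ I → ℂ) i * (Y : FormalMap (I ⊕ I)).jac i k := by
    intro i k
    have h1 := congrFun (congrFun (congrArg FormalMap.jac hYZ) i) k
    rw [FormalMap.jac_mul, FormalMap.jac_mul, jac_flip, Matrix.mul_diagonal,
      Matrix.diagonal_mul] at h1
    simpa using h1
  have hlinj : (Y : FormalMap (I ⊕ I)).linPart.jac = (Y : FormalMap (I ⊕ I)).jac := by
    rw [FormalMap.linPart_eq, FormalMap.jac_ofMatrix]
  refine folds_of_monomial ?_ ?_ ?_ ?_ ?_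
  · rw [FormalMap.isUnit_iff_jac, hlinj, ← FormalMap.isUnit_iff_jac]
    exact Y.isUnit
  · rw [FormalMap.linPart_eq (Y : FormalMap (I ⊕ I)), FormalMap.linPart_ofMatrix]
  · intro j k
    rw [hlinj]
    have := hYZj (Sum.inl j) (Sum.inr k)
    simp only [Sum.elim_inl, Sum.elim_inr, Pi.one_apply] at this
    linear_combination (-1 / 2) * this
  · intro j k
    rw [hlinj]
    have := hYZj (Sum.inr j) (Sum.inl k)
    simp only [Sum.elim_inl, Sum.elim_inr, Pi.one_apply] at this
    linear_combination (1 / 2) * this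
  · intro j k l hkl
    rw [hlinj]
    by_contra hne
    have h1 := hentry _ _ (left_ne_zero_of_mul hne)
    have h2 := hentry _ _ (right_ne_zero_of_mul hne)
    exact hkl (hd (h1.trans h2.symm))

end Shear

/-! ### The product quadric as a sum of squares. -/

section Quadric

variable {e h s : ℕ}

theorem idxPerm_involutive : Function.Involutive (idxPerm (e := e) (h := h) (s := s)) := by
  rintro (k | k | k | k) <;> rfl

/-- For Bishop quadrics one completes the square in w, with α = 1/(2γ) and remainder (γ - 1/(4γ))
z². The others are squares already, and the coefficient of w is pulled out; it is nonzero because Im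
γ_s > 0 and Re γ_s < 1/2. -/
theorem QuadricInvariants.exists_eq (g : QuadricInvariants e h s) (j : Idx e h s) :
    ∃ c α d : ℂ, c ≠ 0 ∧ g.quadric j =
      C c * (X (Sum.inr (idxPerm j)) + C α * X (Sum.inl j)) ^ 2 + C d * X (Sum.inl j) ^ 2 := by
  have hbishop : ∀ (γ : ℂ) (z w : MvPowerSeries (Idx e h s ⊕ Idx e h s) ℂ), γ ≠ 0 →
      z * w + C γ * (z ^ 2 + w ^ 2) =
        C γ * (w + C (1 / (2 * γ)) * z) ^ 2 + C (γ - 1 / (4 * γ)) * z ^ 2 := by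
    intro γ z w hγ
    have h1 : C γ * C (1 / (2 * γ)) * 2 = (1 : MvPowerSeries (Idx e h s ⊕ Idx e h s) ℂ) := by
      rw [← map_ofNat (C (σ := Idx e h s ⊕ Idx e h s) (R := ℂ)), ← map_mul, ← map_mul,
        ← map_one C]
      congr 1
      field_simp
    have h2 : (C (γ - 1 / (4 * γ)) : MvPowerSeries (Idx e h s ⊕ Idx e h s) ℂ) =
        C γ - C γ * C (1 / (2 * γ)) ^ 2 := by
      rw [← map_pow, ← map_mul, ← map_sub]
      congr 1
      field_simp
      ring
    rw [h2]
    linear_combination (- z * w) * h1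
  have hsq : ∀ (γ : ℂ) (z w : MvPowerSeries (Idx e h s ⊕ Idx e h s) ℂ), γ ≠ 0 →
      (z + C γ * w) ^ 2 = C (γ ^ 2) * (w + C (1 / γ) * z) ^ 2 + C 0 * z ^ 2 := by
    intro γ z w hγ
    have h1 : C γ * C (1 / γ) = (1 : MvPowerSeries (Idx e h s ⊕ Idx e h s) ℂ) := by
      rw [← map_mul, ← map_one C]
      congr 1
      field_simp
    rw [map_pow, map_zero, zero_mul, add_zero, ← mul_pow, mul_add, ← mul_assoc, h1, one_mul,
      add_comm]
  rcases j with k | k | k | k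
  · have hγ : (g.ell k : ℂ) ≠ 0 := Complex.ofReal_ne_zero.2 (g.ell_pos k).ne'
    exact ⟨_, _, _, hγ, hbishop _ _ _ hγ⟩
  · have hγ : (g.hyp k : ℂ) ≠ 0 :=
      Complex.ofReal_ne_zero.2 ((by norm_num : (0 : ℝ) < 1 / 2).trans (g.hyp_gt k)).ne'
    exact ⟨_, _, _, hγ, hbishop _ _ _ hγ⟩
  · have hγ : 2 * g.cpx k ≠ 0 := by
      refine mul_ne_zero two_ne_zero fun h0 => ?_
      have := g.cpx_im k
      rw [h0] at this
      simp at this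
    exact ⟨_, _, _, pow_ne_zero 2 hγ, hsq _ _ _ hγ⟩
  · have hγ : 2 * (1 - starRingEnd ℂ (g.cpx k)) ≠ 0 := by
      refine mul_ne_zero two_ne_zero fun h0 => ?_
      have := g.cpx_re k
      have h1 := congrArg Complex.re h0
      simp at h1
      linarith
    exact ⟨_, _, _, pow_ne_zero 2 hγ, hsq _ _ _ hγ⟩

theorem QuadricInvariants.constantCoeff_of_perturbation {g : QuadricInvariants e h s}
    {E : Idx e h s → MvPowerSeries (Idx e h s ⊕ Idx e h s) ℂ}
    (hEQ : IsHigherOrderPerturbation E g.quadric) (j : Idx e h s) :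
    constantCoeff (E j) = 0 := by
  obtain ⟨c, α, d, -, hq⟩ := g.exists_eq j
  rw [← coeff_zero_eq_constantCoeff_apply, hEQ j 0 (by simp), hq,
    coeff_zero_eq_constantCoeff_apply]
  simp

end Quadric

/-! ### Factorization into a complement factor and a descending map. -/

section Complement

variable {I : Type} [Fintype I] [DecidableEq I]

theorem evenPart_mapR_mul (ε : I → ℂ) (F : FormalMap (I ⊕ I)) :
    evenPart (mapR ε * F) = mapR ε * evenPart F := by
  classical
  ext1
  funext i
  ext n
  rw [mapR_eq, coeff_evenPart, diagMap_mul_comp, diagMap_mul_comp, coeff_C_mul, coeff_C_mul,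
    coeff_evenPart, mul_ite, mul_zero]

/-- `R_ε` as an invertible map. -/
def signUnit (ε : I → ℂ) (hε : ∀ j, ε j = 1 ∨ ε j = -1) : (FormalMap (I ⊕ I))ˣ :=
  ⟨mapR ε, mapR ε, mapR_mul_self hε, mapR_mul_self hε⟩

variable {ε : I → ℂ}

theorem val_signUnit (hε : ∀ j, ε j = 1 ∨ ε j = -1) :
    (signUnit ε hε : FormalMap (I ⊕ I)) = mapR ε := rfl

theorem inv_signUnit (hε : ∀ j, ε j = 1 ∨ ε j = -1) : (signUnit ε hε)⁻¹ = signUnit ε hε := rfl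

theorem folds_signUnit (hε : ∀ j, ε j = 1 ∨ ε j = -1) :
    Folds (signUnit ε hε : FormalMap (I ⊕ I)) :=
  ⟨⟨mapL ε, mapL ε, mapL_mul_self hε, mapL_mul_self hε⟩, mapL_mul_sqMap hε⟩

theorem IsComplementZ.conj_signUnit (hε : ∀ j, ε j = 1 ∨ ε j = -1) {φ : FormalMap (I ⊕ I)}
    (hφ : IsComplementZ φ) : IsComplementZ (mapR ε * φ * mapR ε) := by
  rw [isComplementZ_iff] at hφ ⊢
  constructor
  · rw [FormalMap.jac_mul, FormalMap.jac_mul, hφ.1, mul_one, ← FormalMap.jac_mul,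
      mapR_mul_self hε, FormalMap.jac_one]
  · rw [evenPart_mul _ (signEquivariant_mapR ε), evenPart_mapR_mul, hφ.2, mul_one,
      mapR_mul_self hε]

theorem FormalMap.jac_units_inv {V : Type} [Fintype V] [DecidableEq V] {u : (FormalMap V)ˣ}
    (hu : (u : FormalMap V).jac = 1) : ((u⁻¹ : (FormalMap V)ˣ) : FormalMap V).jac = 1 := by
  have := congrArg FormalMap.jac (Units.inv_mul u)
  rwa [FormalMap.jac_mul, hu, mul_one, FormalMap.jac_one] at this

/-- Uniqueness of the complement factor. -/
theorem eq_of_folds (hε : ∀ j, ε j = 1 ∨ ε j = -1) {φ φ' : (FormalMap (I ⊕ I))ˣ}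
    (hφ : IsComplementZ (φ : FormalMap (I ⊕ I))) (hφ' : IsComplementZ (φ' : FormalMap (I ⊕ I)))
    (h : Folds ((φ'⁻¹ * signUnit ε hε * φ : (FormalMap (I ⊕ I))ˣ) : FormalMap (I ⊕ I))) :
    φ' = signUnit ε hε * φ * signUnit ε hε := by
  set R := signUnit ε hε
  have hc : IsComplementZ ((R * φ * R : (FormalMap (I ⊕ I))ˣ) : FormalMap (I ⊕ I)) :=
    hφ.conj_signUnit hε
  rw [isComplementZ_iff] at hc hφ'
  -- `G` descends and is tangent to the identity, so it commutes with all sign changes. Applying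
  -- `evenPart` to φ' G = R φ R gives G on the left and the identity on the right.
  set G : (FormalMap (I ⊕ I))ˣ := φ'⁻¹ * (R * φ * R) with hG
  have hGj : (G : FormalMap (I ⊕ I)).jac = 1 := by
    rw [hG, Units.val_mul, FormalMap.jac_mul, hc.1, FormalMap.jac_units_inv hφ'.1, one_mul]
  have hGf : Folds (G : FormalMap (I ⊕ I)) := by
    have : G = φ'⁻¹ * R * φ * R := by rw [hG]; group
    rw [this]
    exact h.mul (folds_signUnit hε)
  have h1 : φ' * G = R * φ * R := by rw [hG]; group
  have h2 : evenPart ((R * φ * R : (FormalMap (I ⊕ I))ˣ) : FormalMap (I ⊕ I)) = 1 := hc.2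
  rw [← h1, Units.val_mul, evenPart_mul _ (hGf.signEquivariant hGj), hφ'.2, one_mul] at h2
  have h3 : G = 1 := Units.ext h2
  rw [← h1, h3, mul_one]

/-- A map whose linear part folds is a complement factor times a map that folds. -/
theorem exists_complement_mul_folds {Y : (FormalMap (I ⊕ I))ˣ}
    (hY : Folds (Y : FormalMap (I ⊕ I)).linPart) :
    ∃ φ H : (FormalMap (I ⊕ I))ˣ, IsComplementZ (φ : FormalMap (I ⊕ I)) ∧
      Folds (H : FormalMap (I ⊕ I)) ∧ Y = φ * H := by
  obtain ⟨P, hP⟩ := hY.isUnit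
  rw [← hP] at hY
  have hPj : (P : FormalMap (I ⊕ I)).jac = (Y : FormalMap (I ⊕ I)).jac := by
    rw [hP, FormalMap.linPart_eq, FormalMap.jac_ofMatrix]
  have hj : ((Y * P⁻¹ : (FormalMap (I ⊕ I))ˣ) : FormalMap (I ⊕ I)).jac = 1 := by
    rw [Units.val_mul, FormalMap.jac_mul, ← hPj, ← FormalMap.jac_mul, Units.mul_inv,
      FormalMap.jac_one]
  -- Here N = evenPart(Y P⁻¹), so dividing by it on the right leaves a map with even part N N⁻¹ = 1.
  obtain ⟨N, hN⟩ := FormalMap.isUnit_of_jac_eq_one (jac_evenPart hj)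
  have hNe : SignEquivariant (N : FormalMap (I ⊕ I)) := hN ▸ signEquivariant_evenPart _
  refine ⟨Y * P⁻¹ * N⁻¹, N * P, ?_, hNe.folds.mul hY, by group⟩
  rw [isComplementZ_iff]
  constructor
  · rw [Units.val_mul, FormalMap.jac_mul, hj, FormalMap.jac_units_inv, mul_one]
    rw [hN, jac_evenPart hj]
  · rw [Units.val_mul, evenPart_mul _ hNe.inv, ← hN, Units.mul_inv]

end Complement

/-! ### Equivalences with normal forms and their automorphisms. -/

section Equivalence

variable {e h s : ℕ}

/-- The complexification of the submanifold as a composition of invertible maps and `sqMap`, in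
coordinates in which `τ₁` is `τ̂₁` and `ρ₀` is `ρ`. -/
structure FoldCoordinates (E : Idx e h s → MvPowerSeries (Idx e h s ⊕ Idx e h s) ℂ)
    (h0 : ∀ j, constantCoeff (E j) = 0) (L : Idx e h s → MvPowerSeries (Idx e h s) ℂ) where
  outer : (FormalMap (Idx e h s ⊕ Idx e h s))ˣ
  fold : (FormalMap (Idx e h s ⊕ Idx e h s))ˣ
  coord : (FormalMap (Idx e h s ⊕ Idx e h s))ˣ
  graph : graphMap E h0 = (outer : FormalMap (Idx e h s ⊕ Idx e h s)) * sqMap *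
    (fold : FormalMap (Idx e h s ⊕ Idx e h s))
  real : FormalMap.conjBy Sum.swap rhoPerm (coord : FormalMap (Idx e h s ⊕ Idx e h s)) = coord
  tau : ((fold * coord : (FormalMap (Idx e h s ⊕ Idx e h s))ˣ) :
      FormalMap (Idx e h s ⊕ Idx e h s)) * hatTau L = flip Finset.univ *
    ((fold * coord : (FormalMap (Idx e h s ⊕ Idx e h s))ˣ) : FormalMap (Idx e h s ⊕ Idx e h s))

variable {lam : Idx e h s → ℂ} {M L : Idx e h s → MvPowerSeries (Idx e h s) ℂ}
  {S Ψ Ψ' : (FormalMap (Idx e h s ⊕ Idx e h s))ˣ}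

theorem commute_straighten_conj (hL : ∀ j, constantCoeff (L j) ≠ 0)
    (hS : (S : FormalMap (Idx e h s ⊕ Idx e h s)) = straighten L)
    (T : FormalMap (Idx e h s ⊕ Idx e h s)) :
    Commute T (hatTau L) ↔ Commute ((S : FormalMap (Idx e h s ⊕ Idx e h s)) * T *
      ((S⁻¹ : (FormalMap (Idx e h s ⊕ Idx e h s))ˣ) : FormalMap (Idx e h s ⊕ Idx e h s)))
      (flip Finset.univ) := by
  have h1 : (S : FormalMap (Idx e h s ⊕ Idx e h s)) * hatTau L =
      flip Finset.univ * (S : FormalMap (Idx e h s ⊕ Idx e h s)) := by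
    rw [hS, straighten_mul_hatTau hL]
  have h2 : ((S⁻¹ : (FormalMap (Idx e h s ⊕ Idx e h s))ˣ) : FormalMap (Idx e h s ⊕ Idx e h s)) *
      flip Finset.univ = hatTau L * ((S⁻¹ : (FormalMap (Idx e h s ⊕ Idx e h s))ˣ) :
        FormalMap (Idx e h s ⊕ Idx e h s)) := by
    rw [← Units.mul_right_inj S, ← mul_assoc, Units.mul_inv, one_mul, ← mul_assoc, h1, mul_assoc,
      Units.mul_inv, mul_one]
  rw [Commute, SemiconjBy, Commute, SemiconjBy, mul_assoc _ _ (flip _), h2, ← mul_assoc (flip _),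
    ← mul_assoc (flip _), ← h1, ← mul_assoc, Units.mul_left_inj, mul_assoc, mul_assoc,
    Units.mul_right_inj]

theorem IsNormalizedPsi.isComplementZ (hS : (S : FormalMap (Idx e h s ⊕ Idx e h s)) = straighten L)
    (hΨ : IsNormalizedPsi L Ψ) : IsComplementZ ((S * Ψ * S⁻¹ :
      (FormalMap (Idx e h s ⊕ Idx e h s))ˣ) : FormalMap (Idx e h s ⊕ Idx e h s)) := by
  obtain ⟨-, -, φ, hφ, he⟩ := hΨ
  have : ((S * Ψ * S⁻¹ : (FormalMap (Idx e h s ⊕ Idx e h s))ˣ) :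
      FormalMap (Idx e h s ⊕ Idx e h s)) = φ := by
    rw [Units.val_mul, Units.val_mul, hS, he, ← hS, mul_assoc, Units.mul_inv, mul_one]
  rwa [this]

/-- Conjugation by S carries τ̂₁ to the simultaneous sign change, so normalized Ψ correspond to
complement factors φ = S Ψ S⁻¹ commuting with that sign change. -/
theorem isNormalizedPsi_of_isComplementZ (hL : ∀ j, constantCoeff (L j) ≠ 0)
    (hS : (S : FormalMap (Idx e h s ⊕ Idx e h s)) = straighten L)
    {φ : (FormalMap (Idx e h s ⊕ Idx e h s))ˣ}
    (hφ : IsComplementZ (φ : FormalMap (Idx e h s ⊕ Idx e h s)))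
    (hc : Commute (φ : FormalMap (Idx e h s ⊕ Idx e h s)) (flip Finset.univ)) :
    IsNormalizedPsi L (S⁻¹ * φ * S) := by
  have he : S * (S⁻¹ * φ * S) = φ * S := by group
  refine ⟨?_, ?_, φ, hφ, ?_⟩
  · rw [FormalMap.TangentToId, Units.val_mul, Units.val_mul, FormalMap.jac_mul, FormalMap.jac_mul,
      (isComplementZ_iff.1 hφ).1, mul_one, ← FormalMap.jac_mul, Units.inv_mul, FormalMap.jac_one]
  · rw [commute_straighten_conj hL hS, ← Units.val_mul, he, Units.val_mul, mul_assoc,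
      Units.mul_inv, mul_one]
    exact hc
  · rw [← hS, ← Units.val_mul, he, Units.val_mul]

namespace SigmaData

variable {E : Idx e h s → MvPowerSeries (Idx e h s ⊕ Idx e h s) ℂ}
  {h0 : ∀ j, constantCoeff (E j) = 0}

/-- The maps from `M` to a normal form. -/
theorem mapsManifold_normalE_iff (hd : SigmaData lam M L)
    (hR : rhoConj (hatTau L) = hatTau L * hatSigma M)
    (hS : (S : FormalMap (Idx e h s ⊕ Idx e h s)) = straighten L) (hΨ : IsNormalizedPsi L Ψ)
    (P : FoldCoordinates E h0 L) (F : (FormalMap (Idx e h s ⊕ Idx e h s))ˣ) :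
    MapsManifold (F : FormalMap (Idx e h s ⊕ Idx e h s)) E (normalE lam L Ψ) ↔
      ∃ (ε : Idx e h s → ℂ) (hε : IsRealSign ε),
        F.val * P.outer.val * sqMap =
          sqMap * ((S * Ψ⁻¹ * signUnit ε hε.1 * (P.fold * P.coord)⁻¹ :
            (FormalMap (Idx e h s ⊕ Idx e h s))ˣ) : FormalMap (Idx e h s ⊕ Idx e h s)) := by
  obtain ⟨Φ, hΦ⟩ := isUnit_normalPhi hd.lam_norm hd.nonres hd.L_zero hΨ.1
  have hgr := graphMap_normalE hd.lam_norm.ne_zero Φ hΦ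
  have hΦρ : FormalMap.conjBy Sum.swap rhoPerm (Φ : FormalMap (Idx e h s ⊕ Idx e h s)) = Φ := by
    rw [hΦ, conjBy_normalPhi hd.lam_norm.ne_zero]
  rw [← hS, ← Units.val_mul] at hgr
  rw [mapsManifold_iff h0 (constantCoeff_normalE hd.lam_norm.ne_zero Ψ)]
  constructor
  · rintro ⟨T₀, hT₀, hF⟩
    -- `T` is the map of complexifications in the coordinates where the antiholomorphic involution
    -- is ρ on both sides.
    obtain ⟨T, hΦT⟩ : ∃ T : FormalMap (Idx e h s ⊕ Idx e h s),
        Φ.val * T = T₀ * P.coord.val :=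
      ⟨Φ⁻¹.val * (T₀ * P.coord.val), by rw [← mul_assoc, Units.mul_inv, one_mul]⟩
    have h1 : F.val * P.outer.val * sqMap * (P.fold * P.coord).val =
        sqMap * ((S * Ψ⁻¹).val * T) := by
      calc F.val * P.outer.val * sqMap * (P.fold * P.coord).val
          = F.val * (P.outer.val * sqMap * P.fold.val) * P.coord.val := by
            rw [Units.val_mul]
            simp only [mul_assoc]
        _ = sqMap * ((S * Ψ⁻¹).val * T) := by
            rw [← P.graph, hF, mul_assoc, ← hΦT, ← mul_assoc, hgr, mul_assoc]
    -- `H` descends to the invertible map F ∘ outer and is itself invertible by `Folds.isUnit`. This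
    -- is where the invertibility of `T` comes from.
    obtain ⟨H, hH⟩ : ∃ H, H = (S * Ψ⁻¹).val * T * (P.fold * P.coord)⁻¹.val := ⟨_, rfl⟩
    have h2 : ((F * P.outer : (FormalMap _)ˣ) : FormalMap (Idx e h s ⊕ Idx e h s)) * sqMap =
        sqMap * H := by
      rw [hH, ← mul_assoc, ← h1, mul_assoc, Units.mul_inv, mul_one, Units.val_mul]
    have hHf : Folds H := ⟨F * P.outer, h2⟩
    obtain ⟨H', hH'⟩ := hHf.isUnit
    have hHK : H * ((P.fold * P.coord : (FormalMap _)ˣ) : FormalMap (Idx e h s ⊕ Idx e h s)) =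
        ((S * Ψ⁻¹ : (FormalMap _)ˣ) : FormalMap (Idx e h s ⊕ Idx e h s)) * T := by
      rw [hH, mul_assoc, Units.inv_mul, mul_one]
    have hTu : IsUnit T := by
      have : T = (((S * Ψ⁻¹)⁻¹ * H' * (P.fold * P.coord) : (FormalMap _)ˣ) :
          FormalMap (Idx e h s ⊕ Idx e h s)) := by
        rw [mul_assoc, Units.val_mul, Units.val_mul, hH', hHK, ← mul_assoc, Units.inv_mul, one_mul]
      rw [this]
      exact Units.isUnit _
    have hTρ : rhoConj T = T := by
      have h3 := congrArg (FormalMap.conjBy Sum.swap rhoPerm) hΦT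
      rw [← FormalMap.conjBy_mul rhoPerm_involutive, hΦρ, ← FormalMap.conjBy_mul swap_involutive,
        hT₀, P.real, ← hΦT, Units.mul_right_inj] at h3
      exact h3
    have hSτ : (S : FormalMap (Idx e h s ⊕ Idx e h s)) * hatTau L =
        flip Finset.univ * (S : FormalMap (Idx e h s ⊕ Idx e h s)) := by
      rw [hS, straighten_mul_hatTau hd.L_ne]
    have hΨτ : ((Ψ⁻¹ : (FormalMap _)ˣ) : FormalMap (Idx e h s ⊕ Idx e h s)) * hatTau L =
        hatTau L * ((Ψ⁻¹ : (FormalMap _)ˣ) : FormalMap (Idx e h s ⊕ Idx e h s)) :=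
      hΨ.2.1.units_inv_left
    have hGτ : flip Finset.univ * (S * Ψ⁻¹).val = (S * Ψ⁻¹).val * hatTau L := by
      rw [Units.val_mul, ← mul_assoc, ← hSτ, mul_assoc, mul_assoc, hΨτ]
    -- `H` commutes with the simultaneous sign change, which becomes τ̂₁ when pulled back by K at
    -- the source and by S Ψ⁻¹ at the target.
    have hTτ : Commute T (hatTau L) := by
      rw [Commute, SemiconjBy, ← Units.mul_right_inj (S * Ψ⁻¹)]
      calc (S * Ψ⁻¹).val * (T * hatTau L) = (S * Ψ⁻¹).val * T * hatTau L := by rw [mul_assoc]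
        _ = H * flip Finset.univ * (P.fold * P.coord).val := by
            rw [← hHK, mul_assoc, P.tau, mul_assoc]
        _ = flip Finset.univ * ((S * Ψ⁻¹).val * T) := by
            rw [hHf.commute_flip_univ.eq, mul_assoc, hHK]
        _ = (S * Ψ⁻¹).val * (hatTau L * T) := by rw [← mul_assoc, hGτ, mul_assoc]
    obtain ⟨ε, hε, hTε⟩ := hd.eq_mapR hR hTu hTρ hTτ
    refine ⟨ε, hε, ?_⟩
    rw [← Units.val_mul F, h2, hH, hTε, Units.val_mul (S * Ψ⁻¹ * signUnit ε hε.1),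
      Units.val_mul (S * Ψ⁻¹), val_signUnit]
  · rintro ⟨ε, hε, hF⟩
    set R := signUnit ε hε.1 with hRdef
    set T₀ : (FormalMap (Idx e h s ⊕ Idx e h s))ˣ := Φ * R * P.coord⁻¹ with hT₀
    have hTΘ : T₀.val * P.coord.val = Φ.val * R.val := by
      rw [← Units.val_mul, ← Units.val_mul, hT₀]
      congr 1
      group
    refine ⟨T₀, ?_, ?_⟩
    · have h3 := congrArg (FormalMap.conjBy Sum.swap rhoPerm) hTΘ
      have h4 : FormalMap.conjBy rhoPerm rhoPerm (R : FormalMap (Idx e h s ⊕ Idx e h s)) = R :=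
        rhoConj_mapR hε
      rw [← FormalMap.conjBy_mul rhoPerm_involutive Φ.val, hΦρ, h4, ← hTΘ,
        ← FormalMap.conjBy_mul swap_involutive, P.real, Units.mul_left_inj] at h3
      exact h3
    · rw [P.graph, ← mul_assoc, ← mul_assoc, hF, mul_assoc, ← Units.val_mul]
      have h5 : S * Ψ⁻¹ * R * (P.fold * P.coord)⁻¹ * P.fold = S * Ψ⁻¹ * (Φ⁻¹ * T₀) := by
        rw [hT₀]
        group
      have h6 : T₀.val = Φ.val * (Φ⁻¹ * T₀).val := by
        rw [← Units.val_mul, mul_inv_cancel_left]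
      rw [h5, h6, ← mul_assoc (graphMap _ _), hgr, Units.val_mul (S * Ψ⁻¹), mul_assoc]

/-- The outer factor of the projection is invertible and can be absorbed into the equivalence,
leaving a condition on the inner map alone. -/
theorem formallyEquivalent_normalE_iff (hd : SigmaData lam M L)
    (hR : rhoConj (hatTau L) = hatTau L * hatSigma M)
    (hS : (S : FormalMap (Idx e h s ⊕ Idx e h s)) = straighten L) (hΨ : IsNormalizedPsi L Ψ)
    (P : FoldCoordinates E h0 L) :
    FormallyEquivalent E (normalE lam L Ψ) ↔
      ∃ (ε : Idx e h s → ℂ) (hε : IsRealSign ε),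
        Folds ((S * Ψ⁻¹ * signUnit ε hε.1 * (P.fold * P.coord)⁻¹ :
            (FormalMap (Idx e h s ⊕ Idx e h s))ˣ) : FormalMap (Idx e h s ⊕ Idx e h s)) := by
  constructor
  · rintro ⟨F, hF⟩
    obtain ⟨ε, hε, h1⟩ := (hd.mapsManifold_normalE_iff hR hS hΨ P F).1 hF
    exact ⟨ε, hε, F * P.outer, h1⟩
  · rintro ⟨ε, hε, F, hF⟩
    refine ⟨F * P.outer⁻¹, (hd.mapsManifold_normalE_iff hR hS hΨ P _).2 ⟨ε, hε, ?_⟩⟩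
    rw [← Units.val_mul, inv_mul_cancel_right, hF]

/-- Factor Y = S K⁻¹ as φ H and put Ψ = S⁻¹ φ S. Then S Ψ⁻¹ K⁻¹ = φ⁻¹ Y = H descends, with all signs
equal to 1. Both Y and H commute with the simultaneous sign change, hence so does φ. -/
theorem exists_normalized (hd : SigmaData lam M L)
    (hR : rhoConj (hatTau L) = hatTau L * hatSigma M)
    (hS : (S : FormalMap (Idx e h s ⊕ Idx e h s)) = straighten L)
    (P : FoldCoordinates E h0 L)
    (hP : Folds ((S * (P.fold * P.coord)⁻¹ : (FormalMap (Idx e h s ⊕ Idx e h s))ˣ) :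
      FormalMap (Idx e h s ⊕ Idx e h s)).linPart) :
    ∃ Ψ, IsNormalizedPsi L Ψ ∧ FormallyEquivalent E (normalE lam L Ψ) := by
  obtain ⟨φ, H, hφ, hH, hY⟩ := exists_complement_mul_folds hP
  have hSτ : (S : FormalMap (Idx e h s ⊕ Idx e h s)) * hatTau L =
      flip Finset.univ * (S : FormalMap (Idx e h s ⊕ Idx e h s)) := by
    rw [hS, straighten_mul_hatTau hd.L_ne]
  have hYz : Commute ((S * (P.fold * P.coord)⁻¹ : (FormalMap (Idx e h s ⊕ Idx e h s))ˣ) :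
      FormalMap (Idx e h s ⊕ Idx e h s)) (flip Finset.univ) := by
    rw [Commute, SemiconjBy, ← Units.mul_left_inj (P.fold * P.coord), mul_assoc, ← P.tau,
      ← mul_assoc, ← Units.val_mul, inv_mul_cancel_right, hSτ, mul_assoc, ← Units.val_mul,
      inv_mul_cancel_right]
  have hφz : Commute (φ : FormalMap (Idx e h s ⊕ Idx e h s)) (flip Finset.univ) := by
    have h1 : φ = S * (P.fold * P.coord)⁻¹ * H⁻¹ := by rw [hY]; group
    rw [h1, Units.val_mul]
    exact hYz.mul_left hH.commute_flip_univ.units_inv_left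
  have hΨ := isNormalizedPsi_of_isComplementZ hd.L_ne hS hφ hφz
  refine ⟨_, hΨ, (hd.formallyEquivalent_normalE_iff hR hS hΨ P).2
    ⟨1, ⟨fun _ => Or.inl rfl, fun _ => rfl⟩, ?_⟩⟩
  have h1 : signUnit (1 : Idx e h s → ℂ) (fun _ => Or.inl rfl) = 1 := by
    ext1
    change mapR 1 = 1
    rw [mapR_eq, ← diagMap_one]
    congr 1
    funext i
    rcases i with i | i <;> rfl
  have h2 : S * (S⁻¹ * φ * S)⁻¹ * 1 * (P.fold * P.coord)⁻¹ = φ⁻¹ * (S * (P.fold * P.coord)⁻¹) := by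
    group
  rw [h1, h2, hY, inv_mul_cancel_left]
  exact hH

theorem isRealSign_mul {ε δ : Idx e h s → ℂ} (hε : IsRealSign ε) (hδ : IsRealSign δ) :
    IsRealSign (ε * δ) := by
  refine ⟨fun j => ?_, fun k => ?_⟩
  · rw [Pi.mul_apply]
    rcases hε.1 j with h1 | h1 <;> rcases hδ.1 j with h2 | h2 <;> simp [h1, h2]
  · rw [Pi.mul_apply, Pi.mul_apply, hε.2, hδ.2]

theorem signUnit_mul {ε δ : Idx e h s → ℂ} (hε : IsRealSign ε) (hδ : IsRealSign δ) :
    signUnit ε hε.1 * signUnit δ hδ.1 = signUnit (ε * δ) (isRealSign_mul hε hδ).1 :=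
  Units.ext (mapR_mul ε δ)

theorem commute_signUnit (hS : (S : FormalMap (Idx e h s ⊕ Idx e h s)) = straighten L)
    {ε : Idx e h s → ℂ} (hε : IsRealSign ε) : S * signUnit ε hε.1 = signUnit ε hε.1 * S := by
  ext1
  rw [Units.val_mul, Units.val_mul, hS]
  exact straighten_mul_mapR L hε.1

theorem signUnit_mul_self {ε : Idx e h s → ℂ} (hε : IsRealSign ε) :
    signUnit ε hε.1 * signUnit ε hε.1 = 1 := Units.ext (mapR_mul_self hε.1)

/-- Two normal forms with a common source. -/
theorem eq_of_folds_both (hS : (S : FormalMap (Idx e h s ⊕ Idx e h s)) = straighten L)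
    (hΨ : IsNormalizedPsi L Ψ) (hΨ' : IsNormalizedPsi L Ψ') {ε ε' : Idx e h s → ℂ}
    (hε : IsRealSign ε) (hε' : IsRealSign ε') {K : (FormalMap (Idx e h s ⊕ Idx e h s))ˣ}
    (h1 : Folds ((S * Ψ⁻¹ * signUnit ε hε.1 * K⁻¹ : (FormalMap (Idx e h s ⊕ Idx e h s))ˣ) :
      FormalMap (Idx e h s ⊕ Idx e h s)))
    (h2 : Folds ((S * Ψ'⁻¹ * signUnit ε' hε'.1 * K⁻¹ : (FormalMap (Idx e h s ⊕ Idx e h s))ˣ) :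
      FormalMap (Idx e h s ⊕ Idx e h s))) :
    Ψ' = signUnit (ε' * ε) (isRealSign_mul hε' hε).1 * Ψ *
      signUnit (ε' * ε) (isRealSign_mul hε' hε).1 := by
  have h3 := h2.mul h1.inv
  rw [← Units.val_mul] at h3
  set R := signUnit (ε' * ε) (isRealSign_mul hε' hε).1 with hR
  have hSR : S * R = R * S := commute_signUnit hS (isRealSign_mul hε' hε)
  -- In the quotient of the two descending maps K cancels. Since sign maps commute with S, what
  -- remains is φ'⁻¹ R φ for the complement factors, as `eq_of_folds` requires.
  have h4 : S * Ψ'⁻¹ * signUnit ε' hε'.1 * K⁻¹ * (S * Ψ⁻¹ * signUnit ε hε.1 * K⁻¹)⁻¹ =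
      (S * Ψ' * S⁻¹)⁻¹ * R * (S * Ψ * S⁻¹) := by
    calc _ = S * Ψ'⁻¹ * (signUnit ε' hε'.1 * (signUnit ε hε.1)⁻¹) * Ψ * S⁻¹ := by group
      _ = S * Ψ'⁻¹ * S⁻¹ * (S * R) * Ψ * S⁻¹ := by
          rw [inv_signUnit, signUnit_mul hε' hε, ← hR]
          group
      _ = _ := by
          rw [hSR]
          group
  rw [h4] at h3
  have h5 := eq_of_folds (isRealSign_mul hε' hε).1 (hΨ.isComplementZ hS) (hΨ'.isComplementZ hS) h3
  calc Ψ' = S⁻¹ * (S * Ψ' * S⁻¹) * S := by group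
    _ = S⁻¹ * (R * S) * Ψ * S⁻¹ * (R * S) := by rw [h5, ← hR]; group
    _ = R * Ψ * R := by
        rw [← hSR]
        group

/-- One direction compares two descending maps with the same K. In the other, passing from Ψ to R_δ
Ψ R_δ only multiplies the descending map on the left by R_δ, which itself descends. -/
theorem formallyEquivalent_iff_of_formallyEquivalent (hd : SigmaData lam M L)
    (hR : rhoConj (hatTau L) = hatTau L * hatSigma M) (P : FoldCoordinates E h0 L)
    (hΨ : IsNormalizedPsi L Ψ) (hE : FormallyEquivalent E (normalE lam L Ψ))
    (hΨ' : IsNormalizedPsi L Ψ') :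
    FormallyEquivalent E (normalE lam L Ψ') ↔ ∃ ε : Idx e h s → ℂ, IsRealSign ε ∧
      (Ψ' : FormalMap (Idx e h s ⊕ Idx e h s)) = mapR ε * Ψ * mapR ε := by
  obtain ⟨S, hS⟩ := isUnit_straighten hd.L_ne
  obtain ⟨ε, hε, hf⟩ := (hd.formallyEquivalent_normalE_iff hR hS hΨ P).1 hE
  constructor
  · intro hE'
    obtain ⟨ε', hε', hf'⟩ := (hd.formallyEquivalent_normalE_iff hR hS hΨ' P).1 hE'
    exact ⟨_, isRealSign_mul hε' hε, congrArg Units.val (eq_of_folds_both hS hΨ hΨ' hε hε' hf hf')⟩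
  · rintro ⟨δ, hδ, he⟩
    have he' : Ψ' = signUnit δ hδ.1 * Ψ * signUnit δ hδ.1 := Units.ext he
    refine (hd.formallyEquivalent_normalE_iff hR hS hΨ' P).2 ⟨_, isRealSign_mul hδ hε, ?_⟩
    have h1 : S * Ψ'⁻¹ * signUnit (δ * ε) (isRealSign_mul hδ hε).1 * (P.fold * P.coord)⁻¹ =
        signUnit δ hδ.1 * (S * Ψ⁻¹ * signUnit ε hε.1 * (P.fold * P.coord)⁻¹) := by
      rw [← signUnit_mul hδ hε, he']
      calc _ = S * (signUnit δ hδ.1)⁻¹ * Ψ⁻¹ * signUnit ε hε.1 * (P.fold * P.coord)⁻¹ := by group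
        _ = _ := by
          rw [inv_signUnit, commute_signUnit hS hδ]
          group
    rw [h1, Units.val_mul]
    exact (folds_signUnit hδ.1).mul hf

/-- The normal form as a fold. -/
theorem exists_foldCoordinates_normalE (hd : SigmaData lam M L)
    (hS : (S : FormalMap (Idx e h s ⊕ Idx e h s)) = straighten L) (hΨ : IsNormalizedPsi L Ψ) :
    ∃ P : FoldCoordinates (normalE lam L Ψ) (constantCoeff_normalE hd.lam_norm.ne_zero Ψ) L,
      P.outer = 1 ∧ P.fold * P.coord = S * Ψ⁻¹ := by
  obtain ⟨Φ, hΦ⟩ := isUnit_normalPhi hd.lam_norm hd.nonres hd.L_zero hΨ.1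
  have hgr := graphMap_normalE hd.lam_norm.ne_zero Φ hΦ
  rw [← hS, ← Units.val_mul] at hgr
  have h1 : S * Ψ⁻¹ * Φ⁻¹ * Φ = S * Ψ⁻¹ := by group
  refine ⟨⟨1, S * Ψ⁻¹ * Φ⁻¹, Φ, ?_, ?_, ?_⟩, rfl, h1⟩
  · rw [Units.val_one, one_mul, Units.val_mul, ← mul_assoc, ← hgr, mul_assoc, Units.mul_inv,
      mul_one]
  · rw [hΦ, conjBy_normalPhi hd.lam_norm.ne_zero]
  · have hΨτ : ((Ψ⁻¹ : (FormalMap _)ˣ) : FormalMap (Idx e h s ⊕ Idx e h s)) * hatTau L =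
        hatTau L * ((Ψ⁻¹ : (FormalMap _)ˣ) : FormalMap (Idx e h s ⊕ Idx e h s)) :=
      hΨ.2.1.units_inv_left
    rw [h1, Units.val_mul, mul_assoc, hΨτ, ← mul_assoc, ← mul_assoc, hS,
      straighten_mul_hatTau hd.L_ne]

/-- The formal automorphisms of a normal form. -/
theorem mapsManifold_normalE_self_iff (hd : SigmaData lam M L)
    (hR : rhoConj (hatTau L) = hatTau L * hatSigma M) (hΨ : IsNormalizedPsi L Ψ)
    (F : (FormalMap (Idx e h s ⊕ Idx e h s))ˣ) :
    MapsManifold (F : FormalMap (Idx e h s ⊕ Idx e h s)) (normalE lam L Ψ) (normalE lam L Ψ) ↔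
      ∃ ε : Idx e h s → ℂ, IsRealSign ε ∧ mapR ε * Ψ = Ψ * mapR ε ∧
        (F : FormalMap (Idx e h s ⊕ Idx e h s)) = mapL ε := by
  obtain ⟨S, hS⟩ := isUnit_straighten hd.L_ne
  obtain ⟨P, hP1, hPK⟩ := hd.exists_foldCoordinates_normalE hS hΨ
  rw [hd.mapsManifold_normalE_iff hR hS hΨ P, hP1, hPK]
  have key : ∀ (ε : Idx e h s → ℂ) (hε : IsRealSign ε),
      signUnit ε hε.1 * Ψ = Ψ * signUnit ε hε.1 →
      S * Ψ⁻¹ * signUnit ε hε.1 * (S * Ψ⁻¹)⁻¹ = signUnit ε hε.1 := by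
    intro ε hε hc
    calc _ = S * Ψ⁻¹ * (signUnit ε hε.1 * Ψ) * S⁻¹ := by group
      _ = S * signUnit ε hε.1 * S⁻¹ := by
          rw [hc]
          group
      _ = _ := by
          rw [commute_signUnit hS hε]
          group
  constructor
  · rintro ⟨ε, hε, hF⟩
    have hone : IsRealSign (1 : Idx e h s → ℂ) := ⟨fun _ => Or.inl rfl, fun _ => rfl⟩
    have hu1 : signUnit (1 : Idx e h s → ℂ) hone.1 = 1 := by
      ext1
      change mapR 1 = 1
      rw [mapR_eq, ← diagMap_one]
      congr 1
      funext i
      rcases i with i | i <;> rfl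
    have h1 : Folds ((S * Ψ⁻¹ * signUnit 1 hone.1 * (S * Ψ⁻¹)⁻¹ :
        (FormalMap (Idx e h s ⊕ Idx e h s))ˣ) : FormalMap (Idx e h s ⊕ Idx e h s)) := by
      rw [hu1, mul_one, mul_inv_cancel]
      exact ⟨1, by rw [Units.val_one, one_mul, mul_one]⟩
    -- Comparing `F` with the identity, both as self-equivalences of the normal form, gives Ψ = R Ψ
    -- R.
    have h2 := eq_of_folds_both hS hΨ hΨ hone hε h1 ⟨F * 1, hF⟩
    simp only [mul_one] at h2
    have h3 : signUnit ε hε.1 * Ψ = Ψ * signUnit ε hε.1 := by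
      conv_lhs => rw [h2]
      rw [← mul_assoc, ← mul_assoc, signUnit_mul_self hε, one_mul]
    refine ⟨ε, hε, congrArg Units.val h3, ?_⟩
    -- As R_ε commutes with Ψ and S, the inner map reduces to R_ε; cancelling the fold identifies
    -- `F` with L_ε.
    rw [key ε hε h3, Units.val_one, mul_one] at hF
    exact sqMap_cancel (hF.trans (mapL_mul_sqMap hε.1).symm)
  · rintro ⟨ε, hε, hc, hF⟩
    refine ⟨ε, hε, ?_⟩
    rw [key ε hε (Units.ext hc), hF, Units.val_one, mul_one]
    exact mapL_mul_sqMap hε.1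

end SigmaData

end Equivalence

/-! ### Convergence on coordinate subspaces. -/

section Restriction

variable {I : Type} [Fintype I] [DecidableEq I]

theorem IsConvergent.of_mul_X {V : Type} [Finite V] {f : MvPowerSeries V ℂ} {i : V}
    (h : IsConvergent (f * MvPowerSeries.X i)) : IsConvergent f := by
  obtain ⟨K, r, hr, hn⟩ := h
  refine ⟨K * r, r, hr, fun n => ?_⟩
  have h1 := hn (n + Finsupp.single i 1)
  rw [X_def, coeff_add_mul_monomial, mul_one, map_add, Finsupp.degree_single, pow_succ] at h1
  rw [mul_assoc, mul_comm r]
  exact h1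

theorem IsConvergent.of_ofProd {f : MvPowerSeries I ℂ} (h : IsConvergent (ofProd f)) :
    IsConvergent f := by
  obtain ⟨K, r, hr, hn⟩ := h
  refine ⟨K, r ^ 2, by positivity, fun n => ?_⟩
  have h1 := hn (expMap prodExp n)
  rw [coeff_ofProd_expMap] at h1
  have h2 : (expMap (prodExp (I := I)) n).degree = 2 * n.degree := by
    rw [Finsupp.degree_eq_sum, Finsupp.degree_eq_sum, Fintype.sum_sum_type, two_mul]
    simp only [expMap_prodExp_inl, expMap_prodExp_inr]
  rwa [h2, pow_mul] at h1

theorem IsConvergent.ofProd {f : MvPowerSeries I ℂ} (h : IsConvergent f) :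
    IsConvergent (ofProd f) :=
  h.subst constantCoeff_X_mul_X fun _ => (IsConvergent.X _).mul (IsConvergent.X _)

theorem convergent_hatMap_iff {a b : I → MvPowerSeries I ℂ} :
    (hatMap a b).Convergent ↔ (∀ j, IsConvergent (a j)) ∧ ∀ j, IsConvergent (b j) := by
  constructor
  · intro h
    exact ⟨fun j => (h (Sum.inl j)).of_mul_X.of_ofProd, fun j => (h (Sum.inr j)).of_mul_X.of_ofProd⟩
  · rintro ⟨ha, hb⟩ (j | j)
    · exact (ha j).ofProd.mul (IsConvergent.X _)
    · exact (hb j).ofProd.mul (IsConvergent.X _)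

/-- The coordinate projection to the subspace spanned by the coordinates in `S`. -/
def coordProj (S : Finset I) : FormalMap I := diagMap fun k => if k ∈ S then 1 else 0

theorem subst_coordProj_X (S : Finset I) (k : I) :
    subst (coordProj S).comp (X k : MvPowerSeries I ℂ) = if k ∈ S then X k else 0 := by
  rw [subst_X (FormalMap.hasSubst _)]
  change C (if k ∈ S then 1 else 0) * X k = _
  split_ifs
  · rw [map_one, one_mul]
  · rw [map_zero, zero_mul]

theorem coordProj_univ : coordProj (Finset.univ : Finset I) = 1 := by
  rw [coordProj, ← diagMap_one]
  congr 1
  funext k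
  simp

theorem subst_coordProj_erase {f : MvPowerSeries I ℂ} {k : I}
    (hf : ∀ n : I →₀ ℕ, coeff n f ≠ 0 → n k = 0) (S : Finset I) :
    subst (coordProj S).comp f = subst (coordProj (S.erase k)).comp f := by
  ext n
  rw [coordProj, coordProj, coeff_subst_diagMap, coeff_subst_diagMap]
  by_cases hn : coeff n f = 0
  · rw [hn, mul_zero, mul_zero]
  · congr 1
    refine Finset.prod_congr rfl fun i _ => ?_
    by_cases hi : i = k
    · subst hi
      rw [hf n hn, pow_zero, pow_zero]
    · simp [hi]

/-- If a convergent map `N` composed with a map `B` preserving the coordinate subspaces is in rest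
normal form, then `B` converges. -/
theorem convergent_of_isRestNormalForm {N B : FormalMap I} (hN : N.Convergent) (hNj : N.jac = 1)
    (hB : ∀ k, ∃ f, B.comp k = f * X k) (hNB : IsRestNormalForm (N * B).comp) :
    B.Convergent := by
  -- On the subspace spanned by `S`, and for k in `S`, the component (N ∘ B)_k is ζ_k plus a series
  -- free of ζ_k, already convergent by induction on S minus k. For k outside `S` the component B_k
  -- vanishes, being divisible by ζ_k. Inverting `NS`, which is N with its components outside `S`
  -- replaced by the identity, yields B.
  have key : ∀ S : Finset I, (B * coordProj S).Convergent := by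
    intro S
    induction S using Finset.strongInduction with
    | H S ih =>
      let NS : FormalMap I := ⟨fun k => if k ∈ S then N.comp k else X k, fun k => by
        split_ifs
        · exact N.zero_at k
        · exact constantCoeff_X k⟩
      have hNSj : NS.jac = 1 := by
        ext i k
        change coeff _ (if i ∈ S then N.comp i else X i) = _
        split_ifs
        · rw [← FormalMap.jac_apply, hNj]
        · rw [← FormalMap.jac_one]
          rfl
      have hNSc : NS.Convergent := by
        intro k
        change IsConvergent (if k ∈ S then N.comp k else X k)
        split_ifs
        · exact hN k
        · exact IsConvergent.X k
      obtain ⟨u, hu⟩ := FormalMap.isUnit_of_jac_eq_one hNSj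
      have hR : (NS * (B * coordProj S)).Convergent := by
        intro k
        rw [FormalMap.mul_comp]
        change IsConvergent (subst _ (if k ∈ S then N.comp k else X k))
        split_ifs with hk
        · rw [← FormalMap.mul_comp, ← mul_assoc, FormalMap.mul_comp]
          have h1 : (N * B).comp k = X k + ((N * B).comp k - X k) := by ring
          rw [h1, subst_add (FormalMap.hasSubst _), subst_coordProj_X, if_pos hk,
            subst_coordProj_erase fun n hn => (hNB k n hn).2, subst_sub (FormalMap.hasSubst _),
            subst_coordProj_X, if_neg (Finset.notMem_erase k S), sub_zero, ← FormalMap.mul_comp,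
            mul_assoc]
          exact (IsConvergent.X k).add (hN.mul (ih _ (Finset.erase_ssubset hk)) k)
        · rw [subst_X (FormalMap.hasSubst _), FormalMap.mul_comp]
          obtain ⟨f, hf⟩ := hB k
          rw [hf, subst_mul (FormalMap.hasSubst _), subst_coordProj_X, if_neg hk, mul_zero,
            ← map_zero C]
          exact IsConvergent.C 0
      have h2 : B * coordProj S = u⁻¹.val * (NS * (B * coordProj S)) := by
        rw [← hu, ← mul_assoc, Units.inv_mul, one_mul]
      rw [h2]
      exact FormalMap.Convergent.mul (FormalMap.Convergent.inv (hu ▸ hNSc)) hR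
  have := key Finset.univ
  rwa [coordProj_univ, mul_one] at this

end Restriction

/-! ### Convergence of the normalization under a convergent Poincaré–Dulac form. -/

section Convergence

variable {e h s : ℕ} {lam : Idx e h s → ℂ} {M L : Idx e h s → MvPowerSeries (Idx e h s) ℂ}

theorem convergent_straighten (hL : ∀ j, IsConvergent (L j)) (hL0 : ∀ j, constantCoeff (L j) ≠ 0) :
    (straighten L).Convergent := by
  rintro (j | j)
  · exact (IsConvergent.X _).add ((hL j).ofProd.mul (IsConvergent.X _))
  · exact (IsConvergent.X _).sub (((hL j).inv (hL0 j)).ofProd.mul (IsConvergent.X _))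

theorem convergent_hatTau (hL : ∀ j, IsConvergent (L j)) (hL0 : ∀ j, constantCoeff (L j) ≠ 0) :
    (hatTau L).Convergent := by
  rintro (j | j)
  · exact (hL j).ofProd.mul (IsConvergent.X _)
  · exact ((hL j).inv (hL0 j)).ofProd.mul (IsConvergent.X _)

theorem convergent_sigmaOf {τ : FormalMap (Idx e h s ⊕ Idx e h s)} (hτ : τ.Convergent) :
    (sigmaOf τ).Convergent := hτ.mul (hτ.conjBy _ _)

namespace SigmaData

/-- Linear adjustment of the convergent coordinates. -/
theorem exists_convergent_intertwiner (hd : SigmaData lam M L)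
    {σ : FormalMap (Idx e h s ⊕ Idx e h s)} (hσc : σ.Convergent)
    (hPD : HasConvergentPoincareDulac σ) {Θ : (FormalMap (Idx e h s ⊕ Idx e h s))ˣ}
    (hΘ : σ * Θ = Θ * hatSigma M) :
    ∃ (Θ' W : (FormalMap (Idx e h s ⊕ Idx e h s))ˣ)
      (m n a b : Idx e h s → MvPowerSeries (Idx e h s) ℂ),
      Θ'.val.Convergent ∧ Θ = Θ' * W ∧ W.val = hatMap a b ∧ W.val.jac = 1 ∧
      (hatMap m n).Convergent ∧ hatMap m n * W = W * hatSigma M := by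
  obtain ⟨Θc, σ', hΘc, hσ', hσPD⟩ := hPD
  -- This linear correction makes the remaining intertwiner `W` tangent to the identity. The
  -- corrected Poincaré–Dulac form then has the diagonal linear part of σ̂, so both it and `W`
  -- contain only resonant terms.
  obtain ⟨P, hP⟩ : IsUnit (Θc⁻¹ * Θ).val.linPart := by
    rw [FormalMap.linPart_eq]
    exact FormalMap.isUnit_ofMatrix (FormalMap.isUnit_iff_jac.1 (Θc⁻¹ * Θ).isUnit)
  have hPlin : P.val.linPart = P := by
    rw [hP, FormalMap.linPart_eq (Θc⁻¹ * Θ).val, FormalMap.linPart_ofMatrix]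
  have hPinv : P⁻¹.val.linPart = P⁻¹ := by
    have h1 : P⁻¹.val.linPart * P.val = 1 := by
      conv_lhs => rw [← hPlin]
      rw [← FormalMap.linPart_mul, Units.inv_mul, FormalMap.linPart_eq, FormalMap.jac_one,
        FormalMap.ofMatrix_one]
    rw [← Units.mul_left_inj P, h1, Units.inv_mul]
  have hPc : P.val.Convergent := by
    rw [hP, FormalMap.linPart_eq]
    exact FormalMap.convergent_ofMatrix _
  have hΘ'c : (Θc * P).val.Convergent := hΘc.mul hPc
  set W : (FormalMap (Idx e h s ⊕ Idx e h s))ˣ := P⁻¹ * (Θc⁻¹ * Θ) with hW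
  have hWj : W.val.jac = 1 := by
    have h1 : P.val.jac = (Θc⁻¹ * Θ).val.jac := by
      rw [hP, FormalMap.linPart_eq, FormalMap.jac_ofMatrix]
    rw [hW, Units.val_mul, FormalMap.jac_mul, ← h1, ← FormalMap.jac_mul, Units.inv_mul,
      FormalMap.jac_one]
  have hΘW : Θ = Θc * P * W := by
    rw [hW]
    group
  obtain ⟨σ₂, hσ₂⟩ : ∃ σ₂, σ₂ = P⁻¹.val * σ' * P.val := ⟨_, rfl⟩
  have h1 : σ * (Θc * P).val = (Θc * P).val * σ₂ := by
    rw [hσ₂, Units.val_mul, ← mul_assoc, hσ', mul_assoc Θc.val P.val, ← mul_assoc P.val,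
      ← mul_assoc P.val, Units.mul_inv, one_mul, mul_assoc]
  have hσ₂c : σ₂.Convergent := by
    have h2 : σ₂ = (Θc * P)⁻¹.val * (σ * (Θc * P).val) := by
      rw [h1, ← mul_assoc, Units.inv_mul, one_mul]
    rw [h2]
    exact hΘ'c.inv.mul (hσc.mul hΘ'c)
  have h2 : σ₂ * W.val = W.val * hatSigma M := by
    rw [← Units.mul_right_inj (Θc * P), ← mul_assoc, ← h1, mul_assoc, ← Units.val_mul, ← hΘW, hΘ,
      hΘW, Units.val_mul, mul_assoc]
  have hMj := jac_hatSigma hd.M_zero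
  have hσ₂j : σ₂.jac = Matrix.diagonal (sigmaEig fun j => lam j ^ 2) := by
    have := congrArg FormalMap.jac h2
    rwa [FormalMap.jac_mul, FormalMap.jac_mul, hWj, mul_one, one_mul, hMj] at this
  have hσ₂d : Commute σ₂ (diagMap (sigmaEig fun j => lam j ^ 2)) := by
    have h3 : diagMap (sigmaEig fun j => lam j ^ 2) = P⁻¹.val * σ'.linPart * P.val := by
      rw [diagMap_eq, ← hσ₂j, ← FormalMap.linPart_eq, hσ₂, FormalMap.linPart_mul,
        FormalMap.linPart_mul, hPinv, hPlin]
    have h4 : ∀ A B : FormalMap (Idx e h s ⊕ Idx e h s),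
        P⁻¹.val * A * P.val * (P⁻¹.val * B * P.val) = P⁻¹.val * (A * B) * P.val := by
      intro A B
      calc _ = P⁻¹.val * A * (P.val * P⁻¹.val) * B * P.val := by simp only [mul_assoc]
        _ = _ := by
          rw [Units.mul_inv, mul_one]
          simp only [mul_assoc]
    rw [h3, hσ₂, Commute, SemiconjBy, h4, h4, hσPD.eq]
  obtain ⟨m, n, rfl⟩ := exists_hatMap_of_commute hd.mu_ne hd.nonres hσ₂d
  obtain ⟨a, b, hab⟩ := exists_hatMap_of_commute hd.mu_ne hd.nonres
    (commute_diagMap_of_intertwine (commute_hatMap_diagMap hd.mu_ne _ _) hσ₂d hMj hσ₂j h2)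
  exact ⟨Θc * P, W, m, n, a, b, hΘ'c, hΘW, hab, hWj, hσ₂c, h2⟩

/-- Solving for the coefficients of an intertwiner of `σ̂` with a convergent normal form. -/
theorem convergent_mul_and_convergent (hd : SigmaData lam M L)
    {m a b : Idx e h s → MvPowerSeries (Idx e h s) ℂ} (hm : ∀ j, IsConvergent (m j))
    (ha0 : ∀ j, constantCoeff (a j) = 1) (hb0 : ∀ j, constantCoeff (b j) = 1)
    (hmM : ∀ j, subst (scaleMap (a * b)).comp (m j) = M j) :
    (∀ j, IsConvergent ((a * b) j)) ∧ ∀ j, IsConvergent (M j) := by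
  have hm0 : ∀ j, constantCoeff (m j) ≠ 0 := by
    intro j
    rw [← constantCoeff_subst_zero (scaleMap (a * b)).zero_at, hmM]
    exact hd.M_ne j
  -- Logarithms turn M = m ∘ B into (log m) ∘ B = log M with log m convergent, the setting of
  -- `convergent_of_isRestNormalForm`.
  have hNB : logMap m hm0 * scaleMap (a * b) = logMap M hd.M_ne := by
    ext1
    funext j
    rw [logMap_mul_comp, hmM, ← logM_eq]
    rfl
  have hBj : (scaleMap (a * b)).jac = 1 := by
    ext i k
    have h0 : (scaleMap (a * b)).comp i = a i * b i * X i := rfl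
    have h1 : AgreeTo 2 (a i * b i * X i) (X i) := by
      rw [← AgreeTo.sub_zero_iff]
      have h2 : a i * b i * X i - X i = (a i * b i - 1) * X i := by ring
      rw [h2]
      exact (AgreeTo.one_of_constantCoeff (by simp [ha0, hb0])).mul_zero
        (AgreeTo.one_of_constantCoeff (constantCoeff_X i))
    rw [← FormalMap.jac_one, FormalMap.jac_apply, FormalMap.jac_apply, h0, FormalMap.one_comp]
    exact h1 _ (by rw [Finsupp.degree_single]; exact one_lt_two)
  have hNj : (logMap m hm0).jac = 1 := by
    have h1 : (logMap M hd.M_ne).jac = 1 := isUnit_of_isRestNormalForm hd.rest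
    rwa [← hNB, FormalMap.jac_mul, hBj, mul_one] at h1
  have hNc : (logMap m hm0).Convergent := by
    intro j
    change IsConvergent (logM m j)
    rw [logM_eq]
    exact (IsConvergent.C _).mul ((hm j).logQuot (hm0 j))
  have hBc : (scaleMap (a * b)).Convergent :=
    convergent_of_isRestNormalForm hNc hNj (fun k => ⟨_, rfl⟩) (by rw [hNB]; exact hd.rest)
  have hab : ∀ j, IsConvergent ((a * b) j) := fun j => (hBc j).of_mul_X
  refine ⟨hab, fun j => ?_⟩
  rw [← hmM j]
  exact (hm j).subst (scaleMap (a * b)).zero_at hBc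

/-- The equation for σ controls only the product a b. So W is split as (ξ, η) ↦ (ab·ξ, η) after T =
(b⁻¹ξ, bη). In the convergent coordinates Θ' W T⁻¹ the involution τ₁ is T τ̂₁ T⁻¹ = T² τ̂₁, so T²
converges; this gives b², and then b. -/
theorem convergent_of_convergent_mul (hd : SigmaData lam M L)
    {τ : FormalMap (Idx e h s ⊕ Idx e h s)} (hτc : τ.Convergent)
    {Θ Θ' W : (FormalMap (Idx e h s ⊕ Idx e h s))ˣ}
    (hΘτ : τ * Θ = Θ * hatTau L) (hΘ'c : Θ'.val.Convergent) (hΘW : Θ = Θ' * W)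
    {a b : Idx e h s → MvPowerSeries (Idx e h s) ℂ} (hWab : W.val = hatMap a b)
    (hb0 : ∀ j, constantCoeff (b j) = 1) (hab : ∀ j, IsConvergent ((a * b) j))
    (hLc : ∀ j, IsConvergent (L j)) : Θ.val.Convergent := by
  have hb0' : ∀ j, constantCoeff (b j) ≠ 0 := fun j => by
    rw [hb0]
    exact one_ne_zero
  obtain ⟨d, hd'⟩ : ∃ d : Idx e h s → MvPowerSeries (Idx e h s) ℂ, d = fun j => (b j)⁻¹ := ⟨_, rfl⟩
  have hbd : b * d = 1 := hd' ▸ mul_inv_eq_one_of hb0'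
  have hdb : d * b = 1 := by rw [mul_comm, hbd]
  have h1 : hatMap b d * hatMap d b = 1 := by
    rw [hatMap_mul_of_mul_eq_one _ _ hdb, hbd, hdb, hatMap_one]
  have h2 : hatMap d b * hatMap b d = 1 := by
    rw [hatMap_mul_of_mul_eq_one _ _ hbd, hbd, hdb, hatMap_one]
  obtain ⟨T, hT⟩ : IsUnit (hatMap d b) := ⟨⟨_, _, h2, h1⟩, rfl⟩
  obtain ⟨W₁, hW₁⟩ : ∃ W₁, W₁ = W * T⁻¹ := ⟨_, rfl⟩
  have hTi : T⁻¹.val = hatMap b d := by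
    rw [← Units.mul_right_inj T, Units.mul_inv, hT, h2]
  have hW₁c : W₁.val.Convergent := by
    have : W₁.val = hatMap (a * b) 1 := by
      rw [hW₁, Units.val_mul, hWab, hTi, hatMap_mul_of_mul_eq_one _ _ hbd, hbd]
    rw [this, convergent_hatMap_iff]
    refine ⟨hab, fun j => ?_⟩
    rw [Pi.one_apply, ← map_one C]
    exact IsConvergent.C 1
  have hΘ₁c : (Θ' * W₁).val.Convergent := hΘ'c.mul hW₁c
  have hΘT : Θ = Θ' * W₁ * T := by
    rw [hΘW, hW₁]
    group
  have hτ₁ : (Θ' * W₁)⁻¹.val * (τ * (Θ' * W₁).val) = hatMap (d * d) (b * b) * hatTau L := by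
    have h3 : τ * (Θ' * W₁).val = (Θ' * W₁).val * (T.val * hatTau L * T⁻¹.val) := by
      have h4 : Θ' * W₁ = Θ * T⁻¹ := by
        rw [hΘT]
        group
      calc τ * (Θ' * W₁).val = τ * Θ.val * T⁻¹.val := by rw [h4, Units.val_mul, mul_assoc]
        _ = (Θ' * W₁).val * (T.val * hatTau L * T⁻¹.val) := by
          rw [hΘτ, hΘT, Units.val_mul (Θ' * W₁)]
          simp only [mul_assoc]
    rw [h3, ← mul_assoc, Units.inv_mul, one_mul, hT, hTi, mul_assoc,
      swapMap_hatTau_comm hbd hd.L_ne, ← mul_assoc, hatMap_mul_of_mul_eq_one _ _ hdb]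
  have hbb : (hatMap (d * d) (b * b)).Convergent := by
    have h3 : hatMap (d * d) (b * b) =
        (Θ' * W₁)⁻¹.val * (τ * (Θ' * W₁).val) * hatTau L := by
      rw [hτ₁, mul_assoc, hatTau_mul_self hd.L_ne, mul_one]
    rw [h3]
    exact (hΘ₁c.inv.mul (hτc.mul hΘ₁c)).mul (convergent_hatTau hLc hd.L_ne)
  have hbc : ∀ j, IsConvergent (b j) := fun j => by
    refine IsConvergent.of_sq ?_ (hb0' j)
    rw [sq]
    exact (convergent_hatMap_iff.1 hbb).2 j
  have hTc : T.val.Convergent := by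
    rw [hT, convergent_hatMap_iff]
    refine ⟨fun j => ?_, hbc⟩
    rw [hd']
    exact (hbc j).inv (hb0' j)
  rw [hΘT, Units.val_mul]
  exact hΘ₁c.mul hTc

/-- Convergence of the normal form `σ̂` and of the normalizing coordinates. -/
theorem convergent_of_poincareDulac (hd : SigmaData lam M L)
    {τ : FormalMap (Idx e h s ⊕ Idx e h s)} (hτc : τ.Convergent)
    (hPD : HasConvergentPoincareDulac (sigmaOf τ)) {Θ : (FormalMap (Idx e h s ⊕ Idx e h s))ˣ}
    (hΘτ : τ * Θ = Θ * hatTau L) (hΘ : sigmaOf τ * Θ = Θ * hatSigma M) :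
    (∀ j, IsConvergent (L j)) ∧ Θ.val.Convergent := by
  obtain ⟨Θ', W, m, n, a, b, hΘ'c, hΘW, hWab, hWj, hmn, hσW⟩ :=
    hd.exists_convergent_intertwiner (convergent_sigmaOf hτc) hPD hΘ
  have hm := (convergent_hatMap_iff.1 hmn).1
  rw [hWab, jac_hatMap] at hWj
  have ha0 : ∀ j, constantCoeff (a j) = 1 := by
    intro j
    have := congrFun (congrFun hWj (Sum.inl j)) (Sum.inl j)
    rwa [Matrix.diagonal_apply_eq, Matrix.one_apply_eq] at this
  have hb0 : ∀ j, constantCoeff (b j) = 1 := by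
    intro j
    have := congrFun (congrFun hWj (Sum.inr j)) (Sum.inr j)
    rwa [Matrix.diagonal_apply_eq, Matrix.one_apply_eq] at this
  have hane : ∀ j, a j ≠ 0 := by
    intro j hj
    have := ha0 j
    rw [hj, map_zero] at this
    exact zero_ne_one this
  rw [hWab, hatSigma_eq, hatMap_mul_of_mul_eq_one a b (mul_inv_eq_one_of hd.M_ne), hatMap_mul]
    at hσW
  have hmM : ∀ j, subst (scaleMap (a * b)).comp (m j) = M j := by
    intro j
    have := congrFun (hatMap_injective hσW).1 j
    simp only [Pi.mul_apply] at this
    rw [mul_comm] at this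
    exact mul_left_cancel₀ (hane j) this
  obtain ⟨hab, hMc⟩ := hd.convergent_mul_and_convergent hm ha0 hb0 hmM
  have hLc : ∀ j, IsConvergent (L j) := fun j => by
    refine IsConvergent.of_sq ?_ (hd.L_ne j)
    rw [hd.L_sq j]
    exact hMc j
  exact ⟨hLc, hd.convergent_of_convergent_mul hτc hΘτ hΘ'c hΘW hWab hb0 hab hLc⟩

end SigmaData

theorem IsConvergent.of_coeff {V : Type} {f g : MvPowerSeries V ℂ} (hf : IsConvergent f)
    (h : ∀ n, coeff n g = coeff n f ∨ coeff n g = 0) : IsConvergent g := by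
  obtain ⟨K, r, hr, hn⟩ := hf
  have hK : 0 ≤ K := by simpa using (norm_nonneg _).trans (hn 0)
  refine ⟨K, r, hr, fun n => ?_⟩
  rcases h n with h | h
  · rw [h]
    exact hn n
  · rw [h, norm_zero]
    positivity

theorem convergent_evenPart {I : Type} [Fintype I] [DecidableEq I] {F : FormalMap (I ⊕ I)}
    (hF : F.Convergent) : (evenPart F).Convergent := by
  classical
  intro i
  refine (hF i).of_coeff fun n => ?_
  rw [coeff_evenPart]
  split_ifs
  · exact Or.inl rfl
  · exact Or.inr rfl

theorem convergent_mapR {I : Type} [Fintype I] [DecidableEq I] (ε : I → ℂ) :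
    (mapR ε).Convergent := by
  rw [mapR_eq, diagMap_eq]
  exact FormalMap.convergent_ofMatrix _

/-- The factors of a convergent product of a complement factor and a map that folds. -/
theorem convergent_of_complement_mul_folds {I : Type} [Fintype I] [DecidableEq I]
    {Y φ H : (FormalMap (I ⊕ I))ˣ} (hYc : Y.val.Convergent) (hY : Folds Y.val.linPart)
    (hφ : IsComplementZ φ.val) (hH : Folds H.val) (h : Y = φ * H) :
    φ.val.Convergent ∧ H.val.Convergent := by
  rw [isComplementZ_iff] at hφ
  obtain ⟨P, hP⟩ := hY.isUnit
  rw [← hP] at hY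
  have hPc : P.val.Convergent := by
    rw [hP, FormalMap.linPart_eq]
    exact FormalMap.convergent_ofMatrix _
  have hPj : P.val.jac = H.val.jac := by
    rw [hP, FormalMap.linPart_eq, FormalMap.jac_ofMatrix, h, Units.val_mul, FormalMap.jac_mul,
      hφ.1, one_mul]
  have hGj : (H * P⁻¹).val.jac = 1 := by
    rw [Units.val_mul, FormalMap.jac_mul, ← hPj, ← FormalMap.jac_mul, Units.mul_inv,
      FormalMap.jac_one]
  have hGf : Folds (H * P⁻¹).val := hH.mul hY.inv
  -- The descending factor is recovered from the convergent `Y * P⁻¹` by `evenPart`, which merely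
  -- discards coefficients.
  have h1 : evenPart (Y * P⁻¹).val = (H * P⁻¹).val := by
    rw [h, mul_assoc, Units.val_mul φ, evenPart_mul _ (hGf.signEquivariant hGj), hφ.2, one_mul]
  have hGc : (H * P⁻¹).val.Convergent := h1 ▸ convergent_evenPart (hYc.mul hPc.inv)
  have hHc : H.val.Convergent := by
    have : H = H * P⁻¹ * P := by group
    rw [this]
    exact hGc.mul hPc
  refine ⟨?_, hHc⟩
  have : φ = Y * H⁻¹ := by
    rw [h]
    group
  rw [this]
  exact hYc.mul hHc.inv

namespace SigmaData

variable {E : Idx e h s → MvPowerSeries (Idx e h s ⊕ Idx e h s) ℂ}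
  {h0 : ∀ j, constantCoeff (E j) = 0} {S Ψ : (FormalMap (Idx e h s ⊕ Idx e h s))ˣ}

theorem convergent_linearE (lam : Idx e h s → ℂ) : (linearE lam).Convergent := by
  rintro (j | j)
  · exact (IsConvergent.C _).mul
      ((IsConvergent.X _).sub ((IsConvergent.C _).mul (IsConvergent.X _)))
  · exact (IsConvergent.C _).mul
      (((IsConvergent.C _).mul (IsConvergent.X _)).add (IsConvergent.X _))

theorem convergent_normalE (hd : SigmaData lam M L) (hL : ∀ j, IsConvergent (L j))
    (hΨ : IsNormalizedPsi L Ψ) (hΨc : Ψ.val.Convergent) (j : Idx e h s) :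
    IsConvergent (normalE lam L Ψ j) := by
  have hUV : (mapUV lam L Ψ).Convergent :=
    ((convergent_linearE lam).mul (convergent_straighten hL hd.L_ne)).mul hΨc.inv
  have hΦc : (normalPhi lam L Ψ).Convergent := by
    have hf : ∀ j, IsConvergent ((normalPhi lam L Ψ).comp (Sum.inl j)) := fun j =>
      (hUV (Sum.inl j)).add ((IsConvergent.C _).mul (hUV (Sum.inr j)))
    rintro (j | j)
    · exact hf j
    · exact (hf j).conjPull _
  obtain ⟨Φ, hΦ⟩ := isUnit_normalPhi hd.lam_norm hd.nonres hd.L_zero hΨ.1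
  rw [normalE, ← hΦ, FormalMap.inv_eq]
  rw [← hΦ] at hΦc
  exact IsConvergent.subst (IsConvergent.pow
    (((IsConvergent.C _).mul (hUV (Sum.inl j))).sub (hUV (Sum.inr j))) 2)
    (FormalMap.zero_at _) hΦc.inv

/-- Any formal equivalence converges: R_ε S K⁻¹ is convergent and equals S Ψ S⁻¹ times the
descending inner map, so both factors converge, hence so does Ψ. The outer map then converges
because it is induced from a convergent map through the fold. -/
theorem holomorphicallyEquivalent_normalE (hd : SigmaData lam M L)
    (hR : rhoConj (hatTau L) = hatTau L * hatSigma M) (hL : ∀ j, IsConvergent (L j))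
    (hS : S.val = straighten L) (P : FoldCoordinates E h0 L)
    (hP : Folds (S * (P.fold * P.coord)⁻¹).val.linPart) (hPo : P.outer.val.Convergent)
    (hPf : P.fold.val.Convergent) (hPc : P.coord.val.Convergent) (hΨ : IsNormalizedPsi L Ψ)
    (hE : FormallyEquivalent E (normalE lam L Ψ)) :
    (∀ j, IsConvergent (normalE lam L Ψ j)) ∧
      HolomorphicallyEquivalent E (normalE lam L Ψ) := by
  obtain ⟨F, hF⟩ := hE
  obtain ⟨ε, hε, h1⟩ := (hd.mapsManifold_normalE_iff hR hS hΨ P F).1 hF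
  obtain ⟨H, hH⟩ : ∃ H, H = S * Ψ⁻¹ * signUnit ε hε.1 * (P.fold * P.coord)⁻¹ := ⟨_, rfl⟩
  rw [← hH] at h1
  have hSc : S.val.Convergent := hS ▸ convergent_straighten hL hd.L_ne
  have hRc : (signUnit ε hε.1).val.Convergent := convergent_mapR ε
  obtain ⟨Y, hY⟩ : ∃ Y, Y = signUnit ε hε.1 * (S * (P.fold * P.coord)⁻¹) := ⟨_, rfl⟩
  have hYc : Y.val.Convergent := by
    rw [hY]
    exact hRc.mul (hSc.mul (FormalMap.Convergent.inv (hPf.mul hPc)))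
  have hRlin : (signUnit ε hε.1).val.linPart = (signUnit ε hε.1).val := by
    rw [val_signUnit, mapR_eq, diagMap_eq, FormalMap.linPart_ofMatrix]
  have hYf : Folds Y.val.linPart := by
    rw [hY, Units.val_mul, FormalMap.linPart_mul, hRlin]
    exact (folds_signUnit hε.1).mul hP
  have hYH : Y = S * Ψ * S⁻¹ * H := by
    rw [hY, hH]
    calc _ = signUnit ε hε.1 * S * (P.fold * P.coord)⁻¹ := by group
      _ = _ := by
        rw [← commute_signUnit hS hε]
        group
  obtain ⟨hφc, hHc⟩ := convergent_of_complement_mul_folds hYc hYf (hΨ.isComplementZ hS)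
    ⟨F * P.outer, h1⟩ hYH
  have hΨc : Ψ.val.Convergent := by
    have : Ψ = S⁻¹ * (S * Ψ * S⁻¹) * S := by group
    rw [this]
    exact (hSc.inv.mul hφc).mul hSc
  refine ⟨hd.convergent_normalE hL hΨ hΨc, F, ?_, hF⟩
  have hFo : (F * P.outer).val.Convergent :=
    convergent_of_fold h1 (convergent_sqMap.mul hHc)
  have : F = F * P.outer * P.outer⁻¹ := by group
  rw [this]
  exact hFo.mul hPo.inv

end SigmaData

end Convergence

end CRNormalForm

end

/-! ### Assembly of the theorem. -/

open CRNormalForm MvPowerSeries in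
theorem theorem1p4 {e h s : ℕ}
    -- the submanifold `M`
    (g : QuadricInvariants e h s)
    (E : Idx e h s → MvPowerSeries (Idx e h s ⊕ Idx e h s) ℂ)
    (hE : ∀ j, IsConvergent (E j))
    (hEQ : IsHigherOrderPerturbation E g.quadric)
    (hD : ConditionD E)
    -- its involution `τ₁`, and the normal form of its `σ`
    (τ : (FormalMap (Idx e h s ⊕ Idx e h s))ˣ)
    (hτ : IsPrincipalDeck E τ)
    (lam : Idx e h s → ℂ)
    (hlam : NormalizedMultipliers lam)
    (hres : NonResonant fun j => lam j ^ 2)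
    (M L : Idx e h s → MvPowerSeries (Idx e h s) ℂ)
    (hL0 : ∀ j, constantCoeff (L j) = lam j)
    (hLM : ∀ j, L j ^ 2 = M j)
    (hM : IsRestNormalForm (logM M))
    (hσ : HasSigmaNormalForm (τ : FormalMap (Idx e h s ⊕ Idx e h s)) lam M) :
    -- the normal form is a formal submanifold, and `M` is formally equivalent to one
    (∀ Ψ, IsNormalizedPsi L Ψ → IsUnit (normalPhi lam L Ψ)) ∧
    (∃ Ψ, IsNormalizedPsi L Ψ ∧ FormallyEquivalent E (normalE lam L Ψ)) ∧
    ∀ Ψ, IsNormalizedPsi L Ψ → FormallyEquivalent E (normalE lam L Ψ) →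
      -- uniqueness of `Ψ`
      (∀ Ψ', IsNormalizedPsi L Ψ' →
        (FormallyEquivalent E (normalE lam L Ψ') ↔
          ∃ ε : Idx e h s → ℂ, IsRealSign ε ∧
            (Ψ' : FormalMap (Idx e h s ⊕ Idx e h s)) = mapR ε * Ψ * mapR ε)) ∧
      -- the formal automorphism group
      (∀ F : (FormalMap (Idx e h s ⊕ Idx e h s))ˣ,
        MapsManifold (F : FormalMap (Idx e h s ⊕ Idx e h s))
            (normalE lam L Ψ) (normalE lam L Ψ) ↔
          ∃ ε : Idx e h s → ℂ, IsRealSign ε ∧ mapR ε * Ψ = Ψ * mapR ε ∧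
            (F : FormalMap (Idx e h s ⊕ Idx e h s)) = mapL ε) ∧
      -- convergence
      (HasConvergentPoincareDulac (sigmaOf (τ : FormalMap (Idx e h s ⊕ Idx e h s))) →
        (∀ j, IsConvergent (normalE lam L Ψ j)) ∧
          HolomorphicallyEquivalent E (normalE lam L Ψ)) := by
  have hd : SigmaData lam M L := ⟨hlam, hres, hL0, hLM, hM⟩
  choose c α d hc hQ using g.exists_eq
  have h0 := QuadricInvariants.constantCoeff_of_perturbation hEQ
  obtain ⟨B, F, hB, hF, hBj, hgr, hBτ⟩ := exists_fold_coordinates idxPerm_involutive hE hc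
    (fun j n hn => (hEQ j n hn).trans (by rw [hQ])) hD h0
  have hBτ := hBτ τ hτ
  -- τ₁ is conjugate to the simultaneous sign change, hence an involution.
  have hττ : τ.val * τ.val = 1 := by
    rw [← Units.mul_right_inj B, ← mul_assoc, hBτ, mul_assoc, hBτ, ← mul_assoc, flip_mul_self,
      one_mul, mul_one]
  obtain ⟨hR, Θ, hΘρ, hΘτ, hΘσ⟩ := hd.exists_coordinates hττ hσ
  obtain ⟨S, hS⟩ := isUnit_straighten hd.L_ne
  let P : FoldCoordinates E h0 L := ⟨F, B, Θ, hgr, hΘρ, by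
    rw [Units.val_mul, mul_assoc, ← hΘτ, ← mul_assoc, hBτ, mul_assoc]⟩
  have hP : Folds (S * (P.fold * P.coord)⁻¹).val.linPart :=
    folds_linPart idxPerm_involutive hd.mu_ne hd.nonres hlam.ne_zero hd.M_zero hL0 hBj hBτ hΘτ hΘσ
      (by rw [← Units.val_mul, inv_mul_cancel_right, hS])
  refine ⟨fun Ψ hΨ => isUnit_normalPhi hlam hres hL0 hΨ.1, hd.exists_normalized hR hS P hP,
    fun Ψ hΨ hEΨ => ⟨fun Ψ' hΨ' =>
      hd.formallyEquivalent_iff_of_formallyEquivalent hR P hΨ hEΨ hΨ',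
      hd.mapsManifold_normalE_self_iff hR hΨ, fun hPD => ?_⟩⟩
  obtain ⟨hLc, hΘc⟩ := hd.convergent_of_poincareDulac hτ.1.1 hPD hΘτ hΘσ
  exact hd.holomorphicallyEquivalent_normalE hR hLc hS P hP hF hB hΘc hΨ hEΨ
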